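/- **Setting.** Let $N,M\ge 0$, $\kappa>0$, $\kappa_I\in\{\kappa,16/\kappa\}$ for $I=1,\dots,N$, and $h_{y_K}\in\mathbb R$ for $K=1,\dots,M$. Put $h_{x_I}=\frac{6-\kappa_I}{2\kappa_I}$ and $c=\frac{(6-\kappa)(3\kappa-8)}{2\kappa}$. Fix distinct reals $X^1_0,\dots,X^N_0,Y^1_0,\dots,Y^M_0$. Let $S\subset\mathbb R^{N+M}$ be the set of points $(x_1,\dots,x_N,y_1,\dots,y_M)$ whose coordinates are ordered on the line in the same way as these numbers, and let $\mathcal F=C^\infty(S\to\mathbb C)[f_{-2},f_{-3},\dots]$. Write $f(u)=u+\sum_{m\le-2}f_mu^{1+m}$ and $Sf=\frac{f'''}{f'}-\frac32\big(\frac{f''}{f'}\big)^2$, both in $\mathcal F((u^{-1}))$. Let $\mathrm{Res}_u$ denote the coefficient of $u^{-1}$; for an element $x$, the expression $\frac1{(f(u)-x)^{1+j}}$ is expanded as $\sum_{m\ge0}\binom mj f(u)^{-1-m}x^{m-j}$, and likewise $\frac1{f(z)-f(u)}=\sum_{m\ge0}f(z)^{-1-m}f(u)^m$. For $n\in\mathbb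 Z$ define operators on $\mathcal F$ by $$\mathcal L_n=\mathrm{Res}_u\,u^{1-n}\Big\{\tfrac c{12}Sf(u)-\sum_{l\le-2}\mathrm{Res}_z\,f'(u)^2z^{-2-l}\tfrac1{f(z)-f(u)}\,\partial_{f_l}+\sum_{I}f'(u)^2\Big(\tfrac{h_{x_I}}{(f(u)-x_I)^2}+\tfrac1{f(u)-x_I}\partial_{x_I}\Big)+\sum_{K}f'(u)^2\Big(\tfrac{h_{y_K}}{(f(u)-y_K)^2}+\tfrac1{f(u)-y_K}\partial_{y_K}\Big)\Big\},$$ and for $I=1,\dots,N$ $$\mathcal D_I=\tfrac{\kappa_I}2\partial_{x_I}^2+\sum_{J\ne I}\Big(\tfrac2{x_J-x_I}\partial_{x_J}+\tfrac{(\kappa_J-6)/\kappa_J}{(x_J-x_I)^2}\Big)+\sum_{K=1}^M\Big(\tfrac2{y_K-x_I}\partial_{y_K}-\tfrac{2h_{y_K}}{(y_K-x_I)^2}\Big),$$ $$\mathcal A_I=\mathcal D_I+2\sum_{m\le-2}\Big(\mathrm{Res}_v\,v^{-2-m}\tfrac1{f(v)-x_I}\Big)\partial_{f_m}.$$ Let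 $\mathrm{vir}$ be the Virasoro algebra, with basis $L_n$ ($n\in\mathbb Z$), $C$, with $C$ central and $[L_n,L_m]=(n-m)L_{n+m}+\frac{n^3-n}{12}\delta_{n+m,0}C$. **Statement.** The assignment $L_n\mapsto\mathcal L_n$, $C\mapsto c\cdot\mathrm{id}$ makes $\mathcal F$ a $\mathrm{vir}$-module, and $\bigcap_I\ker\mathcal A_I$ is a submodule of it. Let $Z\in C^\infty(S\to\mathbb R_{>0})$, regarded as an element of $\mathcal F$ (a constant polynomial in the $f_l$), satisfy the null field equations $\mathcal D_IZ=0$ for all $I$, and let $\mathcal M=\mathcal U(\mathrm{vir})Z$. Then: 1. $\mathcal M$ is a submodule of $\mathcal F$ and $\mathcal M\subset\bigcap_I\ker\mathcal A_I$. 2. $\mathcal L_nZ=0$ for all $n\ge2$, and $\mathcal M$ is spanned by the elements $\mathcal L_{-m}^{n_{-m}}\cdots\mathcal L_0^{n_0}\mathcal L_1^{n_1}Z$ with $m\ge-1$ and $n_j\in\mathbb N$ (including $0$) for $j=-m,\dots,1$. 3. If (c) $Z(x_1+\sigma,\dots,y_M+\sigma)=Z(x_1,\dots,y_M)$ for all $\sigma\in\mathbb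 R$, then $\mathcal L_1Z=0$. 4. If (d) for some $\Delta\in\mathbb R$ one has $Z(\lambda x_1,\dots,\lambda y_M)=\lambda^\Delta Z(x_1,\dots,y_M)$ for all $\lambda>0$, then $\mathcal L_0Z=\big(\Delta+\sum_Ih_{x_I}+\sum_Kh_{y_K}\big)Z$. 5. If (c) and (d) hold, then $\mathcal M$ is a highest weight module for $\mathrm{vir}$ of central charge $c$, with highest weight vector $Z$ and highest weight $\Delta+\sum_Ih_{x_I}+\sum_Kh_{y_K}$; that is, $Z\ne0$, $\mathcal M=\mathcal U(\mathrm{vir})Z$, $\mathcal L_nZ=0$ for all $n>0$, $\mathcal L_0Z=\big(\Delta+\sum_Ih_{x_I}+\sum_Kh_{y_K}\big)Z$, and $C$ acts on $\mathcal M$ as $c$. -/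

import Mathlib

open scoped ContDiff

attribute [local instance 100] LieRing.ofAssociativeRing

noncomputable section

namespace SLEVir

/-! ## Smooth functions on the set of configurations with a given order -/

section Smooth

variable {ι : Type}

/-- The set `S` of points of `ℝ^ι` whose coordinates are ordered on the real line in the same way
as the (pairwise distinct) numbers `q i`. -/
def chamber (q : ι → ℝ) : Set (ι → ℝ) := {p | ∀ i j, q i < q j → p i < p j}

theorem isOpen_chamber [Finite ι] (q : ι → ℝ) : IsOpen (chamber q) := by
  have h : chamber q = ⋂ i, ⋂ j, ⋂ (_ : q i < q j), {p : ι → ℝ | p i < p j} := by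
    ext p; simp [chamber]
  rw [h]
  refine isOpen_iInter_of_finite fun i => isOpen_iInter_of_finite fun j =>
    isOpen_iInter_of_finite fun _ => isOpen_lt (by fun_prop) (by fun_prop)

/-- Extension by zero of a function on `S` to the whole space. -/
def extZero {q : ι → ℝ} (φ : chamber q → ℂ) : (ι → ℝ) → ℂ :=
  Function.extend Subtype.val φ 0

theorem extZero_apply {q : ι → ℝ} (φ : chamber q → ℂ) (p : ι → ℝ) (hp : p ∈ chamber q) :
    extZero φ p = φ ⟨p, hp⟩ :=
  Subtype.val_injective.extend_apply φ 0 ⟨p, hp⟩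

/-- The algebra `C^∞(S → ℂ)`, as a subalgebra of all functions on `S`; smoothness is real
smoothness on the open set `S`. -/
def smoothSubalgebra [Fintype ι] (q : ι → ℝ) : Subalgebra ℂ (chamber q → ℂ) where
  carrier := {φ | ContDiffOn ℝ ∞ (extZero φ) (chamber q)}
  mul_mem' {a b} ha hb := (ContDiffOn.mul ha hb).congr fun p hp => by
    simp [extZero_apply _ p hp]
  add_mem' {a b} ha hb := (ContDiffOn.add ha hb).congr fun p hp => by
    simp [extZero_apply _ p hp]
  algebraMap_mem' r := (contDiffOn_const (c := r)).congr fun p hp => by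
    rw [extZero_apply _ p hp]; rfl

/-- `C^∞(S → ℂ)` as a commutative `ℂ`-algebra. -/
def Smooth [Fintype ι] (q : ι → ℝ) : Type := smoothSubalgebra q

instance [Fintype ι] (q : ι → ℝ) : CommRing (Smooth q) :=
  inferInstanceAs (CommRing (smoothSubalgebra q))

instance [Fintype ι] (q : ι → ℝ) : Algebra ℂ (Smooth q) :=
  inferInstanceAs (Algebra ℂ (smoothSubalgebra q))

/-- The underlying function of an element of `C^∞(S → ℂ)`. -/
def Smooth.val [Fintype ι] {q : ι → ℝ} (φ : Smooth q) : chamber q → ℂ := Subtype.val φ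

instance [Fintype ι] (q : ι → ℝ) : CoeFun (Smooth q) (fun _ => chamber q → ℂ) := ⟨Smooth.val⟩

@[ext]
theorem Smooth.ext [Fintype ι] {q : ι → ℝ} {φ ψ : Smooth q} (h : ∀ p, φ p = ψ p) : φ = ψ :=
  Subtype.ext (funext h)

@[simp]
theorem Smooth.add_apply [Fintype ι] {q : ι → ℝ} (φ ψ : Smooth q) (p : chamber q) :
    (φ + ψ) p = φ p + ψ p := rfl

@[simp]
theorem Smooth.mul_apply [Fintype ι] {q : ι → ℝ} (φ ψ : Smooth q) (p : chamber q) :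
    (φ * ψ) p = φ p * ψ p := rfl

@[simp]
theorem Smooth.smul_apply [Fintype ι] {q : ι → ℝ} (a : ℂ) (φ : Smooth q) (p : chamber q) :
    (a • φ) p = a * φ p := rfl

theorem Smooth.contDiffOn [Fintype ι] {q : ι → ℝ} (φ : Smooth q) :
    ContDiffOn ℝ ∞ (extZero φ.val) (chamber q) := φ.2

theorem Smooth.differentiableAt [Fintype ι] {q : ι → ℝ} (φ : Smooth q) {p : ι → ℝ}
    (hp : p ∈ chamber q) : DifferentiableAt ℝ (extZero φ.val) p :=
  (φ.contDiffOn.contDiffAt ((isOpen_chamber q).mem_nhds hp)).differentiableAt (by simp)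

theorem fderiv_congr_chamber [Fintype ι] {q : ι → ℝ} {g h : (ι → ℝ) → ℂ}
    (H : Set.EqOn g h (chamber q)) {p : ι → ℝ} (hp : p ∈ chamber q) :
    fderiv ℝ g p = fderiv ℝ h p :=
  Filter.EventuallyEq.fderiv_eq (H.eventuallyEq_of_mem ((isOpen_chamber q).mem_nhds hp))

/-- The partial derivative `∂φ/∂p_i` of `φ ∈ C^∞(S → ℂ)`. -/
def Smooth.partialFun [Fintype ι] [DecidableEq ι] {q : ι → ℝ} (i : ι) (φ : Smooth q) : Smooth q :=
  ⟨fun p => fderiv ℝ (extZero φ.val) p.1 (Pi.single i 1), by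
    have h : ContDiffOn ℝ ∞ (fun p => fderiv ℝ (extZero φ.val) p (Pi.single i 1))
        (chamber q) :=
      (φ.contDiffOn.fderiv_of_isOpen (isOpen_chamber q) (by simp)).clm_apply
        contDiffOn_const
    exact h.congr fun p hp => by rw [extZero_apply _ p hp]⟩

theorem Smooth.partialFun_apply [Fintype ι] [DecidableEq ι] {q : ι → ℝ} (i : ι) (φ : Smooth q)
    (p : chamber q) : φ.partialFun i p = fderiv ℝ (extZero φ.val) p.1 (Pi.single i 1) := rfl

/-- The partial derivative `∂/∂p_i` as a derivation of `C^∞(S → ℂ)`. -/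
def partialDeriv [Fintype ι] [DecidableEq ι] (q : ι → ℝ) (i : ι) :
    Derivation ℂ (Smooth q) (Smooth q) :=
  Derivation.mk'
    { toFun := Smooth.partialFun i
      map_add' := fun φ ψ => by
        ext p
        have H : Set.EqOn (extZero (φ + ψ).val) (extZero φ.val + extZero ψ.val) (chamber q) :=
          fun p hp => by simp [extZero_apply _ p hp]
        rw [Smooth.add_apply, Smooth.partialFun_apply, fderiv_congr_chamber H p.2,
          fderiv_add (φ.differentiableAt p.2) (ψ.differentiableAt p.2)]
        rfl
      map_smul' := fun c φ => by
        ext p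
        have H : Set.EqOn (extZero (c • φ).val) (c • extZero φ.val) (chamber q) :=
          fun p hp => by simp [extZero_apply _ p hp]
        rw [RingHom.id_apply, Smooth.smul_apply, Smooth.partialFun_apply,
          fderiv_congr_chamber H p.2, fderiv_const_smul (φ.differentiableAt p.2)]
        rfl }
    (fun φ ψ => by
      ext p
      have H : Set.EqOn (extZero (φ * ψ).val) (extZero φ.val * extZero ψ.val) (chamber q) :=
        fun p hp => by simp [extZero_apply _ p hp]
      change Smooth.partialFun i (φ * ψ) p = _
      rw [Smooth.partialFun_apply, fderiv_congr_chamber H p.2,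
        fderiv_mul (φ.differentiableAt p.2) (ψ.differentiableAt p.2)]
      simp [extZero_apply _ p.1 p.2, Smooth.partialFun_apply])

theorem partialDeriv_apply [Fintype ι] [DecidableEq ι] (q : ι → ℝ) (i : ι) (φ : Smooth q)
    (p : chamber q) :
    partialDeriv q i φ p = fderiv ℝ (extZero φ.val) p.1 (Pi.single i 1) := rfl

/-- The coordinate function `p ↦ p_i` on `S`. -/
def coord [Fintype ι] (q : ι → ℝ) (i : ι) : Smooth q :=
  ⟨fun p => (p.1 i : ℂ), by
    have h : ContDiffOn ℝ ∞ (fun p : ι → ℝ => ((p i : ℝ) : ℂ)) (chamber q) :=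
      (Complex.ofRealCLM.contDiff.comp (contDiff_apply ℝ ℝ i)).contDiffOn
    exact h.congr fun p hp => by rw [extZero_apply _ p hp]⟩

theorem chamber_ne {q : ι → ℝ} (hq : Function.Injective q) {i j : ι} (hij : i ≠ j)
    {p : ι → ℝ} (hp : p ∈ chamber q) : p i ≠ p j := by
  rcases lt_or_gt_of_ne (fun h => hij (hq h)) with h | h
  · exact (hp i j h).ne
  · exact (hp j i h).ne'

/-- The function `p ↦ 1 / (p_i - p_j)` on `S`. (It is used only for `i ≠ j`.) -/
def invDiff [Fintype ι] (q : ι → ℝ) (hq : Function.Injective q) (i j : ι) : Smooth q :=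
  ⟨fun p => ((p.1 i - p.1 j : ℝ) : ℂ)⁻¹, by
    by_cases hij : i = j
    · subst hij
      refine (contDiffOn_const (c := (0 : ℂ))).congr fun p hp => ?_
      rw [extZero_apply _ p hp]; simp
    · have h1 : ContDiffOn ℝ ∞ (fun p : ι → ℝ => ((p i - p j : ℝ) : ℂ)) (chamber q) :=
        (Complex.ofRealCLM.contDiff.comp
          ((contDiff_apply ℝ ℝ i).sub (contDiff_apply ℝ ℝ j))).contDiffOn
      have h : ContDiffOn ℝ ∞ (fun p : ι → ℝ => ((p i - p j : ℝ) : ℂ)⁻¹) (chamber q) :=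
        h1.inv fun p hp => by
          rw [Complex.ofReal_ne_zero]
          exact sub_ne_zero.2 (chamber_ne hq hij hp)
      exact h.congr fun p hp => by rw [extZero_apply _ p hp]⟩

end Smooth

/-! ## Formal Laurent series at infinity

`LaurentSeries B` is used for `B((u⁻¹))`: the formal variable of the Laurent series is `u⁻¹`, so
the coefficient of `u^k` has index `-k`. -/

section Formal

/-- The monomial `u^n` in `B((u⁻¹))`. -/
def upow (B : Type) [CommRing B] (n : ℤ) : LaurentSeries B := HahnSeries.single (-n) 1

/-- The residue: the coefficient of `u^{-1}`. -/
def res {B : Type} [CommRing B] (h : LaurentSeries B) : B := h.coeff 1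

/-- The derivative `d/du` in `B((u⁻¹))`. With `t = u⁻¹` one has `d/du = -t² d/dt`. -/
def ddu {B : Type} [CommRing B] (h : LaurentSeries B) : LaurentSeries B :=
  -(upow B (-2) * LaurentSeries.derivative B h)

/-- `d/du ∑_k a_k u^k = ∑_k k a_k u^{k-1}`. -/
theorem ddu_coeff {B : Type} [CommRing B] (h : LaurentSeries B) (k : ℤ) :
    (ddu h).coeff (-(k - 1)) = (k : B) * h.coeff (-k) := by
  have e : -(k - 1) = 2 + (-k - 1) := by ring
  rw [ddu, HahnSeries.coeff_neg, e]
  simp only [upow, neg_neg]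
  rw [add_comm, HahnSeries.coeff_single_mul_add]
  simp [LaurentSeries.derivative_apply]

variable {A : Type} [CommRing A]

/-- The coefficients of `f`: the coefficient of `u^{1-k}` is `1` for `k = 0`, `0` for `k = 1` and
`f_{-k}` for `k ≥ 2`. Here `φ j` stands for `f_{-2-j}`. -/
def fCoeff (φ : ℕ → A) : ℕ → A
  | 0 => 1
  | 1 => 0
  | (j + 2) => φ j

/-- A power series in `u⁻¹` with constant coefficient `1`, as a unit of `A((u⁻¹))`. -/
def oneUnit (g : PowerSeries A) (hg : PowerSeries.constantCoeff g = ((1 : Aˣ) : A)) :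
    (LaurentSeries A)ˣ where
  val := HahnSeries.ofPowerSeries ℤ A g
  inv := HahnSeries.ofPowerSeries ℤ A (PowerSeries.invOfUnit g 1)
  val_inv := by rw [← map_mul, PowerSeries.mul_invOfUnit _ _ hg, map_one]
  inv_val := by rw [mul_comm, ← map_mul, PowerSeries.mul_invOfUnit _ _ hg, map_one]

/-- `u` as a unit of `A((u⁻¹))`. -/
def uUnit (A : Type) [CommRing A] : (LaurentSeries A)ˣ where
  val := upow A 1
  inv := upow A (-1)
  val_inv := by simp [upow]
  inv_val := by simp [upow]

/-- The series `f(u) = u + ∑_{m ≤ -2} f_m u^{1+m}`, as a unit of `A((u⁻¹))`. -/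
def fSer (φ : ℕ → A) : (LaurentSeries A)ˣ :=
  uUnit A * oneUnit (PowerSeries.mk (fCoeff φ)) (by simp [fCoeff])

theorem fSer_coeff (φ : ℕ → A) (k : ℤ) :
    (fSer φ : LaurentSeries A).coeff (k - 1) =
      (HahnSeries.ofPowerSeries ℤ A (PowerSeries.mk (fCoeff φ))).coeff k := by
  have h : k - 1 = k + (-1) := by ring
  rw [h]
  simp only [fSer, uUnit, oneUnit, Units.val_mul, upow]
  rw [HahnSeries.coeff_single_mul_add, one_mul]

/-- `f(u)^n` for an integer `n`. -/
def fPow (φ : ℕ → A) (n : ℤ) : LaurentSeries A :=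
  ((fSer φ ^ n : (LaurentSeries A)ˣ) : LaurentSeries A)

/-- `f'(u)`. -/
def fDer (φ : ℕ → A) : LaurentSeries A := ddu (fSer φ).1

/-- `f'(u) = 1 + ∑_{m ≤ -2} (1 + m) f_m u^m` as a power series in `u⁻¹`. -/
theorem fDer_eq (φ : ℕ → A) : fDer φ =
    HahnSeries.ofPowerSeries ℤ A
      (PowerSeries.mk fun k => (1 - (k : A)) * fCoeff φ k) := by
  ext i
  have h := ddu_coeff (fSer φ).1 (1 - i)
  have e1 : -(1 - i - 1) = i := by ring
  have e2 : -(1 - i) = i - 1 := by ring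
  rw [e1, e2, fSer_coeff] at h
  rw [fDer, h]
  rcases lt_or_ge i 0 with hi | hi
  · simp [PowerSeries.coeff_coe, hi]
  · lift i to ℕ using hi
    simp [LaurentSeries.coeff_coe_powerSeries]

/-- `f'(u)` as a unit of `A((u⁻¹))`. -/
def fDerUnit (φ : ℕ → A) : (LaurentSeries A)ˣ :=
  (oneUnit (PowerSeries.mk fun k => (1 - (k : A)) * fCoeff φ k) (by simp [fCoeff])).copy
    (fDer φ) (fDer_eq φ) _ rfl

/-- The Schwarzian derivative `Sf = f'''/f' - (3/2) (f''/f')²`. -/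
def schwarzian [Algebra ℂ A] (φ : ℕ → A) : LaurentSeries A :=
  ddu (ddu (fDer φ)) * ((fDerUnit φ)⁻¹).1
    - (3 / 2 : ℂ) • (ddu (fDer φ) * ((fDerUnit φ)⁻¹).1) ^ 2

/-- The expansion of `1/(f(u) - x)^{1+j}` in the region `|f(u)| > |x|`, that is
`∑_{m ≥ 0} binom(m,j) f(u)^{-1-m} x^{m-j}`, where `x` is an element of a commutative `A`-algebra
`B` with structure map `ι`. Since `f(u)^{-1-m}` has only powers `u^{-k}` with `k ≥ 1 + m`, the
coefficient of `u^{-k}` is the finite sum over `m < k`. -/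
def expandInv (φ : ℕ → A) {B : Type} [CommRing B] (ι : A →+* B) (j : ℕ) (x : B) :
    LaurentSeries B :=
  HahnSeries.ofPowerSeries ℤ B (PowerSeries.mk fun k : ℕ =>
    ∑ m ∈ Finset.range k,
      m.choose j • (ι ((fPow φ (-1 - (m : ℤ))).coeff (k : ℤ)) * x ^ (m - j)))

/-- `Res_u u^{1-n} Sf(u)`. -/
def schwarzCoeff [Algebra ℂ A] (φ : ℕ → A) (n : ℤ) : A := res (upow A (1 - n) * schwarzian φ)

/-- `Res_u u^{1-n} Res_z f'(u)² z^{-2-l} (1/(f(z) - f(u)))`, expanded in `|f(z)| > |f(u)|`. The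
series in `z` has coefficients in `A((u⁻¹))`. -/
def modeCoeff (φ : ℕ → A) (n l : ℤ) : A :=
  res (upow A (1 - n) * res (HahnSeries.C (fDer φ ^ 2) * upow (LaurentSeries A) (-2 - l)
    * expandInv φ HahnSeries.C 0 (fSer φ).1))

/-- `Res_u u^{1-n} f'(u)² (1/(f(u) - x)^{1+j})`, expanded in `|f(u)| > |x|`. -/
def pointCoeff (φ : ℕ → A) (n : ℤ) (j : ℕ) (x : A) : A :=
  res (upow A (1 - n) * (fDer φ ^ 2 * expandInv φ (RingHom.id A) j x))

/-- `Res_v v^{-2-m} (1/(f(v) - x))`, expanded in `|f(v)| > |x|`; this is the polynomial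
`p_m(-x, f_{-2}, f_{-3}, …)`. -/
def loewnerCoeff (φ : ℕ → A) (m : ℤ) (x : A) : A :=
  res (upow A (-2 - m) * expandInv φ (RingHom.id A) 0 x)

end Formal

/-! ## Functions of SLE data -/

section FunctionSpace

variable {ι : Type}

/-- The space `𝓕 = C^∞(S → ℂ)[f_{-2}, f_{-3}, …]`. The variable with index `j : ℕ` is
`f_{-2-j}`. -/
abbrev FSpace [Fintype ι] (q : ι → ℝ) : Type := MvPolynomial ℕ (Smooth q)

/-- A linear operator `d` on `C^∞(S → ℂ)`, applied to the coefficients of a polynomial in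
`f_{-2}, f_{-3}, …`. -/
def coeffwise [Fintype ι] {q : ι → ℝ} (d : Smooth q →ₗ[ℂ] Smooth q) : Module.End ℂ (FSpace q) where
  toFun η := AddMonoidAlgebra.map d.toAddMonoidHom η
  map_add' η θ := by
    ext m : 1
    exact map_add d (η.coeff m) (θ.coeff m)
  map_smul' c η := by
    ext m : 1
    exact map_smul d c (η.coeff m)

theorem coeff_coeffwise [Fintype ι] {q : ι → ℝ} (d : Smooth q →ₗ[ℂ] Smooth q)
    (η : FSpace q) (m : ℕ →₀ ℕ) :
    (coeffwise d η).coeff m = d (η.coeff m) := rfl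

/-- The operator of multiplication by `a` on `𝓕`. -/
def mulOp [Fintype ι] {q : ι → ℝ} (a : FSpace q) : Module.End ℂ (FSpace q) := LinearMap.mulLeft ℂ a

/-- The operator `∑_{l ≤ -2} a_l ∂/∂f_l` on `𝓕`, where `a j` stands for `a_{-2-j}`: the derivation
over `C^∞(S → ℂ)` that sends the variable `f_l` to `a_l`. -/
def vectorField [Fintype ι] {q : ι → ℝ} (a : ℕ → FSpace q) : Module.End ℂ (FSpace q) :=
  (MvPolynomial.mkDerivation (Smooth q) a).toLinearMap.restrictScalars ℂ

/-- The sum over `l` is locally finite: only the variables that occur in `η` contribute. -/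
theorem vectorField_apply [Fintype ι] {q : ι → ℝ} (a : ℕ → FSpace q) (η : FSpace q) :
    vectorField a η = ∑ j ∈ η.vars, a j * MvPolynomial.pderiv j η := by
  have hs : ∀ θ : FSpace q, (∑ j ∈ η.vars, a j • MvPolynomial.pderiv j) θ =
      ∑ j ∈ η.vars, a j * MvPolynomial.pderiv j θ := fun θ => by
    rw [← Derivation.coeFnAddMonoidHom_apply, map_sum, Finset.sum_apply]
    rfl
  have h := MvPolynomial.derivation_eq_of_forall_mem_vars (f := η)
    (D₁ := MvPolynomial.mkDerivation (Smooth q) a)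
    (D₂ := ∑ j ∈ η.vars, a j • MvPolynomial.pderiv j) (by
      intro i hi
      rw [MvPolynomial.mkDerivation_X, hs, Finset.sum_eq_single i]
      · simp
      · intro j _ hj
        simp [MvPolynomial.pderiv_X, hj.symm]
      · exact fun h => absurd hi h)
  change MvPolynomial.mkDerivation (Smooth q) a η = _
  rw [h, hs]

/-- The coordinate `x_I` or `y_K` as an element of `𝓕`. -/
def var [Fintype ι] (q : ι → ℝ) (i : ι) : FSpace q := MvPolynomial.C (coord q i)

/-- The variables `f_{-2}, f_{-3}, …` of `𝓕`. -/
def fVar [Fintype ι] (q : ι → ℝ) (j : ℕ) : FSpace q := MvPolynomial.X j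

/-- The operators `𝓛_n` on `𝓕`, with parameters `c` and `δ`; the index `i` runs over all the
variables `x_I` and `y_K`. -/
def virOp [Fintype ι] [DecidableEq ι] (q : ι → ℝ) (c : ℂ) (δ : ι → ℂ) (n : ℤ) : Module.End ℂ (FSpace q) :=
  (c / 12) • mulOp (schwarzCoeff (fVar q) n)
    - vectorField (fun j => modeCoeff (fVar q) n (-2 - (j : ℤ)))
    + ∑ i, (δ i • mulOp (pointCoeff (fVar q) n 1 (var q i))
        + mulOp (pointCoeff (fVar q) n 0 (var q i))
          * coeffwise (partialDeriv q i).toLinearMap)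

end FunctionSpace

/-! ## The data of an SLE variant -/

/-- The parameters of an SLE variant with `N` curves and `M` passive points: `κ > 0`, parameters
`κ_I ∈ {κ, 16/κ}` of the curves, weights `h_{y_K}` of the passive points, and the distinct initial
positions `X^1_0, …, X^N_0, Y^1_0, …, Y^M_0`. -/
structure Variant (N M : ℕ) where
  κ : ℝ
  κ_pos : 0 < κ
  κx : Fin N → ℝ
  κx_mem : ∀ I, κx I = κ ∨ κx I = 16 / κ
  hy : Fin M → ℝ
  init : Fin N ⊕ Fin M → ℝ
  init_inj : Function.Injective init

namespace Variant

variable {N M : ℕ} (V : Variant N M)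

/-- `h_{x_I} = (6 - κ_I) / (2 κ_I)`. -/
def hx (I : Fin N) : ℝ := (6 - V.κx I) / (2 * V.κx I)

/-- `c(κ) = (6 - κ)(3κ - 8) / (2κ)`. -/
def c : ℝ := (6 - V.κ) * (3 * V.κ - 8) / (2 * V.κ)

/-- `C^∞(S → ℂ)`. -/
abbrev R : Type := Smooth V.init

/-- The space `𝓕`. -/
abbrev F : Type := FSpace V.init

/-- `∂/∂x_I` on `C^∞(S → ℂ)`. -/
def dx (I : Fin N) : Module.End ℂ V.R := (partialDeriv V.init (Sum.inl I)).toLinearMap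

/-- `∂/∂y_K` on `C^∞(S → ℂ)`. -/
def dy (K : Fin M) : Module.End ℂ V.R := (partialDeriv V.init (Sum.inr K)).toLinearMap

/-- `1 / (x_J - x_I)` for `J ≠ I`. -/
def invXX (J I : Fin N) : V.R := invDiff V.init V.init_inj (Sum.inl J) (Sum.inl I)

/-- `1 / (y_K - x_I)`. -/
def invYX (K : Fin M) (I : Fin N) : V.R := invDiff V.init V.init_inj (Sum.inr K) (Sum.inl I)

/-- The null field operator `𝓓_I` on `C^∞(S → ℂ)`. -/
def nullOp (I : Fin N) : Module.End ℂ V.R :=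
  ((V.κx I / 2 : ℝ) : ℂ) • (V.dx I * V.dx I)
    + ∑ J ∈ Finset.univ.erase I,
        ((2 : ℂ) • (LinearMap.mulLeft ℂ (V.invXX J I) * V.dx J)
          + (((V.κx J - 6) / V.κx J : ℝ) : ℂ) • LinearMap.mulLeft ℂ (V.invXX J I ^ 2))
    + ∑ K, ((2 : ℂ) • (LinearMap.mulLeft ℂ (V.invYX K I) * V.dy K)
          - ((2 * V.hy K : ℝ) : ℂ) • LinearMap.mulLeft ℂ (V.invYX K I ^ 2))

/-- The operator `𝓐_I = 𝓓_I + 2 ∑_{m ≤ -2} p_m(-x_I, f_{-2}, f_{-3}, …) ∂/∂f_m` on `𝓕`. -/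
def genOp (I : Fin N) : Module.End ℂ V.F :=
  coeffwise (V.nullOp I)
    + (2 : ℂ) • vectorField (fun j => loewnerCoeff (fVar V.init) (-2 - (j : ℤ)) (var V.init (Sum.inl I)))

/-- The operators `𝓛_n` with `δ_{x_I} = h_{x_I}`, `δ_{y_K} = h_{y_K}` and `c = c(κ)`. -/
def L (n : ℤ) : Module.End ℂ V.F :=
  virOp V.init (V.c : ℂ) (Sum.elim (fun I => (V.hx I : ℂ)) (fun K => (V.hy K : ℂ))) n

/-- (a) `Z` is a smooth function on `S` with positive real values. -/
def IsPositive (Z : V.R) : Prop := ∀ p, ∃ r : ℝ, 0 < r ∧ Z p = (r : ℂ)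

/-- (b) The null field equations. -/
def NullField (Z : V.R) : Prop := ∀ I, V.nullOp I Z = 0

/-- (c) Translation invariance. -/
def TranslationInvariant (Z : V.R) : Prop :=
  ∀ (σ : ℝ) (p p' : chamber V.init), (∀ i, p'.1 i = p.1 i + σ) → Z p' = Z p

/-- (d) Homogeneity of degree `Δ`. -/
def Homogeneous (Z : V.R) (Δ : ℝ) : Prop :=
  ∀ (s : ℝ) (p p' : chamber V.init), 0 < s → (∀ i, p'.1 i = s * p.1 i) →
    Z p' = ((s ^ Δ : ℝ) : ℂ) * Z p

/-- A function on `S` as an element of `𝓕`, a constant polynomial in `f_{-2}, f_{-3}, …`. -/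
def toF (Z : V.R) : V.F := MvPolynomial.C Z

end Variant

/-! ## The Virasoro algebra -/

/-- The bilinear map with `(e_n, e_m) ↦ (n - m) e_{n+m}`. -/
def wittBracket : (ℤ →₀ ℂ) →ₗ[ℂ] (ℤ →₀ ℂ) →ₗ[ℂ] (ℤ →₀ ℂ) :=
  Finsupp.linearCombination ℂ fun n : ℤ =>
    Finsupp.linearCombination ℂ fun m : ℤ => Finsupp.single (n + m) ((n : ℂ) - (m : ℂ))

/-- The bilinear form with `(e_n, e_m) ↦ (n³ - n)/12 · δ_{n+m,0}`. -/
def virCocycle : (ℤ →₀ ℂ) →ₗ[ℂ] (ℤ →₀ ℂ) →ₗ[ℂ] ℂ :=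
  Finsupp.linearCombination ℂ fun n : ℤ =>
    Finsupp.linearCombination ℂ fun m : ℤ =>
      if n + m = 0 then (1 / 12 : ℂ) * ((n : ℂ) ^ 3 - (n : ℂ)) else 0

theorem wittBracket_single (n m : ℤ) (a b : ℂ) :
    wittBracket (Finsupp.single n a) (Finsupp.single m b) =
      Finsupp.single (n + m) (a * b * ((n : ℂ) - (m : ℂ))) := by
  simp [wittBracket, mul_assoc, -Finsupp.single_sub, -Finsupp.single_mul]

theorem virCocycle_single (n m : ℤ) (a b : ℂ) :
    virCocycle (Finsupp.single n a) (Finsupp.single m b) =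
      if n + m = 0 then a * b * ((1 / 12 : ℂ) * ((n : ℂ) ^ 3 - (n : ℂ))) else 0 := by
  simp [virCocycle, mul_assoc]

/-- The Virasoro algebra as a vector space with basis `L_n` (`n ∈ ℤ`) and `C`. -/
def Vir : Type := (ℤ →₀ ℂ) × ℂ

namespace Vir

instance : AddCommGroup Vir := inferInstanceAs (AddCommGroup ((ℤ →₀ ℂ) × ℂ))

instance : Module ℂ Vir := inferInstanceAs (Module ℂ ((ℤ →₀ ℂ) × ℂ))

/-- The basis element `L_n`. -/
def L (n : ℤ) : Vir := (Finsupp.single n 1, 0)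

/-- The central element `C`. -/
def C : Vir := (0, 1)

instance : Bracket Vir Vir := ⟨fun x y => (wittBracket x.1 y.1, virCocycle x.1 y.1)⟩

theorem bracket_def (x y : Vir) : ⁅x, y⁆ = (wittBracket x.1 y.1, virCocycle x.1 y.1) := rfl

theorem witt_skew (x y : ℤ →₀ ℂ) : wittBracket x y = -wittBracket y x := by
  induction x using Finsupp.induction_linear with
  | zero => simp
  | add x x' h h' => simp [h, h']; abel
  | single n a =>
    induction y using Finsupp.induction_linear with
    | zero => simp
    | add y y' h h' => simp [h, h']; abel
    | single m b =>
      rw [wittBracket_single, wittBracket_single, ← Finsupp.single_neg, add_comm m n]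
      congr 1
      ring

theorem cocycle_skew (x y : ℤ →₀ ℂ) : virCocycle x y = -virCocycle y x := by
  induction x using Finsupp.induction_linear with
  | zero => simp
  | add x x' h h' => simp [h, h']; abel
  | single n a =>
    induction y using Finsupp.induction_linear with
    | zero => simp
    | add y y' h h' => simp [h, h']; abel
    | single m b =>
      rw [virCocycle_single, virCocycle_single, add_comm m n]
      split_ifs with h
      · obtain rfl : m = -n := by omega
        push_cast
        ring
      · simp

theorem witt_jacobi (x y z : ℤ →₀ ℂ) : wittBracket x (wittBracket y z) =
    wittBracket (wittBracket x y) z + wittBracket y (wittBracket x z) := by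
  induction x using Finsupp.induction_linear with
  | zero => simp
  | add x x' h h' => simp only [map_add, LinearMap.add_apply, h, h']; abel
  | single n a =>
    induction y using Finsupp.induction_linear with
    | zero => simp
    | add y y' h h' => simp only [map_add, LinearMap.add_apply, h, h']; abel
    | single m b =>
      induction z using Finsupp.induction_linear with
      | zero => simp
      | add z z' h h' => simp only [map_add, h, h']; abel
      | single k c =>
        simp only [wittBracket_single]
        rw [show n + m + k = n + (m + k) by ring, show m + (n + k) = n + (m + k) by ring,
          ← Finsupp.single_add]
        congr 1
        push_cast
        ring

theorem cocycle_jacobi (x y z : ℤ →₀ ℂ) : virCocycle x (wittBracket y z) =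
    virCocycle (wittBracket x y) z + virCocycle y (wittBracket x z) := by
  induction x using Finsupp.induction_linear with
  | zero => simp
  | add x x' h h' => simp only [map_add, LinearMap.add_apply, h, h']; ring
  | single n a =>
    induction y using Finsupp.induction_linear with
    | zero => simp
    | add y y' h h' => simp only [map_add, LinearMap.add_apply, h, h']; ring
    | single m b =>
      induction z using Finsupp.induction_linear with
      | zero => simp
      | add z z' h h' => simp only [map_add, h, h']; ring
      | single k c =>
        simp only [wittBracket_single, virCocycle_single]
        rw [show n + m + k = n + (m + k) by ring, show m + (n + k) = n + (m + k) by ring]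
        split_ifs with h
        · obtain rfl : k = -n - m := by omega
          push_cast
          ring
        · simp

instance : LieRing Vir where
  add_lie x y z := by
    exact Prod.ext (congrArg (· z.1) (map_add wittBracket x.1 y.1))
      (congrArg (· z.1) (map_add virCocycle x.1 y.1))
  lie_add x y z := by
    exact Prod.ext (map_add (wittBracket x.1) y.1 z.1) (map_add (virCocycle x.1) y.1 z.1)
  lie_self x := by
    have h1 := witt_skew x.1 x.1
    have h2 := cocycle_skew x.1 x.1
    exact Prod.ext (self_eq_neg.1 h1) (self_eq_neg.1 h2)
  leibniz_lie x y z := Prod.ext (witt_jacobi x.1 y.1 z.1) (cocycle_jacobi x.1 y.1 z.1)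

instance : LieAlgebra ℂ Vir where
  lie_smul t x y := Prod.ext (map_smul (wittBracket x.1) t y.1) (map_smul (virCocycle x.1) t y.1)

/-- The defining relation of the Virasoro algebra. -/
theorem L_bracket (n m : ℤ) : ⁅L n, L m⁆ = ((n : ℂ) - (m : ℂ)) • L (n + m)
    + (if n + m = 0 then (1 / 12 : ℂ) * ((n : ℂ) ^ 3 - (n : ℂ)) else 0) • C := by
  refine Prod.ext ?_ ?_
  · change wittBracket (Finsupp.single n 1) (Finsupp.single m 1) =
      ((n : ℂ) - (m : ℂ)) • Finsupp.single (n + m) (1 : ℂ) + _ • (0 : ℤ →₀ ℂ)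
    rw [wittBracket_single, smul_zero, add_zero, Finsupp.smul_single]
    simp
  · change virCocycle (Finsupp.single n 1) (Finsupp.single m 1) =
      ((n : ℂ) - (m : ℂ)) • (0 : ℂ) + _ • (1 : ℂ)
    rw [virCocycle_single]
    simp

theorem C_bracket (x : Vir) : ⁅C, x⁆ = 0 := by
  refine Prod.ext ?_ ?_
  · change wittBracket 0 x.1 = 0
    simp
  · change virCocycle 0 x.1 = 0
    simp

end Vir

/-! ## Modules over the Virasoro algebra -/

section Modules

variable {W : Type} [AddCommGroup W] [Module ℂ W]

/-- A subspace is a submodule for the representation `ρ` of the Virasoro algebra. -/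
def IsVirSubmodule (ρ : Vir →ₗ⁅ℂ⁆ Module.End ℂ W) (U : Submodule ℂ W) : Prop :=
  ∀ (X : Vir), ∀ w ∈ U, ρ X w ∈ U

/-- The subspace `𝓤(vir) v`. -/
def cyclic (ρ : Vir →ₗ⁅ℂ⁆ Module.End ℂ W) (v : W) : Submodule ℂ W :=
  LinearMap.range
    ((LinearMap.applyₗ v : Module.End ℂ W →ₗ[ℂ] W) ∘ₗ
      (UniversalEnvelopingAlgebra.lift ℂ ρ).toLinearMap)

theorem mem_cyclic (ρ : Vir →ₗ⁅ℂ⁆ Module.End ℂ W) (v w : W) :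
    w ∈ cyclic ρ v ↔ ∃ a : UniversalEnvelopingAlgebra ℂ Vir,
      UniversalEnvelopingAlgebra.lift ℂ ρ a v = w := Iff.rfl

/-- The subspace `U` is a highest weight module of central charge `c` and highest weight `h`, with
highest weight vector `v`. -/
structure IsHighestWeightModule (ρ : Vir →ₗ⁅ℂ⁆ Module.End ℂ W) (U : Submodule ℂ W) (v : W)
    (c h : ℂ) : Prop where
  submodule : IsVirSubmodule ρ U
  generated : U = cyclic ρ v
  ne_zero : v ≠ 0
  singular : ∀ n : ℤ, 0 < n → ρ (Vir.L n) v = 0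
  weight : ρ (Vir.L 0) v = h • v
  central : ∀ w ∈ U, ρ Vir.C w = c • w

/-- The operator `L_{-m}^{e_{-m}} ⋯ L_0^{e_0} L_1^{e_1}`, for `m ≥ -1`. -/
def orderedMonomial (T : ℤ → Module.End ℂ W) (m : ℤ) (e : ℤ → ℕ) : Module.End ℂ W :=
  ((List.range (m + 2).toNat).map fun i : ℕ => T (-m + i) ^ e (-m + i)).prod

end Modules

end SLEVir

end

/-! Expand u^{1-n} f'(u) in powers of f(u), and let a_n be the polynomial formed by the nonnegative
powers. Residues against f(u)^k f'(u) read off the coefficients, and they show that the first order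
part V_n of the operator 𝓛_n is geometric: V_n f(u) = a_n(f(u)) - u^{1-n} f'(u), and V_n x = a_n(x)
for each point x. So V_n reparametrises u along -u^{1-n} d/du and moves f and the points by the
polynomial field a_n, which restores the normalisation f(u) = u + O(u^{-1}). The zeroth order part
is c/12 times a mode of Sf plus the sum of the h_x a_n'(x).

Virasoro relations: the difference of [V_n, V_m] f and (n - m) V_{n+m} f is a polynomial in f(u),
because the reparametrisations obey the Witt relations, and it has only negative powers of u. Such a
series vanishes (`evalF_eq_zero_of_mem`). This gives the bracket of the a_n (`fieldPoly_bracket`)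
and then that of the V_n (`virField_bracket`). The central term comes from the variation of Sf,
which defines an antisymmetric form `thirdForm`. The form vanishes on two polynomials in f and on
two series of negative powers; on the series u^{1-n} f' it produces the cocycle n³ - n and a mode of
Sf (`schwarzCoeff_bracket`).

Generators: 𝓐_I is (κ_I/2) ∂_I² plus the Loewner field U_I, with U_I f = 2/(f - x_I), plus a
potential. Taylor expansion of a_n at x_I gives [𝓐_I, 𝓛_n] = 2 a_n'(x_I) 𝓐_I (`generator_virOp`):
the obstructions are multiples of a_n''(x_I) ∂_I and a_n'''(x_I), and the values of h_{x_I} and c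
cancel them. Hence the joint kernel is a submodule. It contains Z, which does not involve the f_l
and solves the null field equations.

Action on Z: a_n is 0 for n ≥ 2, 1 for n = 1 and X for n = 0, and the modes of Sf vanish for n ≥ 0,
so 𝓛_1 and 𝓛_0 are the generators of translations and of weighted dilations. Reordering a word in
the 𝓛_n costs only shorter words (`word_sub_mem_of_perm`), and a letter with n ≥ 2 moved to the
right end kills Z. This yields the spanning set (`cyclic_eq_span`). -/

noncomputable section

namespace SLEVir

/-! ## Calculus of formal Laurent series -/

section Calculus

variable {A : Type} [CommRing A]

/-- The coefficientwise structure. It takes precedence over the one through power series. -/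
instance laurentAlgebra (A : Type) [CommRing A] [Algebra ℂ A] : Algebra ℂ (LaurentSeries A) :=
  HahnSeries.instAlgebra

/-- The Laurent series whose coefficients of index less than `N` vanish. -/
def vanishingBelow (A : Type) [CommRing A] (N : ℤ) : Submodule A (LaurentSeries A) where
  carrier := {h | ∀ k < N, h.coeff k = 0}
  zero_mem' := fun k _ => rfl
  add_mem' {a b} ha hb k hk := by rw [HahnSeries.coeff_add, ha k hk, hb k hk, add_zero]
  smul_mem' c x hx k hk := by rw [HahnSeries.coeff_smul, hx k hk, smul_zero]

theorem vanishingBelow_anti {N M : ℤ} (hNM : N ≤ M) {h : LaurentSeries A}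
    (hh : h ∈ vanishingBelow A M) : h ∈ vanishingBelow A N :=
  fun k hk => hh k (by omega)

theorem exists_mem_vanishingBelow (h : LaurentSeries A) : ∃ N, h ∈ vanishingBelow A N :=
  ⟨h.order, fun _ hk => HahnSeries.coeff_eq_zero_of_lt_order hk⟩

theorem eq_zero_of_forall_mem_vanishingBelow {h : LaurentSeries A}
    (hh : ∀ N : ℕ, h ∈ vanishingBelow A (N : ℤ)) : h = 0 := by
  ext k
  exact hh (k + 1).toNat k (by omega)

/-- The interval depends only on the bounds N and M, not on the supports, so products whose factors
have been changed coefficientwise can be compared term by term. -/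
theorem coeff_mul_eq_sum_Icc {N M : ℤ} {x y : LaurentSeries A} (hx : x ∈ vanishingBelow A N)
    (hy : y ∈ vanishingBelow A M) (k : ℤ) :
    (x * y).coeff k = ∑ i ∈ Finset.Icc N (k - M), x.coeff i * y.coeff (k - i) := by
  rw [HahnSeries.coeff_mul]
  refine Finset.sum_of_injOn Prod.fst ?_ ?_ ?_ ?_
  · rintro ⟨a, b⟩ h ⟨c, d⟩ h' e
    simp only [Finset.mem_coe, Finset.mem_antidiagonal] at h h' e
    ext <;> simp <;> omega
  · rintro ⟨a, b⟩ h
    simp only [Finset.mem_coe, Finset.mem_antidiagonal, HahnSeries.mem_support] at h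
    have h1 : N ≤ a := not_lt.1 fun h' => h.1 (hx a h')
    have h2 : M ≤ b := not_lt.1 fun h' => h.2.1 (hy b h')
    simp only [Finset.mem_coe, Finset.mem_Icc]
    omega
  · intro i _ hi
    by_contra h
    refine hi ⟨(i, k - i), ?_, rfl⟩
    simp only [Finset.mem_coe, Finset.mem_antidiagonal, HahnSeries.mem_support]
    exact ⟨fun h' => h (by rw [h', zero_mul]), fun h' => h (by rw [h', mul_zero]), by omega⟩
  · rintro ⟨a, b⟩ h
    simp only [Finset.mem_antidiagonal] at h
    rw [show k - (a, b).1 = b by simp; omega]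

theorem mul_mem_vanishingBelow {N M : ℤ} {x y : LaurentSeries A} (hx : x ∈ vanishingBelow A N)
    (hy : y ∈ vanishingBelow A M) : x * y ∈ vanishingBelow A (N + M) := by
  intro k hk
  rw [coeff_mul_eq_sum_Icc hx hy, Finset.Icc_eq_empty (by omega), Finset.sum_empty]

theorem coeff_mul_lead {N M k : ℤ} {x y : LaurentSeries A} (hx : x ∈ vanishingBelow A N)
    (hy : y ∈ vanishingBelow A M) (hk : k = N + M) :
    (x * y).coeff k = x.coeff N * y.coeff M := by
  subst hk
  rw [coeff_mul_eq_sum_Icc hx hy, show N + M - M = N by ring, Finset.Icc_self,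
    Finset.sum_singleton, show N + M - N = M by ring]

theorem ofPowerSeries_mem_vanishingBelow (g : PowerSeries A) :
    HahnSeries.ofPowerSeries ℤ A g ∈ vanishingBelow A 0 := by
  intro k hk
  have := PowerSeries.coeff_coe g k
  rw [if_pos hk] at this
  exact this

theorem C_mem_vanishingBelow (a : A) : (HahnSeries.C a : LaurentSeries A) ∈ vanishingBelow A 0 := by
  intro k hk
  rw [HahnSeries.C_apply, HahnSeries.coeff_single_of_ne hk.ne]

theorem one_mem_vanishingBelow : (1 : LaurentSeries A) ∈ vanishingBelow A 0 := by
  simpa using C_mem_vanishingBelow (1 : A)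

theorem upow_mem_vanishingBelow (n : ℤ) : upow A n ∈ vanishingBelow A (-n) := by
  intro k hk
  rw [upow, HahnSeries.coeff_single_of_ne hk.ne]

theorem upow_mul_upow (n m : ℤ) : upow A n * upow A m = upow A (n + m) := by
  simp only [upow, HahnSeries.single_mul_single, mul_one]
  congr 2
  ring

theorem coeff_upow_mul (n k : ℤ) (h : LaurentSeries A) :
    (upow A n * h).coeff k = h.coeff (k + n) := by
  have := HahnSeries.coeff_single_mul_add (r := (1 : A)) (x := h) (a := k + n) (b := -n)
  rw [one_mul, add_neg_cancel_right] at this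
  exact this

theorem coeff_C_mul (a : A) (h : LaurentSeries A) (k : ℤ) :
    (HahnSeries.C a * h).coeff k = a * h.coeff k := by
  rw [HahnSeries.C_mul_eq_smul, HahnSeries.coeff_smul, smul_eq_mul]

theorem res_C_mul (a : A) (h : LaurentSeries A) : res (HahnSeries.C a * h) = a * res h :=
  coeff_C_mul a h 1

theorem res_add (x y : LaurentSeries A) : res (x + y) = res x + res y := rfl

theorem res_sub (x y : LaurentSeries A) : res (x - y) = res x - res y := HahnSeries.coeff_sub ..

theorem res_neg (x : LaurentSeries A) : res (-x) = -res x := rfl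

theorem res_sum {σ : Type*} (s : Finset σ) (x : σ → LaurentSeries A) :
    res (∑ i ∈ s, x i) = ∑ i ∈ s, res (x i) := HahnSeries.coeff_sum 1

theorem res_eq_zero {N : ℤ} (hN : 2 ≤ N) {x : LaurentSeries A} (hx : x ∈ vanishingBelow A N) :
    res x = 0 := hx 1 (by omega)

theorem res_upow (n : ℤ) : res (upow A n) = if n = -1 then 1 else 0 := by
  rw [res, upow]
  split_ifs with h
  · subst h; simp
  · rw [HahnSeries.coeff_single_of_ne (by omega)]

variable [Algebra ℂ A]

/-- Apply a linear map to each coefficient of a Laurent series, depending on its index. -/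
def coeffMap (T : ℤ → A →ₗ[ℂ] A) : LaurentSeries A →ₗ[ℂ] LaurentSeries A where
  toFun h :=
    { coeff := fun k => T k (h.coeff k)
      isPWO_support' := h.isPWO_support'.mono fun k hk => by
        rw [Function.mem_support] at hk ⊢
        exact fun h' => hk (by rw [h', map_zero]) }
  map_add' x y := by
    ext k
    exact map_add (T k) _ _
  map_smul' c x := by
    ext k
    exact map_smul (T k) c _

theorem coeffMap_coeff (T : ℤ → A →ₗ[ℂ] A) (h : LaurentSeries A) (k : ℤ) :
    (coeffMap T h).coeff k = T k (h.coeff k) := rfl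

theorem coeffMap_mem_vanishingBelow (T : ℤ → A →ₗ[ℂ] A) {N : ℤ} {h : LaurentSeries A}
    (hh : h ∈ vanishingBelow A N) : coeffMap T h ∈ vanishingBelow A N := by
  intro k hk
  rw [coeffMap_coeff, hh k hk, map_zero]

/-- The Leibniz rule is allowed to depend on the index. One statement thus covers u d/du, where
index i contributes the additive weight -i, and a derivation of the coefficient ring, where the
index plays no role. -/
theorem coeffMap_mul (T : ℤ → A →ₗ[ℂ] A)
    (hT : ∀ i j x y, T (i + j) (x * y) = x * T j y + y * T i x) (x y : LaurentSeries A) :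
    coeffMap T (x * y) = x * coeffMap T y + y * coeffMap T x := by
  obtain ⟨N, hx⟩ := exists_mem_vanishingBelow x
  obtain ⟨M, hy⟩ := exists_mem_vanishingBelow y
  ext k
  rw [mul_comm y, HahnSeries.coeff_add,
    coeff_mul_eq_sum_Icc hx (coeffMap_mem_vanishingBelow T hy),
    coeff_mul_eq_sum_Icc (coeffMap_mem_vanishingBelow T hx) hy, coeffMap_coeff,
    coeff_mul_eq_sum_Icc hx hy, map_sum, ← Finset.sum_add_distrib]
  refine Finset.sum_congr rfl fun i _ => ?_
  have := hT i (k - i) (x.coeff i) (y.coeff (k - i))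
  rw [add_sub_cancel] at this
  rw [this, coeffMap_coeff, coeffMap_coeff, mul_comm (y.coeff _)]

/-- The derivation `u d/du`. -/
def eulerDer (A : Type) [CommRing A] [Algebra ℂ A] :
    Derivation ℂ (LaurentSeries A) (LaurentSeries A) :=
  Derivation.mk' (coeffMap fun k => (-(k : ℂ)) • LinearMap.id) fun x y => by
    refine coeffMap_mul _ (fun i j x y => ?_) x y
    simp only [LinearMap.smul_apply, LinearMap.id_apply, Algebra.mul_smul_comm, mul_comm y x,
      ← add_smul]
    congr 1
    push_cast
    ring

theorem eulerDer_coeff (h : LaurentSeries A) (k : ℤ) :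
    (eulerDer A h).coeff k = (-(k : A)) * h.coeff k := by
  change (-(k : ℂ)) • h.coeff k = _
  rw [Algebra.smul_def]
  simp

/-- `d/du` as a derivation. -/
def duDer (A : Type) [CommRing A] [Algebra ℂ A] :
    Derivation ℂ (LaurentSeries A) (LaurentSeries A) := upow A (-1) • eulerDer A

theorem ddu_eq_duDer (h : LaurentSeries A) : ddu h = duDer A h := by
  ext k
  have h1 := ddu_coeff h (1 - k)
  rw [show -(1 - k - 1) = k by ring] at h1
  rw [h1, duDer, Derivation.smul_apply, smul_eq_mul, coeff_upow_mul, eulerDer_coeff,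
    show -(1 - k) = k + -1 by ring]
  push_cast
  ring

theorem duDer_coeff (h : LaurentSeries A) (k : ℤ) :
    (duDer A h).coeff (k + 1) = (-(k : A)) * h.coeff k := by
  rw [duDer, Derivation.smul_apply, smul_eq_mul, coeff_upow_mul, eulerDer_coeff]
  simp

theorem duDer_mem_vanishingBelow {N : ℤ} {h : LaurentSeries A} (hh : h ∈ vanishingBelow A N) :
    duDer A h ∈ vanishingBelow A (N + 1) := by
  intro k hk
  have := duDer_coeff h (k - 1)
  rw [sub_add_cancel] at this
  rw [this, hh _ (by omega), mul_zero]

/-- The constant term is annihilated by d/du, so nothing lands on u^{-1}. All integration by parts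
below rests on this. -/
theorem res_duDer (h : LaurentSeries A) : res (duDer A h) = 0 := by
  have := duDer_coeff h 0
  simpa [res] using this

theorem duDer_upow (n : ℤ) : duDer A (upow A n) = (n : LaurentSeries A) * upow A (n - 1) := by
  have hn : (n : LaurentSeries A) = HahnSeries.C (n : A) := (map_intCast HahnSeries.C n).symm
  ext k
  have := duDer_coeff (upow A n) (k - 1)
  rw [sub_add_cancel] at this
  rw [this, hn, coeff_C_mul, upow, upow, HahnSeries.coeff_single, HahnSeries.coeff_single]
  by_cases h : k - 1 = -n
  · rw [if_pos h, if_pos (by omega), h]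
    push_cast
    ring
  · rw [if_neg h, if_neg (by omega), mul_zero, mul_zero]

theorem duDer_C (a : A) : duDer A (HahnSeries.C a) = 0 := by
  ext k
  have := duDer_coeff (HahnSeries.C a : LaurentSeries A) (k - 1)
  rw [sub_add_cancel] at this
  rw [this, HahnSeries.C_apply, HahnSeries.coeff_single, HahnSeries.coeff_zero]
  split_ifs with h
  · simp [h]
  · simp

/-- The extension of a derivation of `A` to `A((u⁻¹))`, acting on the coefficients. -/
def extDer (D : Derivation ℂ A A) : Derivation ℂ (LaurentSeries A) (LaurentSeries A) :=
  Derivation.mk' (coeffMap fun _ => D.toLinearMap) fun x y =>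
    coeffMap_mul _ (fun _ _ x y => D.leibniz x y) x y

theorem extDer_coeff (D : Derivation ℂ A A) (h : LaurentSeries A) (k : ℤ) :
    (extDer D h).coeff k = D (h.coeff k) := rfl

theorem res_extDer (D : Derivation ℂ A A) (h : LaurentSeries A) :
    res (extDer D h) = D (res h) := rfl

theorem extDer_mem_vanishingBelow (D : Derivation ℂ A A) {N : ℤ} {h : LaurentSeries A}
    (hh : h ∈ vanishingBelow A N) : extDer D h ∈ vanishingBelow A N :=
  coeffMap_mem_vanishingBelow _ hh

theorem extDer_C (D : Derivation ℂ A A) (a : A) :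
    extDer D (HahnSeries.C a) = HahnSeries.C (D a) := by
  ext k
  rw [extDer_coeff, HahnSeries.C_apply, HahnSeries.C_apply, HahnSeries.coeff_single,
    HahnSeries.coeff_single]
  split_ifs <;> simp

theorem extDer_upow (D : Derivation ℂ A A) (n : ℤ) : extDer D (upow A n) = 0 := by
  ext k
  rw [extDer_coeff, upow, HahnSeries.coeff_single, HahnSeries.coeff_zero]
  split_ifs <;> simp

theorem extDer_duDer (D : Derivation ℂ A A) (h : LaurentSeries A) :
    extDer D (duDer A h) = duDer A (extDer D h) := by
  ext k
  have h1 := duDer_coeff h (k - 1)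
  have h2 := duDer_coeff (extDer D h) (k - 1)
  rw [sub_add_cancel] at h1 h2
  rw [extDer_coeff, h1, h2, extDer_coeff, D.leibniz, ← Int.cast_neg, D.map_intCast]
  simp

end Calculus

/-! ## Expansions in powers of `f(u)` -/

section Expansions

variable {A : Type} [CommRing A] (φ : ℕ → A)

theorem fSer_mem : (fSer φ : LaurentSeries A) ∈ vanishingBelow A (-1) := by
  intro k hk
  have := fSer_coeff φ (k + 1)
  rw [add_sub_cancel_right] at this
  rw [this]
  exact ofPowerSeries_mem_vanishingBelow _ _ (by omega)

theorem ofPowerSeries_coeff_zero (g : PowerSeries A) :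
    (HahnSeries.ofPowerSeries ℤ A g).coeff 0 = PowerSeries.constantCoeff g := by
  have := LaurentSeries.coeff_coe_powerSeries g 0
  simpa using this

theorem fSer_coeff_neg_one : (fSer φ : LaurentSeries A).coeff (-1) = 1 := by
  have := fSer_coeff φ 0
  rw [zero_sub] at this
  rw [this, ofPowerSeries_coeff_zero]
  simp [fCoeff]

theorem fPow_zero : fPow φ 0 = 1 := by simp [fPow]

theorem fPow_one : fPow φ 1 = (fSer φ : LaurentSeries A) := by simp [fPow]

theorem fPow_add (n m : ℤ) : fPow φ (n + m) = fPow φ n * fPow φ m := by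
  simp [fPow, zpow_add]

theorem fPow_neg_one : fPow φ (-1) = HahnSeries.ofPowerSeries ℤ A
    (PowerSeries.invOfUnit (PowerSeries.mk (fCoeff φ)) 1) * upow A (-1) := by
  simp [fPow, fSer, uUnit, oneUnit]

theorem fPow_neg_one_mem : fPow φ (-1) ∈ vanishingBelow A 1 ∧ (fPow φ (-1)).coeff 1 = 1 := by
  rw [fPow_neg_one]
  have h1 := ofPowerSeries_mem_vanishingBelow
    (PowerSeries.invOfUnit (PowerSeries.mk (fCoeff φ)) 1)
  have h2 := upow_mem_vanishingBelow (A := A) (-1)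
  refine ⟨vanishingBelow_anti (by norm_num) (mul_mem_vanishingBelow h1 h2), ?_⟩
  rw [coeff_mul_lead h1 h2 (by norm_num), ofPowerSeries_coeff_zero]
  simp [upow]

theorem fPow_mem_and_coeff (n : ℤ) :
    fPow φ n ∈ vanishingBelow A (-n) ∧ (fPow φ n).coeff (-n) = 1 := by
  induction n with
  | zero =>
    rw [fPow_zero]
    exact ⟨one_mem_vanishingBelow, by simp⟩
  | succ n ih =>
    rw [fPow_add, fPow_one]
    refine ⟨vanishingBelow_anti (by omega) (mul_mem_vanishingBelow ih.1 (fSer_mem φ)), ?_⟩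
    rw [coeff_mul_lead ih.1 (fSer_mem φ) (by omega), ih.2, fSer_coeff_neg_one, one_mul]
  | pred n ih =>
    have h := fPow_neg_one_mem φ
    rw [sub_eq_add_neg, fPow_add]
    refine ⟨vanishingBelow_anti (by omega) (mul_mem_vanishingBelow ih.1 h.1), ?_⟩
    rw [coeff_mul_lead ih.1 h.1 (by omega), ih.2, h.2, one_mul]

theorem fPow_mem (n : ℤ) : fPow φ n ∈ vanishingBelow A (-n) := (fPow_mem_and_coeff φ n).1

theorem fPow_coeff_neg (n : ℤ) : (fPow φ n).coeff (-n) = 1 := (fPow_mem_and_coeff φ n).2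

theorem fDer_mem : fDer φ ∈ vanishingBelow A 0 := by
  rw [fDer_eq]
  exact ofPowerSeries_mem_vanishingBelow _

theorem fDer_coeff_zero : (fDer φ).coeff 0 = 1 := by
  rw [fDer_eq, ofPowerSeries_coeff_zero]
  simp [fCoeff]

/-- `1 / f'(u)`. -/
def fDerInv : LaurentSeries A := ((fDerUnit φ)⁻¹).1

theorem fDer_mul_fDerInv : fDer φ * fDerInv φ = 1 := (fDerUnit φ).val_inv

theorem fDerInv_mem : fDerInv φ ∈ vanishingBelow A 0 := ofPowerSeries_mem_vanishingBelow _

/-- A series is zero if it pairs to zero with all `f(u)^k f'(u)`. -/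
theorem eq_zero_of_res_fPow_mul {G : LaurentSeries A}
    (hG : ∀ k, res (fPow φ k * (fDer φ * G)) = 0) : G = 0 := by
  obtain ⟨N, hN⟩ := exists_mem_vanishingBelow G
  have key : ∀ j : ℕ, G ∈ vanishingBelow A (N + j) := by
    intro j
    induction j with
    | zero => simpa using hN
    | succ j ih =>
      intro k hk
      rcases lt_or_ge k (N + j) with h | h
      · exact ih k h
      · obtain rfl : k = N + j := by push_cast at hk; omega
        -- Since f^k f' starts with u^k, this k makes the residue equal to the coefficient of index
        -- N + j of G.
        have h1 := hG (N + j - 1)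
        rw [res, coeff_mul_lead (fPow_mem φ _) (mul_mem_vanishingBelow (fDer_mem φ) ih) (by ring),
          fPow_coeff_neg, one_mul, coeff_mul_lead (fDer_mem φ) ih rfl, fDer_coeff_zero,
          one_mul] at h1
        exact h1
  exact eq_zero_of_forall_mem_vanishingBelow fun M =>
    vanishingBelow_anti (by omega) (key ((M : ℤ) - N).toNat)

theorem eq_of_res_fPow_mul {G H : LaurentSeries A}
    (h : ∀ k, res (fPow φ k * (fDer φ * G)) = res (fPow φ k * (fDer φ * H))) : G = H := by
  rw [← sub_eq_zero]
  refine eq_zero_of_res_fPow_mul φ fun k => ?_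
  rw [mul_sub, mul_sub, res_sub, h, sub_self]

/-- The series `∑_{m ≥ 0} g_m f(u)^{-1-m}`. -/
def negSeries (g : ℕ → A) : LaurentSeries A :=
  HahnSeries.ofPowerSeries ℤ A (PowerSeries.mk fun k : ℕ =>
    ∑ m ∈ Finset.range k, g m * (fPow φ (-1 - (m : ℤ))).coeff (k : ℤ))

theorem negSeries_coeff (g : ℕ → A) (k : ℕ) : (negSeries φ g).coeff k =
    ∑ m ∈ Finset.range k, g m * (fPow φ (-1 - (m : ℤ))).coeff (k : ℤ) := by
  rw [negSeries, LaurentSeries.coeff_coe_powerSeries, PowerSeries.coeff_mk]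

/-- The series f(u)^{-1-m} starts at u^{-1-m}, so the terms with m ≥ N do not reach the indices up
to N. Residues of the infinite sum thereby reduce to finite sums. -/
theorem negSeries_sub_mem (g : ℕ → A) (N : ℕ) :
    negSeries φ g - ∑ m ∈ Finset.range N, HahnSeries.C (g m) * fPow φ (-1 - (m : ℤ))
      ∈ vanishingBelow A (N + 1) := by
  intro k hk
  have hz : ∀ m : ℕ, k ≤ m → g m * (fPow φ (-1 - (m : ℤ))).coeff k = 0 := fun m hm => by
    rw [fPow_mem φ (-1 - (m : ℤ)) k (by omega), mul_zero]
  rw [HahnSeries.coeff_sub, HahnSeries.coeff_sum, sub_eq_zero]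
  simp only [coeff_C_mul]
  rcases lt_or_ge k 0 with hk0 | hk0
  · rw [negSeries, ofPowerSeries_mem_vanishingBelow _ _ hk0]
    exact (Finset.sum_eq_zero fun m _ => hz m (by omega)).symm
  · lift k to ℕ using hk0
    rw [negSeries_coeff]
    refine Finset.sum_subset (fun m hm => ?_) fun m _ hm => hz m ?_
    · simp only [Finset.mem_range] at *
      omega
    · simp only [Finset.mem_range] at hm
      omega

theorem negSeries_mem (g : ℕ → A) : negSeries φ g ∈ vanishingBelow A 1 := by
  simpa using negSeries_sub_mem φ g 0

theorem expandInv_eq_negSeries (j : ℕ) (x : A) : expandInv φ (RingHom.id A) j x =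
    negSeries φ fun m => (m.choose j : A) * x ^ (m - j) := by
  unfold expandInv negSeries
  congr 2
  funext k
  refine Finset.sum_congr rfl fun m _ => ?_
  rw [nsmul_eq_mul, RingHom.id_apply]
  ring

/-- The value `p(f(u))` of a polynomial `p` at `f(u)`. -/
def evalF (p : Polynomial A) : LaurentSeries A := p.eval₂ HahnSeries.C (fSer φ).1

theorem evalF_add (p q : Polynomial A) : evalF φ (p + q) = evalF φ p + evalF φ q :=
  Polynomial.eval₂_add ..

theorem evalF_sub (p q : Polynomial A) : evalF φ (p - q) = evalF φ p - evalF φ q :=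
  Polynomial.eval₂_sub ..

theorem evalF_mul (p q : Polynomial A) : evalF φ (p * q) = evalF φ p * evalF φ q :=
  Polynomial.eval₂_mul ..

theorem evalF_C (a : A) : evalF φ (Polynomial.C a) = HahnSeries.C a := Polynomial.eval₂_C ..

theorem evalF_X : evalF φ Polynomial.X = (fSer φ).1 := Polynomial.eval₂_X ..

theorem fPow_natCast (m : ℕ) : fPow φ m = (fSer φ).1 ^ m := by simp [fPow]

theorem evalF_monomial (m : ℕ) (a : A) :
    evalF φ (Polynomial.monomial m a) = HahnSeries.C a * fPow φ m := by
  rw [evalF, Polynomial.eval₂_monomial, fPow_natCast]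

variable [Algebra ℂ A]

theorem duDer_fSer : duDer A (fSer φ).1 = fDer φ := by rw [fDer, ddu_eq_duDer]

theorem derivation_fPow (D : Derivation ℂ (LaurentSeries A) (LaurentSeries A)) (n : ℤ) :
    D (fPow φ n) = (n : LaurentSeries A) * fPow φ (n - 1) * D (fSer φ).1 := by
  have e : ∀ k, fPow φ k = fPow φ (k - 1) * (fSer φ).1 := fun k => by
    rw [← fPow_one, ← fPow_add, sub_add_cancel]
  induction n with
  | zero => simp [fPow_zero]
  | succ n ih =>
    rw [e, Derivation.leibniz, add_sub_cancel_right, ih, e (n : ℤ)]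
    simp only [smul_eq_mul]
    push_cast
    ring
  -- Downward, the Leibniz rule for f^{k} = f^{k-1} f is solved for the derivative of f^{k-1} by
  -- multiplying with f^{-1}.
  | pred n ih =>
    have h := ih
    rw [e (-(n : ℤ)), Derivation.leibniz] at h
    simp only [smul_eq_mul] at h
    have hu : (fSer φ).1 * fPow φ (-1) = 1 := by
      rw [← fPow_one, ← fPow_add]
      exact fPow_zero φ
    have e2 : fPow φ (-(n : ℤ) - 1 - 1) = fPow φ (-(n : ℤ) - 1) * fPow φ (-1) := by
      rw [← fPow_add]
      rfl
    rw [e2]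
    have h3 := congrArg (· * fPow φ (-1)) h
    push_cast at h3 ⊢
    linear_combination h3 - (D (fPow φ (-(n : ℤ) - 1))) * hu

theorem duDer_fPow (n : ℤ) :
    duDer A (fPow φ n) = (n : LaurentSeries A) * fPow φ (n - 1) * fDer φ := by
  rw [derivation_fPow, duDer_fSer]

/-- For k ≠ -1 the series is the derivative of f^{k+1}/(k+1), where dividing by k + 1 needs the
ℂ-algebra structure. For k = -1 only the leading terms contribute. This is the duality that extracts
coefficients in powers of f. -/
theorem res_fPow_mul_fDer (k : ℤ) : res (fPow φ k * fDer φ) = if k = -1 then 1 else 0 := by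
  split_ifs with h
  · subst h
    rw [res, coeff_mul_lead (fPow_mem φ _) (fDer_mem φ) (by ring), fPow_coeff_neg,
      fDer_coeff_zero, one_mul]
  · have h1 := res_duDer (fPow φ (k + 1))
    rw [duDer_fPow, add_sub_cancel_right, mul_assoc,
      show ((k + 1 : ℤ) : LaurentSeries A) = HahnSeries.C ((k + 1 : ℤ) : A) from
        (map_intCast HahnSeries.C (k + 1)).symm, res_C_mul] at h1
    have h2 : ((k + 1 : ℤ) : ℂ) ≠ 0 := Int.cast_ne_zero.2 (by omega)
    have h3 : ((k + 1 : ℤ) : ℂ) • res (fPow φ k * fDer φ) = 0 := by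
      rw [Algebra.smul_def, map_intCast, h1]
    exact (smul_eq_zero_iff_eq (Units.mk0 _ h2)).1 h3

theorem res_fPow_mul_negSeries (g : ℕ → A) (k : ℤ) :
    res (fPow φ k * (fDer φ * negSeries φ g)) = if 0 ≤ k then g k.toNat else 0 := by
  -- Large enough that the tail pairs to zero with f^k f', and that the index m = k is kept when k ≥
  -- 0.
  set N := (k + 1).toNat with hN
  have h := res_eq_zero (N := -k + (0 + ((N : ℤ) + 1))) (by omega)
    (mul_mem_vanishingBelow (fPow_mem φ k)
      (mul_mem_vanishingBelow (fDer_mem φ) (negSeries_sub_mem φ g N)))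
  rw [mul_sub, mul_sub, res_sub, sub_eq_zero] at h
  rw [h, Finset.mul_sum, Finset.mul_sum, res_sum]
  have : ∀ m : ℕ, res (fPow φ k * (fDer φ * (HahnSeries.C (g m) * fPow φ (-1 - (m : ℤ))))) =
      if (m : ℤ) = k then g m else 0 := fun m => by
    rw [show fPow φ k * (fDer φ * (HahnSeries.C (g m) * fPow φ (-1 - (m : ℤ)))) =
      HahnSeries.C (g m) * (fPow φ k * fPow φ (-1 - (m : ℤ)) * fDer φ) by ring, ← fPow_add,
      res_C_mul, res_fPow_mul_fDer, mul_ite, mul_one, mul_zero]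
    congr 1
    apply propext
    omega
  simp only [this]
  split_ifs with h0
  · rw [Finset.sum_eq_single k.toNat]
    · rw [if_pos (by omega)]
    · intro m _ hm
      rw [if_neg (by omega)]
    · intro hm
      simp only [Finset.mem_range] at hm
      omega
  · refine Finset.sum_eq_zero fun m _ => ?_
    rw [if_neg (by omega)]

theorem res_fPow_mul_evalF (p : Polynomial A) (k : ℤ) :
    res (fPow φ k * (fDer φ * evalF φ p)) = if 0 ≤ k then 0 else p.coeff (-1 - k).toNat := by
  induction p using Polynomial.induction_on' with
  | add p q hp hq =>
    rw [evalF_add, mul_add, mul_add, res_add, hp, hq, Polynomial.coeff_add]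
    split_ifs <;> simp
  | monomial m a =>
    rw [evalF_monomial, show fPow φ k * (fDer φ * (HahnSeries.C a * fPow φ m)) =
      HahnSeries.C a * (fPow φ k * fPow φ m * fDer φ) by ring, ← fPow_add, res_C_mul,
      res_fPow_mul_fDer, Polynomial.coeff_monomial]
    split_ifs <;> first | omega | simp

theorem res_fDer_mul_evalF (p : Polynomial A) : res (fDer φ * evalF φ p) = 0 := by
  simpa [fPow_zero] using res_fPow_mul_evalF φ p 0

/-- Pairing with f^{-1-m} f' returns the m-th coefficient of p, but it gives zero on series of
negative powers of u. This rigidity turns identities modulo negative powers into exact ones. -/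
theorem evalF_eq_zero_of_mem {p : Polynomial A} (hp : evalF φ p ∈ vanishingBelow A 1) : p = 0 := by
  ext m
  have h := res_fPow_mul_evalF φ p (-1 - (m : ℤ))
  rw [if_neg (by omega), show (-1 - (-1 - (m : ℤ))).toNat = m by omega] at h
  rw [← h, Polynomial.coeff_zero]
  exact res_eq_zero (by omega)
    (mul_mem_vanishingBelow (fPow_mem φ _) (mul_mem_vanishingBelow (fDer_mem φ) hp))

theorem duDer_evalF (p : Polynomial A) :
    duDer A (evalF φ p) = evalF φ (Polynomial.derivative p) * fDer φ := by
  induction p using Polynomial.induction_on' with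
  | add p q hp hq => rw [evalF_add, map_add, hp, hq, map_add, evalF_add, add_mul]
  | monomial m a =>
    rw [evalF_monomial, Derivation.leibniz, duDer_C, duDer_fPow, Polynomial.derivative_monomial,
      evalF_monomial]
    cases m with
    | zero => simp
    | succ m =>
      simp only [smul_eq_mul, map_mul, map_natCast, Nat.add_sub_cancel]
      push_cast
      rw [add_sub_cancel_right]
      ring

/-- The extension of a derivation of `A` to `A[X]`, acting on the coefficients. -/
def polyDer (D : Derivation ℂ A A) (p : Polynomial A) : Polynomial A :=
  ∑ m ∈ p.support, Polynomial.monomial m (D (p.coeff m))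

theorem polyDer_coeff (D : Derivation ℂ A A) (p : Polynomial A) (m : ℕ) :
    (polyDer D p).coeff m = D (p.coeff m) := by
  rw [polyDer, Polynomial.finsetSum_coeff]
  simp only [Polynomial.coeff_monomial]
  rw [Finset.sum_ite_eq']
  split_ifs with h
  · rfl
  · rw [Polynomial.notMem_support_iff.1 h, map_zero]

theorem polyDer_add (D : Derivation ℂ A A) (p q : Polynomial A) :
    polyDer D (p + q) = polyDer D p + polyDer D q := by
  ext m
  simp [polyDer_coeff]

theorem polyDer_monomial (D : Derivation ℂ A A) (m : ℕ) (a : A) :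
    polyDer D (Polynomial.monomial m a) = Polynomial.monomial m (D a) := by
  ext k
  rw [polyDer_coeff, Polynomial.coeff_monomial, Polynomial.coeff_monomial]
  split_ifs <;> simp

theorem derivative_polyDer (D : Derivation ℂ A A) (p : Polynomial A) :
    Polynomial.derivative (polyDer D p) = polyDer D (Polynomial.derivative p) := by
  ext k
  rw [polyDer_coeff, Polynomial.coeff_derivative, Polynomial.coeff_derivative, polyDer_coeff,
    D.leibniz, map_add, D.map_natCast, D.map_one_eq_zero]
  simp [mul_comm]

theorem extDer_evalF (D : Derivation ℂ A A) (p : Polynomial A) :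
    extDer D (evalF φ p) = evalF φ (polyDer D p)
      + evalF φ (Polynomial.derivative p) * extDer D (fSer φ).1 := by
  induction p using Polynomial.induction_on' with
  | add p q hp hq =>
    simp only [evalF_add, polyDer_add, map_add, hp, hq]
    ring
  | monomial m a =>
    rw [polyDer_monomial, evalF_monomial, evalF_monomial, Derivation.leibniz, extDer_C,
      Polynomial.derivative_monomial, evalF_monomial, fPow_natCast, fPow_natCast,
      Derivation.leibniz_pow]
    simp only [smul_eq_mul, nsmul_eq_mul, map_mul, map_natCast]
    ring

theorem apply_eval (D : Derivation ℂ A A) (p : Polynomial A) (x : A) :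
    D (p.eval x) = (polyDer D p).eval x + (Polynomial.derivative p).eval x * D x := by
  induction p using Polynomial.induction_on' with
  | add p q hp hq =>
    simp only [Polynomial.eval_add, polyDer_add, map_add, hp, hq]
    ring
  | monomial m a =>
    rw [polyDer_monomial, Polynomial.derivative_monomial, Polynomial.eval_monomial,
      Polynomial.eval_monomial, Polynomial.eval_monomial, D.leibniz, D.leibniz_pow]
    simp only [smul_eq_mul, nsmul_eq_mul]
    ring

/-! ### The series `1 / (f(u) - x)` -/

/-- The series `1 / (f(u) - x)`. -/
def invSer (x : A) : LaurentSeries A := expandInv φ (RingHom.id A) 0 x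

theorem invSer_eq (x : A) : invSer φ x = negSeries φ fun m => x ^ m := by
  rw [invSer, expandInv_eq_negSeries]
  simp

theorem invSer_mem (x : A) : invSer φ x ∈ vanishingBelow A 1 := by
  rw [invSer_eq]
  exact negSeries_mem φ _

theorem res_fPow_mul_mul_sub (G : LaurentSeries A) (x : A) (k : ℤ) :
    res (fPow φ k * (fDer φ * (G * ((fSer φ).1 - HahnSeries.C x)))) =
      res (fPow φ (k + 1) * (fDer φ * G)) - x * res (fPow φ k * (fDer φ * G)) := by
  rw [← res_C_mul, ← res_sub, fPow_add, fPow_one]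
  congr 1
  ring

/-- The geometric series telescopes after pairing with f^k f'. The derivatives of 1/(f(u) - x) are
then obtained by differentiating this product. -/
theorem invSer_mul_sub (x : A) : invSer φ x * ((fSer φ).1 - HahnSeries.C x) = 1 := by
  refine eq_of_res_fPow_mul φ fun k => ?_
  rw [res_fPow_mul_mul_sub, invSer_eq, res_fPow_mul_negSeries, res_fPow_mul_negSeries, mul_one,
    res_fPow_mul_fDer]
  rcases lt_trichotomy k (-1) with h | h | h
  · rw [if_neg (by omega), if_neg (by omega), if_neg (by omega), mul_zero, sub_zero]
  · subst h; simp
  · rw [if_pos (by omega), if_pos (by omega), if_neg (by omega),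
      show (k + 1).toNat = k.toNat + 1 by omega]
    ring

theorem duDer_invSer (x : A) : duDer A (invSer φ x) = -(invSer φ x ^ 2 * fDer φ) := by
  have h := congrArg (duDer A) (invSer_mul_sub φ x)
  rw [Derivation.leibniz, map_sub, duDer_C, duDer_fSer, Derivation.map_one_eq_zero] at h
  simp only [smul_eq_mul, sub_zero] at h
  linear_combination invSer φ x * h - (duDer A (invSer φ x)) * invSer_mul_sub φ x

theorem extDer_invSer (D : Derivation ℂ A A) (x : A) :
    extDer D (invSer φ x) =
      -(invSer φ x ^ 2 * (extDer D (fSer φ).1 - HahnSeries.C (D x))) := by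
  have h := congrArg (extDer D) (invSer_mul_sub φ x)
  rw [Derivation.leibniz, map_sub, extDer_C, Derivation.map_one_eq_zero] at h
  simp only [smul_eq_mul] at h
  linear_combination invSer φ x * h - (extDer D (invSer φ x)) * invSer_mul_sub φ x

/-! ### The decomposition of `u^{1-n} f'(u)` -/

/-- `Res_u u^{1-n} f'(u)² f(u)^m`. -/
def fieldCoeff (n m : ℤ) : A := res (upow A (1 - n) * (fDer φ ^ 2 * fPow φ m))

theorem fDer_sq_mem : fDer φ ^ 2 ∈ vanishingBelow A 0 := by
  rw [sq]
  exact mul_mem_vanishingBelow (fDer_mem φ) (fDer_mem φ)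

/-- The integrand starts with u^{1-n+m}, which is then below u^{-1}. Consequently a_n has degree at
most 1 - n. -/
theorem fieldCoeff_eq_zero {n m : ℤ} (h : m ≤ n - 3) : fieldCoeff φ n m = 0 :=
  res_eq_zero (by omega) (mul_mem_vanishingBelow (upow_mem_vanishingBelow _)
    (mul_mem_vanishingBelow (fDer_sq_mem φ) (fPow_mem φ m)))

/-- The polynomial part in `f(u)` of `u^{1-n} f'(u)`. -/
def fieldPoly (n : ℤ) : Polynomial A :=
  ∑ m ∈ Finset.range (2 - n).toNat, Polynomial.monomial m (fieldCoeff φ n (-1 - (m : ℤ)))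

theorem fieldPoly_coeff (n : ℤ) (m : ℕ) :
    (fieldPoly φ n).coeff m = fieldCoeff φ n (-1 - (m : ℤ)) := by
  rw [fieldPoly, Polynomial.finsetSum_coeff]
  simp only [Polynomial.coeff_monomial]
  rw [Finset.sum_ite_eq']
  split_ifs with h
  · rfl
  · rw [fieldCoeff_eq_zero]
    simp only [Finset.mem_range] at h
    omega

/-- The part of `u^{1-n} f'(u)` with negative powers of `f(u)`. -/
def fieldNeg (n : ℤ) : LaurentSeries A := negSeries φ fun m => fieldCoeff φ n m

theorem fieldNeg_mem (n : ℤ) : fieldNeg φ n ∈ vanishingBelow A 1 := negSeries_mem φ _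

/-- Both sides have the same residues against every f^k f': for k ≥ 0 these see only the negative
part, and for k < 0 only the polynomial part. -/
theorem upow_mul_fDer (n : ℤ) :
    upow A (1 - n) * fDer φ = evalF φ (fieldPoly φ n) + fieldNeg φ n := by
  refine eq_of_res_fPow_mul φ fun k => ?_
  rw [mul_add, mul_add, res_add, res_fPow_mul_evalF, fieldNeg, res_fPow_mul_negSeries,
    fieldPoly_coeff, show fPow φ k * (fDer φ * (upow A (1 - n) * fDer φ)) =
      upow A (1 - n) * (fDer φ ^ 2 * fPow φ k) by ring]
  change fieldCoeff φ n k = _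
  split_ifs with h
  · rw [Int.toNat_of_nonneg h, zero_add]
  · rw [Int.toNat_of_nonneg (by omega), add_zero]
    congr 1
    omega

/-- Taking the residue in z first leaves a finite sum of powers f(u)^m with coefficients from
f(z)^{-1-m}, and the residue in u turns f(u)^m into the m-th negative coefficient of u^{1-n} f'. So
the f_l-components of 𝓛_n assemble into one series. -/
theorem modeCoeff_eq (n : ℤ) (j : ℕ) :
    modeCoeff φ n (-2 - (j : ℤ)) = (fieldNeg φ n).coeff (j + 1 : ℕ) := by
  rw [fieldNeg, negSeries_coeff, modeCoeff, mul_assoc, res_C_mul]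
  have : res (upow (LaurentSeries A) (-2 - (-2 - (j : ℤ))) *
      expandInv φ HahnSeries.C 0 (fSer φ).1) =
      ∑ m ∈ Finset.range (j + 1),
        HahnSeries.C ((fPow φ (-1 - (m : ℤ))).coeff ((j + 1 : ℕ) : ℤ)) * fPow φ m := by
    rw [res, coeff_upow_mul, show 1 + (-2 - (-2 - (j : ℤ))) = ((j + 1 : ℕ) : ℤ) by push_cast; ring,
      expandInv, LaurentSeries.coeff_coe_powerSeries, PowerSeries.coeff_mk]
    simp only [Nat.choose_zero_right, one_smul, Nat.sub_zero, fPow_natCast]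
  rw [this, Finset.mul_sum, Finset.mul_sum, res_sum]
  refine Finset.sum_congr rfl fun m _ => ?_
  rw [fieldCoeff, mul_comm (res _), ← res_C_mul]
  congr 1
  ring

theorem loewnerCoeff_eq (j : ℕ) (x : A) :
    loewnerCoeff φ (-2 - (j : ℤ)) x = (invSer φ x).coeff (j + 1 : ℕ) := by
  rw [loewnerCoeff, res, coeff_upow_mul, invSer]
  congr 1
  push_cast
  ring

theorem res_upow_mul_negSeries (g : ℕ → A) (n : ℤ) :
    res (upow A (1 - n) * (fDer φ ^ 2 * negSeries φ g)) =
      ∑ m ∈ Finset.range (2 - n).toNat, fieldCoeff φ n (-1 - (m : ℤ)) * g m := by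
  have h := res_eq_zero (N := -(1 - n) + (0 + (((2 - n).toNat : ℤ) + 1))) (by omega)
    (mul_mem_vanishingBelow (upow_mem_vanishingBelow (1 - n))
      (mul_mem_vanishingBelow (fDer_sq_mem φ) (negSeries_sub_mem φ g (2 - n).toNat)))
  rw [mul_sub, mul_sub, res_sub, sub_eq_zero] at h
  rw [h, Finset.mul_sum, Finset.mul_sum, res_sum]
  refine Finset.sum_congr rfl fun m _ => ?_
  rw [fieldCoeff, mul_comm _ (g m), ← res_C_mul]
  congr 1
  ring

/-- A formal Cauchy formula: the residue against f'/(f - x) evaluates the polynomial part at x. The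
square of the pole gives the derivative in the same way. -/
theorem pointCoeff_zero (n : ℤ) (x : A) : pointCoeff φ n 0 x = (fieldPoly φ n).eval x := by
  rw [pointCoeff, expandInv_eq_negSeries, res_upow_mul_negSeries, fieldPoly,
    Polynomial.eval_finsetSum]
  simp [Polynomial.eval_monomial]

theorem pointCoeff_one (n : ℤ) (x : A) :
    pointCoeff φ n 1 x = (Polynomial.derivative (fieldPoly φ n)).eval x := by
  rw [pointCoeff, expandInv_eq_negSeries, res_upow_mul_negSeries, fieldPoly, map_sum,
    Polynomial.eval_finsetSum]
  simp [Polynomial.eval_monomial, Polynomial.derivative_monomial, mul_assoc]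

end Expansions

/-! ## The Schwarzian derivative and its variation -/

section Schwarzian

variable {A : Type} [CommRing A] [Algebra ℂ A] (φ : ℕ → A)

theorem derivation_fDerInv (D : Derivation ℂ (LaurentSeries A) (LaurentSeries A)) :
    D (fDerInv φ) = -(fDerInv φ ^ 2 * D (fDer φ)) := by
  have h := congrArg D (fDer_mul_fDerInv φ)
  rw [Derivation.leibniz, Derivation.map_one_eq_zero] at h
  simp only [smul_eq_mul] at h
  linear_combination fDerInv φ * h - D (fDerInv φ) * fDer_mul_fDerInv φ

theorem schwarzian_eq : schwarzian φ = duDer A (duDer A (fDer φ)) * fDerInv φ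
    - HahnSeries.C (algebraMap ℂ A (3 / 2)) * (duDer A (fDer φ) * fDerInv φ) ^ 2 := by
  rw [schwarzian, ddu_eq_duDer, ddu_eq_duDer]
  congr 1
  ext k
  rw [coeff_C_mul, ← Algebra.smul_def]
  rfl

/-- The constant 3/2 enters the ring identities as an opaque element; this relation eliminates it.
-/
theorem two_mul_C_three_halves :
    (2 : LaurentSeries A) * HahnSeries.C (algebraMap ℂ A (3 / 2)) = 3 := by
  have h : (2 : ℂ) * (3 / 2) = 3 := by norm_num
  have := congrArg (fun z => (HahnSeries.C (algebraMap ℂ A z) : LaurentSeries A)) h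
  simpa only [map_mul, map_ofNat] using this

/-- The third order operator `v ↦ f'² ((1/f') d/du)³ v`, which gives the variation of the
Schwarzian derivative of `f` under a variation `v` of `f`. -/
def thirdOrder (v : LaurentSeries A) : LaurentSeries A :=
  fDerInv φ * duDer A (duDer A (duDer A v))
    - 3 * fDerInv φ ^ 2 * duDer A (fDer φ) * duDer A (duDer A v)
    - fDerInv φ ^ 2 * duDer A (duDer A (fDer φ)) * duDer A v
    + 3 * fDerInv φ ^ 3 * duDer A (fDer φ) ^ 2 * duDer A v

theorem thirdOrder_add (v w : LaurentSeries A) :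
    thirdOrder φ (v + w) = thirdOrder φ v + thirdOrder φ w := by
  simp only [thirdOrder, map_add]
  ring

theorem thirdOrder_neg (v : LaurentSeries A) : thirdOrder φ (-v) = -thirdOrder φ v := by
  simp only [thirdOrder, map_neg]
  ring

theorem thirdOrder_C_mul (a : A) (v : LaurentSeries A) :
    thirdOrder φ (HahnSeries.C a * v) = HahnSeries.C a * thirdOrder φ v := by
  simp only [thirdOrder, Derivation.leibniz, duDer_C, smul_eq_mul, mul_zero, add_zero]
  ring

/-- A derivation of the coefficients commutes with d/du, so D only has to be applied to f and the
quotients defining Sf differentiated. -/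
theorem extDer_schwarzian (D : Derivation ℂ A A) :
    extDer D (schwarzian φ) = thirdOrder φ (extDer D (fSer φ).1) := by
  have h : extDer D (fDer φ) = duDer A (extDer D (fSer φ).1) := by
    rw [← duDer_fSer, extDer_duDer]
  rw [schwarzian_eq, thirdOrder, map_sub, Derivation.leibniz, Derivation.leibniz,
    Derivation.leibniz_pow, Derivation.leibniz, extDer_C, D.map_algebraMap, derivation_fDerInv,
    extDer_duDer, extDer_duDer, h]
  simp only [smul_eq_mul, map_zero, nsmul_eq_mul]
  push_cast
  linear_combination (-(duDer A (fDer φ) * fDerInv φ) *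
    (duDer A (fDer φ) * -(fDerInv φ ^ 2 * duDer A (extDer D (fSer φ).1))
      + fDerInv φ * duDer A (duDer A (extDer D (fSer φ).1)))) * two_mul_C_three_halves (A := A)

/-- The variation ξ f' is an infinitesimal reparametrisation of u along ξ, and this is the classical
transformation law of a projective connection. -/
theorem thirdOrder_mul_fDer (ξ : LaurentSeries A) : thirdOrder φ (ξ * fDer φ) =
    duDer A (duDer A (duDer A ξ)) + 2 * schwarzian φ * duDer A ξ
      + duDer A (schwarzian φ) * ξ := by
  rw [schwarzian_eq, thirdOrder]
  simp only [map_sub, map_add, Derivation.leibniz, Derivation.leibniz_pow, duDer_C,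
    derivation_fDerInv, smul_eq_mul, nsmul_eq_mul]
  set r := fDerInv φ
  set f₁ := fDer φ with hf₁
  set f₂ := duDer A f₁
  set f₃ := duDer A f₂
  set f₄ := duDer A f₃
  set ξ₁ := duDer A ξ
  set ξ₂ := duDer A ξ₁
  set ξ₃ := duDer A ξ₂
  have h : f₁ * r = 1 := fDer_mul_fDerInv φ
  push_cast
  linear_combination (ξ₃ - 3 * r * f₂ * ξ₂ - r * f₃ * ξ₁ + 3 * r ^ 2 * f₂ ^ 2 * ξ₁) * h
    + (r ^ 2 * f₂ ^ 2 * ξ₁ + f₂ * r * (f₃ * r - r ^ 2 * f₂ ^ 2) * ξ) *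
      two_mul_C_three_halves (A := A)

/-- The bilinear form `Res_u f' X ((1/f') d/du)³ Y`. -/
def thirdForm (X Y : LaurentSeries A) : A := res (fDerInv φ * (X * thirdOrder φ Y))

theorem thirdForm_add_left (X X' Y : LaurentSeries A) :
    thirdForm φ (X + X') Y = thirdForm φ X Y + thirdForm φ X' Y := by
  rw [thirdForm, add_mul, mul_add, res_add]
  rfl

theorem thirdForm_add_right (X Y Y' : LaurentSeries A) :
    thirdForm φ X (Y + Y') = thirdForm φ X Y + thirdForm φ X Y' := by
  rw [thirdForm, thirdOrder_add, mul_add, mul_add, res_add]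
  rfl

/-- Integration by parts for an odd order operator: the sum of the two integrands is a total
derivative. -/
theorem thirdForm_swap (X Y : LaurentSeries A) : thirdForm φ X Y = -thirdForm φ Y X := by
  rw [eq_neg_iff_add_eq_zero, thirdForm, thirdForm, ← res_add]
  -- With ∂ = (1/f') d/du, the primitive is X ∂²Y - ∂X ∂Y + Y ∂²X.
  have h := res_duDer (X * (fDerInv φ ^ 2 * duDer A (duDer A Y)
      - fDerInv φ ^ 3 * duDer A (fDer φ) * duDer A Y)
    - fDerInv φ ^ 2 * duDer A X * duDer A Y
    + Y * (fDerInv φ ^ 2 * duDer A (duDer A X)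
      - fDerInv φ ^ 3 * duDer A (fDer φ) * duDer A X))
  rw [← h]
  congr 1
  simp only [thirdOrder, map_sub, map_add, Derivation.leibniz, Derivation.leibniz_pow,
    derivation_fDerInv, smul_eq_mul, nsmul_eq_mul]
  push_cast
  ring

/-- The operator (1/f') d/du differentiates polynomials in f as if f were the variable. -/
theorem thirdOrder_evalF (p : Polynomial A) : thirdOrder φ (evalF φ p) =
    fDer φ ^ 2 * evalF φ (Polynomial.derivative (Polynomial.derivative
      (Polynomial.derivative p))) := by
  have h := fDer_mul_fDerInv φ
  simp only [thirdOrder, duDer_evalF, map_add, Derivation.leibniz, smul_eq_mul]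
  set r := fDerInv φ
  set f₁ := fDer φ with hf₁
  set f₂ := duDer A f₁
  set f₃ := duDer A f₂
  set p₁ := evalF φ (Polynomial.derivative p)
  set p₂ := evalF φ (Polynomial.derivative (Polynomial.derivative p))
  set p₃ := evalF φ (Polynomial.derivative (Polynomial.derivative (Polynomial.derivative p)))
  linear_combination (f₁ ^ 2 * p₃ - 3 * r * f₁ * f₂ * p₂ - r * f₃ * p₁
    + 3 * r ^ 2 * f₂ ^ 2 * p₁) * h

/-- The integrand is f' times a polynomial in f, hence exact. -/
theorem thirdForm_evalF (p q : Polynomial A) : thirdForm φ (evalF φ p) (evalF φ q) = 0 := by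
  rw [thirdForm, thirdOrder_evalF, ← res_fDer_mul_evalF φ (p * Polynomial.derivative
    (Polynomial.derivative (Polynomial.derivative q))), evalF_mul]
  congr 1
  linear_combination (fDer φ * evalF φ p * evalF φ (Polynomial.derivative
    (Polynomial.derivative (Polynomial.derivative q)))) * fDer_mul_fDerInv φ

theorem thirdOrder_mem {v : LaurentSeries A} (hv : v ∈ vanishingBelow A 1) :
    thirdOrder φ v ∈ vanishingBelow A 2 := by
  have hr := fDerInv_mem φ
  have h0 := fDer_mem φ
  have h1 := vanishingBelow_anti (N := 0) (by norm_num) (duDer_mem_vanishingBelow h0)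
  have h2 := vanishingBelow_anti (N := 0) (by norm_num) (duDer_mem_vanishingBelow h1)
  have v1 := vanishingBelow_anti (N := 2) (by norm_num) (duDer_mem_vanishingBelow hv)
  have v2 := vanishingBelow_anti (N := 2) (by norm_num) (duDer_mem_vanishingBelow v1)
  have v3 := vanishingBelow_anti (N := 2) (by norm_num) (duDer_mem_vanishingBelow v2)
  have key : ∀ {a w : LaurentSeries A}, a ∈ vanishingBelow A 0 → w ∈ vanishingBelow A 2 →
      a * w ∈ vanishingBelow A 2 := fun ha hw => by
    simpa using mul_mem_vanishingBelow ha hw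
  have e : thirdOrder φ v = fDerInv φ * duDer A (duDer A (duDer A v))
      + HahnSeries.C (-3) * (fDerInv φ * (fDerInv φ * (duDer A (fDer φ) * duDer A (duDer A v))))
      + HahnSeries.C (-1) * (fDerInv φ * (fDerInv φ * (duDer A (duDer A (fDer φ)) * duDer A v)))
      + HahnSeries.C 3 * (fDerInv φ * (fDerInv φ * (fDerInv φ *
        (duDer A (fDer φ) * (duDer A (fDer φ) * duDer A v))))) := by
    simp only [thirdOrder, map_neg, map_ofNat, map_one]
    ring
  rw [e]
  exact add_mem (add_mem (add_mem (key hr v3)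
    (key (C_mem_vanishingBelow _) (key hr (key hr (key h1 v2)))))
    (key (C_mem_vanishingBelow _) (key hr (key hr (key h2 v1)))))
    (key (C_mem_vanishingBelow _) (key hr (key hr (key hr (key h1 (key h1 v1))))))

theorem thirdForm_eq_zero {X Y : LaurentSeries A} (hX : X ∈ vanishingBelow A 1)
    (hY : Y ∈ vanishingBelow A 1) : thirdForm φ X Y = 0 :=
  res_eq_zero (N := 0 + (1 + 2)) (by norm_num) (mul_mem_vanishingBelow (fDerInv_mem φ)
    (mul_mem_vanishingBelow hX (thirdOrder_mem φ hY)))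

theorem thirdForm_mul_fDer (ξ Y : LaurentSeries A) :
    thirdForm φ (ξ * fDer φ) Y = res (ξ * thirdOrder φ Y) := by
  rw [thirdForm]
  congr 1
  linear_combination (ξ * thirdOrder φ Y) * fDer_mul_fDerInv φ

/-- Here the form is computed in the variable u. The third derivative of u^{1-n} yields the cubic
cocycle, and the two terms with Sf combine into one mode after integrating the derivative of Sf by
parts. -/
theorem thirdForm_upow (n m : ℤ) :
    thirdForm φ (upow A (1 - m) * fDer φ) (upow A (1 - n) * fDer φ) =
      -(((n : A) - m) * schwarzCoeff φ (n + m)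
        + if n + m = 0 then (n : A) ^ 3 - n else 0) := by
  have e1 : upow A (1 - m) * upow A (-n) = upow A (1 - (n + m)) := by
    rw [upow_mul_upow]; congr 1; ring
  have e2 : upow A (1 - m) * upow A (-n - 1 - 1) = upow A (-n - m - 1) := by
    rw [upow_mul_upow]; congr 1; ring
  have e3 : upow A (1 - m) * upow A (1 - n) = upow A (2 - n - m) := by
    rw [upow_mul_upow]; congr 1; ring
  have hc : ∀ k : ℤ, (k : LaurentSeries A) = HahnSeries.C (k : A) := fun k =>
    (map_intCast HahnSeries.C k).symm
  have h := res_duDer (upow A (2 - n - m) * schwarzian φ)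
  rw [Derivation.leibniz, duDer_upow, show 2 - n - m - 1 = 1 - (n + m) by ring] at h
  simp only [smul_eq_mul] at h
  rw [res_add, mul_left_comm, hc, res_C_mul, mul_comm (schwarzian φ)] at h
  change _ + _ * schwarzCoeff φ (n + m) = 0 at h
  rw [thirdForm_mul_fDer, thirdOrder_mul_fDer, duDer_upow, show 1 - n - 1 = -n by ring]
  simp only [Derivation.leibniz, hc, duDer_C, duDer_upow, smul_eq_mul, mul_zero, add_zero]
  have e : upow A (1 - m) * (HahnSeries.C ((1 - n : ℤ) : A) * (HahnSeries.C ((-n : ℤ) : A) *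
      (HahnSeries.C ((-n - 1 : ℤ) : A) * upow A (-n - 1 - 1))) +
      2 * schwarzian φ * (HahnSeries.C ((1 - n : ℤ) : A) * upow A (-n)) +
      duDer A (schwarzian φ) * upow A (1 - n)) =
      HahnSeries.C (((1 - n : ℤ) : A) * ((-n : ℤ) : A) * ((-n - 1 : ℤ) : A)) *
        upow A (-n - m - 1)
      + HahnSeries.C (2 * ((1 - n : ℤ) : A)) * (upow A (1 - (n + m)) * schwarzian φ)
      + upow A (2 - n - m) * duDer A (schwarzian φ) := by
    rw [← e1, ← e2, ← e3]
    simp only [map_mul, map_ofNat]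
    ring
  rw [e, res_add, res_add, res_C_mul, res_C_mul, res_upow]
  change _ + _ * schwarzCoeff φ (n + m) + _ = _
  have hi : (-n - m - 1 = -1) ↔ n + m = 0 := by omega
  simp only [hi]
  push_cast at h ⊢
  split_ifs with h0
  · linear_combination h
  · linear_combination h

/-- Split u^{1-n} f' as P_n + N_n, polynomial plus negative part in f, and let B be `thirdForm`. The
left side is -B(P_m + N_m, N_n) + B(P_n + N_n, N_m). As B is antisymmetric and vanishes on (P, P)
and (N, N), this equals -B(P_m + N_m, P_n + N_n). -/
theorem schwarzCoeff_bracket {n m : ℤ} {D D' : Derivation ℂ A A}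
    (hD : extDer D (fSer φ).1 = -fieldNeg φ n) (hD' : extDer D' (fSer φ).1 = -fieldNeg φ m) :
    D (schwarzCoeff φ m) - D' (schwarzCoeff φ n) = ((n : A) - m) * schwarzCoeff φ (n + m)
      + if n + m = 0 then (n : A) ^ 3 - n else 0 := by
  have key : ∀ (E : Derivation ℂ A A) (k l : ℤ), extDer E (fSer φ).1 = -fieldNeg φ k →
      E (schwarzCoeff φ l) = -thirdForm φ (upow A (1 - l) * fDer φ) (fieldNeg φ k) := by
    intro E k l hE
    rw [schwarzCoeff, ← res_extDer, Derivation.leibniz, extDer_upow, extDer_schwarzian, hE,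
      thirdOrder_neg, thirdForm_mul_fDer, ← res_neg]
    simp
  rw [key D n m hD, key D' m n hD']
  have h := thirdForm_upow φ n m
  have hn := upow_mul_fDer φ n
  have hm := upow_mul_fDer φ m
  have s1 := thirdForm_swap φ (evalF φ (fieldPoly φ n)) (fieldNeg φ m)
  have z1 := thirdForm_evalF φ (fieldPoly φ m) (fieldPoly φ n)
  have z2 := thirdForm_eq_zero φ (fieldNeg_mem φ m) (fieldNeg_mem φ n)
  have z3 := thirdForm_eq_zero φ (fieldNeg_mem φ n) (fieldNeg_mem φ m)
  rw [hn, hm] at h ⊢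
  simp only [thirdForm_add_left, thirdForm_add_right] at h ⊢
  linear_combination -h + s1 + z1 + z3

end Schwarzian

/-! ## Partial derivatives -/

section Partial

variable {ι : Type} [Fintype ι] [DecidableEq ι] {q : ι → ℝ}

theorem partialDeriv_coord (i j : ι) :
    partialDeriv q i (coord q j) = if i = j then 1 else 0 := by
  ext p
  have H : Set.EqOn (extZero (coord q j).val)
      (fun p => Complex.ofRealCLM (ContinuousLinearMap.proj (R := ℝ) (φ := fun _ : ι => ℝ) j p))
      (chamber q) := fun p hp => extZero_apply _ p hp
  rw [partialDeriv_apply, fderiv_congr_chamber H p.2]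
  have h2 := ((Complex.ofRealCLM.comp
    (ContinuousLinearMap.proj (R := ℝ) (φ := fun _ : ι => ℝ) j)).hasFDerivAt (x := p.1)).fderiv
  change (fderiv ℝ (Complex.ofRealCLM.comp
    (ContinuousLinearMap.proj (R := ℝ) (φ := fun _ : ι => ℝ) j)) p.1) _ = _
  rw [h2]
  by_cases h : i = j
  · subst h
    simp only [if_true]
    change ((Pi.single i (1 : ℝ) : ι → ℝ) i : ℂ) = 1
    simp
  · rw [if_neg h]
    change ((Pi.single i (1 : ℝ) : ι → ℝ) j : ℂ) = 0
    simp [Ne.symm h]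

theorem partialDeriv_comm (i j : ι) (ψ : Smooth q) :
    partialDeriv q i (partialDeriv q j ψ) = partialDeriv q j (partialDeriv q i ψ) := by
  ext p
  have key : ∀ i j : ι, partialDeriv q i (partialDeriv q j ψ) p =
      fderiv ℝ (fderiv ℝ (extZero ψ.val)) p.1 (Pi.single i 1) (Pi.single j 1) := by
    intro i j
    have H : Set.EqOn (extZero (partialDeriv q j ψ).val)
        (fun p => fderiv ℝ (extZero ψ.val) p (Pi.single j 1)) (chamber q) :=
      fun p hp => extZero_apply _ p hp
    rw [partialDeriv_apply, fderiv_congr_chamber H p.2]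
    have hd : DifferentiableAt ℝ (fderiv ℝ (extZero ψ.val)) p.1 :=
      (((ψ.contDiffOn.contDiffAt ((isOpen_chamber q).mem_nhds p.2)).fderiv_right
        (m := 1) (by norm_cast))).differentiableAt (by simp)
    have := fderiv_clm_apply hd (differentiableAt_const (c := (Pi.single j 1 : ι → ℝ)))
    rw [this]
    simp
  rw [key, key]
  exact ((ψ.contDiffOn.contDiffAt ((isOpen_chamber q).mem_nhds p.2)).isSymmSndFDerivAt
    (by rw [minSmoothness_of_isRCLikeNormedField]; exact WithTop.coe_le_coe.2 (le_top (a := (2 : ℕ∞))))).eq _ _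

end Partial

/-! ## First order differential operators on `𝓕` -/

section Fields

variable {ι : Type} [Fintype ι] {q : ι → ℝ}

/-- A derivation of `C^∞(S → ℂ)`, applied to the coefficients of a polynomial in
`f_{-2}, f_{-3}, …`. -/
def coeffwiseDer (d : Derivation ℂ (Smooth q) (Smooth q)) :
    Derivation ℂ (FSpace q) (FSpace q) :=
  Derivation.mk' (coeffwise d.toLinearMap) fun x y => by
    ext m : 1
    rw [coeff_coeffwise, MvPolynomial.coeff_mul, smul_eq_mul, smul_eq_mul, mul_comm y,
      MvPolynomial.coeff_add, MvPolynomial.coeff_mul, MvPolynomial.coeff_mul, map_sum,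
      ← Finset.sum_add_distrib]
    refine Finset.sum_congr rfl fun a _ => ?_
    rw [coeff_coeffwise, coeff_coeffwise]
    refine (d.leibniz _ _).trans ?_
    rw [smul_eq_mul, smul_eq_mul, mul_comm (MvPolynomial.coeff a.2 y)]
    rfl

theorem coeffwiseDer_apply (d : Derivation ℂ (Smooth q) (Smooth q)) (η : FSpace q) :
    coeffwiseDer d η = coeffwise d.toLinearMap η := rfl

theorem coeffwise_C (d : Smooth q →ₗ[ℂ] Smooth q) (ψ : Smooth q) :
    coeffwise d (MvPolynomial.C ψ) = MvPolynomial.C (d ψ) := by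
  ext m : 1
  rw [coeff_coeffwise, MvPolynomial.coeff_C, MvPolynomial.coeff_C]
  split_ifs <;> simp

theorem coeffwiseDer_X (d : Derivation ℂ (Smooth q) (Smooth q)) (j : ℕ) :
    coeffwiseDer d (MvPolynomial.X j) = 0 := by
  ext m : 1
  rw [coeffwiseDer_apply, coeff_coeffwise, MvPolynomial.coeff_X, MvPolynomial.coeff_zero]
  split_ifs
  · exact d.map_one_eq_zero
  · exact map_zero d

/-- The vector field `∑_l a_l ∂/∂f_l` as a derivation over `ℂ`. -/
def polyField (a : ℕ → FSpace q) : Derivation ℂ (FSpace q) (FSpace q) :=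
  Derivation.mk' (vectorField a) fun x y => (MvPolynomial.mkDerivation (Smooth q) a).leibniz x y

theorem polyField_apply (a : ℕ → FSpace q) (η : FSpace q) :
    polyField a η = vectorField a η := rfl

theorem polyField_X (a : ℕ → FSpace q) (j : ℕ) : polyField a (MvPolynomial.X j) = a j :=
  MvPolynomial.mkDerivation_X _ _ _

theorem polyField_C (a : ℕ → FSpace q) (ψ : Smooth q) : polyField a (MvPolynomial.C ψ) = 0 :=
  (MvPolynomial.mkDerivation (Smooth q) a).map_algebraMap ψ

theorem fDerivation_ext {D D' : Derivation ℂ (FSpace q) (FSpace q)}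
    (hC : ∀ ψ, D (MvPolynomial.C ψ) = D' (MvPolynomial.C ψ))
    (hX : ∀ j, D (MvPolynomial.X j) = D' (MvPolynomial.X j)) : D = D' := by
  refine Derivation.ext fun η => ?_
  induction η using MvPolynomial.induction_on with
  | C ψ => exact hC ψ
  | add p r hp hr => rw [map_add, map_add, hp, hr]
  | mul_X p j hp => rw [Derivation.leibniz, Derivation.leibniz, hp, hX]

variable [DecidableEq ι]

/-- `∂/∂p_i` as a derivation of `𝓕`. -/
def coordDer (q : ι → ℝ) (i : ι) : Derivation ℂ (FSpace q) (FSpace q) :=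
  coeffwiseDer (partialDeriv q i)

theorem coordDer_C (i : ι) (ψ : Smooth q) :
    coordDer q i (MvPolynomial.C ψ) = MvPolynomial.C (partialDeriv q i ψ) := coeffwise_C _ ψ

theorem coordDer_X (i : ι) (j : ℕ) : coordDer q i (MvPolynomial.X j) = 0 := coeffwiseDer_X _ j

theorem coordDer_var (i j : ι) : coordDer q i (var q j) = if i = j then 1 else 0 := by
  rw [var, coordDer_C, partialDeriv_coord]
  split_ifs <;> simp

/-- The derivation is a vector field: on `C^∞(S → ℂ)` it satisfies the chain rule. -/
def IsField (D : Derivation ℂ (FSpace q) (FSpace q)) : Prop :=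
  ∀ ψ, D (MvPolynomial.C ψ) = ∑ i, D (var q i) * MvPolynomial.C (partialDeriv q i ψ)

/-- The coordinates need not generate C^∞ as an algebra; the chain rule makes the values on them
decisive. -/
theorem IsField.ext {D D' : Derivation ℂ (FSpace q) (FSpace q)} (hD : IsField D)
    (hD' : IsField D') (hvar : ∀ i, D (var q i) = D' (var q i))
    (hX : ∀ j, D (MvPolynomial.X j) = D' (MvPolynomial.X j)) : D = D' :=
  fDerivation_ext (fun ψ => by simp only [hD ψ, hD' ψ, hvar]) hX

/-- The second order terms cancel by the symmetry of second partial derivatives. -/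
theorem IsField.lie {D D' : Derivation ℂ (FSpace q) (FSpace q)} (hD : IsField D)
    (hD' : IsField D') : IsField ⁅D, D'⁆ := by
  intro ψ
  have key : ∀ {D D' : Derivation ℂ (FSpace q) (FSpace q)}, IsField D → IsField D' →
      D (D' (MvPolynomial.C ψ)) =
        ∑ i, D (D' (var q i)) * MvPolynomial.C (partialDeriv q i ψ) +
        ∑ i, ∑ j, D' (var q i) * (D (var q j)
          * MvPolynomial.C (partialDeriv q j (partialDeriv q i ψ))) := by
    intro D D' hD hD'
    rw [hD' ψ, map_sum, ← Finset.sum_add_distrib]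
    refine Finset.sum_congr rfl fun i _ => ?_
    rw [D.leibniz, hD, smul_eq_mul, smul_eq_mul, Finset.mul_sum]
    ring
  have hs : ∑ i, ∑ j, D (var q i) * (D' (var q j)
        * MvPolynomial.C (partialDeriv q j (partialDeriv q i ψ))) =
      ∑ i, ∑ j, D' (var q i) * (D (var q j)
        * MvPolynomial.C (partialDeriv q j (partialDeriv q i ψ))) := by
    rw [Finset.sum_comm]
    refine Finset.sum_congr rfl fun i _ => Finset.sum_congr rfl fun j _ => ?_
    rw [partialDeriv_comm i j]
    ring
  rw [Derivation.commutator_apply, key hD hD', key hD' hD, hs, add_sub_add_right_eq_sub,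
    ← Finset.sum_sub_distrib]
  refine Finset.sum_congr rfl fun i _ => ?_
  rw [Derivation.commutator_apply, sub_mul]

theorem IsField.add {D D' : Derivation ℂ (FSpace q) (FSpace q)} (hD : IsField D)
    (hD' : IsField D') : IsField (D + D') := by
  intro ψ
  simp only [Derivation.add_apply, hD ψ, hD' ψ, add_mul, Finset.sum_add_distrib]

theorem IsField.smul {D : Derivation ℂ (FSpace q) (FSpace q)} (hD : IsField D) (a : FSpace q) :
    IsField (a • D) := by
  intro ψ
  simp only [Derivation.smul_apply, hD ψ, smul_eq_mul, Finset.mul_sum, mul_assoc]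

theorem isField_coordDer (i : ι) : IsField (coordDer q i) := by
  intro ψ
  simp [coordDer_var, coordDer_C]

/-- The vector field with `f_{-2-j} ↦ a j` and `p_i ↦ b i`. -/
def mkField (a : ℕ → FSpace q) (b : ι → FSpace q) : Derivation ℂ (FSpace q) (FSpace q) :=
  polyField a + ∑ i, b i • coordDer q i

theorem mkField_apply (a : ℕ → FSpace q) (b : ι → FSpace q) (η : FSpace q) :
    mkField a b η = vectorField a η + ∑ i, b i * coordDer q i η := by
  rw [mkField, Derivation.add_apply, polyField_apply,
    ← Derivation.coeFnAddMonoidHom_apply (∑ i, b i • coordDer q i), map_sum, Finset.sum_apply]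
  rfl

theorem mkField_X (a : ℕ → FSpace q) (b : ι → FSpace q) (j : ℕ) :
    mkField a b (MvPolynomial.X j) = a j := by
  rw [mkField_apply, ← polyField_apply, polyField_X]
  simp [coordDer_X]

theorem mkField_C (a : ℕ → FSpace q) (b : ι → FSpace q) (ψ : Smooth q) :
    mkField a b (MvPolynomial.C ψ) = ∑ i, b i * MvPolynomial.C (partialDeriv q i ψ) := by
  rw [mkField_apply, ← polyField_apply, polyField_C, zero_add]
  simp only [coordDer_C]

theorem mkField_var (a : ℕ → FSpace q) (b : ι → FSpace q) (i : ι) :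
    mkField a b (var q i) = b i := by
  rw [var, mkField_C]
  simp [partialDeriv_coord, apply_ite]

theorem isField_mkField (a : ℕ → FSpace q) (b : ι → FSpace q) : IsField (mkField a b) := by
  intro ψ
  simp only [mkField_C, mkField_var]

/-! ### The action of a derivation on `f(u)` -/

omit [DecidableEq ι] in
theorem fSer_coeff_succ (j : ℕ) :
    (fSer (fVar q)).1.coeff ((j + 1 : ℕ) : ℤ) = MvPolynomial.X j := by
  have h := fSer_coeff (fVar q) ((j + 2 : ℕ) : ℤ)
  rw [LaurentSeries.coeff_coe_powerSeries, PowerSeries.coeff_mk,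
    show ((j + 2 : ℕ) : ℤ) - 1 = ((j + 1 : ℕ) : ℤ) by push_cast; ring] at h
  exact h

omit [DecidableEq ι] in
theorem fSer_coeff_zero : (fSer (fVar q)).1.coeff 0 = 0 := by
  have h := fSer_coeff (fVar q) ((1 : ℕ) : ℤ)
  rw [LaurentSeries.coeff_coe_powerSeries, PowerSeries.coeff_mk] at h
  simpa [fCoeff] using h

omit [DecidableEq ι] in
-- The coefficients of u and of u^0 in f are the constants 1 and 0, so a derivation changes f only
-- in negative powers, where the coefficients are the free variables.
theorem extDer_fSer_eq {D : Derivation ℂ (FSpace q) (FSpace q)} {G : LaurentSeries (FSpace q)}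
    (hG : G ∈ vanishingBelow (FSpace q) 1)
    (hD : ∀ j : ℕ, D (MvPolynomial.X j) = G.coeff ((j + 1 : ℕ) : ℤ)) :
    extDer D (fSer (fVar q)).1 = G := by
  ext k
  rw [extDer_coeff]
  rcases lt_or_ge k (-1) with h | h
  · rw [fSer_mem _ _ h, hG k (by omega), map_zero]
  · obtain rfl | rfl | h' : k = -1 ∨ k = 0 ∨ 1 ≤ k := by omega
    · rw [fSer_coeff_neg_one, hG (-1) (by norm_num), D.map_one_eq_zero]
    · rw [fSer_coeff_zero, hG 0 (by norm_num), map_zero]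
    · obtain ⟨j, rfl⟩ : ∃ j : ℕ, k = ((j + 1 : ℕ) : ℤ) := ⟨(k - 1).toNat, by push_cast; omega⟩
      rw [fSer_coeff_succ, hD]

omit [DecidableEq ι] in
theorem apply_X_eq_of_extDer {D D' : Derivation ℂ (FSpace q) (FSpace q)}
    (h : extDer D (fSer (fVar q)).1 = extDer D' (fSer (fVar q)).1) (j : ℕ) :
    D (MvPolynomial.X j) = D' (MvPolynomial.X j) := by
  have := congrArg (fun G => HahnSeries.coeff G ((j + 1 : ℕ) : ℤ)) h
  simpa only [extDer_coeff, fSer_coeff_succ] using this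

omit [DecidableEq ι] in
theorem extDer_lie (D D' : Derivation ℂ (FSpace q) (FSpace q)) (h : LaurentSeries (FSpace q)) :
    extDer ⁅D, D'⁆ h = extDer D (extDer D' h) - extDer D' (extDer D h) := by
  ext k
  rw [HahnSeries.coeff_sub]
  simp only [extDer_coeff, Derivation.commutator_apply]

omit [DecidableEq ι] in
theorem extDer_smul (a : FSpace q) (D : Derivation ℂ (FSpace q) (FSpace q))
    (h : LaurentSeries (FSpace q)) : extDer (a • D) h = HahnSeries.C a * extDer D h := by
  ext k
  rw [coeff_C_mul]
  rfl

omit [DecidableEq ι] in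
theorem extDer_add (D D' : Derivation ℂ (FSpace q) (FSpace q))
    (h : LaurentSeries (FSpace q)) : extDer (D + D') h = extDer D h + extDer D' h := rfl

end Fields

/-! ## The Virasoro relations -/

section Virasoro

variable {ι : Type} [Fintype ι] [DecidableEq ι] {q : ι → ℝ}

/-- The first order part of `𝓛_n`. -/
def virField (q : ι → ℝ) (n : ℤ) : Derivation ℂ (FSpace q) (FSpace q) :=
  mkField (fun j => -modeCoeff (fVar q) n (-2 - (j : ℤ)))
    (fun i => pointCoeff (fVar q) n 0 (var q i))

theorem isField_virField (n : ℤ) : IsField (virField q n) := isField_mkField _ _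

/-- The zeroth order part of `𝓛_n`. -/
def virPotential (q : ι → ℝ) (c : ℂ) (δ : ι → ℂ) (n : ℤ) : FSpace q :=
  (c / 12) • schwarzCoeff (fVar q) n + ∑ i, δ i • pointCoeff (fVar q) n 1 (var q i)

theorem virOp_apply (c : ℂ) (δ : ι → ℂ) (n : ℤ) (η : FSpace q) :
    virOp q c δ n η = virField q n η + virPotential q c δ n * η := by
  have hneg : ∀ a : ℕ → FSpace q, vectorField (fun j => -a j) η = -vectorField a η := fun a => by
    rw [vectorField_apply, vectorField_apply, ← Finset.sum_neg_distrib]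
    exact Finset.sum_congr rfl fun j _ => neg_mul _ _
  rw [virField, mkField_apply, hneg, virPotential, virOp]
  simp only [LinearMap.add_apply, LinearMap.sub_apply, LinearMap.smul_apply, LinearMap.sum_apply,
    Module.End.mul_apply, Finset.sum_add_distrib, add_mul, Finset.sum_mul]
  simp only [mulOp, LinearMap.mulLeft_apply, smul_mul_assoc, coordDer, coeffwiseDer_apply]
  abel

theorem extDer_virField (n : ℤ) :
    extDer (virField q n) (fSer (fVar q)).1 = -fieldNeg (fVar q) n := by
  refine extDer_fSer_eq (neg_mem (fieldNeg_mem _ n)) fun j => ?_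
  rw [virField, mkField_X, modeCoeff_eq, HahnSeries.coeff_neg]

/-- The geometric form of V_n on f: reparametrisation of u, corrected by a_n. It replaces the
infinite negative part by closed expressions that can be differentiated again. -/
theorem extDer_virField' (n : ℤ) : extDer (virField q n) (fSer (fVar q)).1 =
    evalF (fVar q) (fieldPoly (fVar q) n) - upow _ (1 - n) * fDer (fVar q) := by
  rw [extDer_virField, upow_mul_fDer]
  ring

theorem virField_var (n : ℤ) (i : ι) :
    virField q n (var q i) = (fieldPoly (fVar q) n).eval (var q i) := by
  rw [virField, mkField_var, pointCoeff_zero]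

theorem extDer_virField_virField (n m : ℤ) :
    extDer (virField q n) (extDer (virField q m) (fSer (fVar q)).1) =
      evalF (fVar q) (polyDer (virField q n) (fieldPoly (fVar q) m))
      + evalF (fVar q) (Polynomial.derivative (fieldPoly (fVar q) m))
        * (evalF (fVar q) (fieldPoly (fVar q) n) - upow _ (1 - n) * fDer (fVar q))
      - upow _ (1 - m) * (evalF (fVar q) (Polynomial.derivative (fieldPoly (fVar q) n))
        * fDer (fVar q) - (((1 - n : ℤ) : LaurentSeries (FSpace q)) * upow _ (-n) * fDer (fVar q)
          + upow _ (1 - n) * duDer _ (fDer (fVar q)))) := by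
  rw [extDer_virField' m, map_sub, extDer_evalF, Derivation.leibniz, extDer_upow, ← duDer_fSer,
    extDer_duDer, extDer_virField' n, map_sub, duDer_evalF, Derivation.leibniz (duDer (FSpace q)),
    duDer_upow, duDer_fSer]
  simp only [smul_eq_mul, mul_zero, add_zero]
  rw [show 1 - n - 1 = -n by ring]
  ring

/-- The polynomials `fieldPoly` satisfy the Witt relations. -/
theorem fieldPoly_bracket (n m : ℤ) :
    polyDer (virField q n) (fieldPoly (fVar q) m) - polyDer (virField q m) (fieldPoly (fVar q) n)
      + Polynomial.derivative (fieldPoly (fVar q) m) * fieldPoly (fVar q) n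
      - Polynomial.derivative (fieldPoly (fVar q) n) * fieldPoly (fVar q) m =
    Polynomial.C ((n : FSpace q) - m) * fieldPoly (fVar q) (n + m) ∧
    extDer ⁅virField q n, virField q m⁆ (fSer (fVar q)).1 =
      HahnSeries.C ((n : FSpace q) - m) * extDer (virField q (n + m)) (fSer (fVar q)).1 := by
  -- First of two descriptions of the same defect: it has only negative powers of u.
  have hmem : extDer ⁅virField q n, virField q m⁆ (fSer (fVar q)).1
      - HahnSeries.C ((n : FSpace q) - m) * extDer (virField q (n + m)) (fSer (fVar q)).1
      ∈ vanishingBelow (FSpace q) 1 := by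
    have hv : ∀ k, extDer (virField q k) (fSer (fVar q)).1 ∈ vanishingBelow (FSpace q) 1 :=
      fun k => by
        rw [extDer_virField]
        exact neg_mem (fieldNeg_mem _ k)
    rw [extDer_lie]
    refine sub_mem (sub_mem (extDer_mem_vanishingBelow _ (hv m))
      (extDer_mem_vanishingBelow _ (hv n))) ?_
    simpa only [zero_add] using mul_mem_vanishingBelow
      (C_mem_vanishingBelow ((n : FSpace q) - m)) (hv (n + m))
  -- Second description: the contributions of u^{1-n} d/du cancel by the Witt relations, and a
  -- polynomial in f(u) is left.
  have heq : extDer ⁅virField q n, virField q m⁆ (fSer (fVar q)).1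
      - HahnSeries.C ((n : FSpace q) - m) * extDer (virField q (n + m)) (fSer (fVar q)).1 =
      evalF (fVar q) (polyDer (virField q n) (fieldPoly (fVar q) m)
        - polyDer (virField q m) (fieldPoly (fVar q) n)
        + Polynomial.derivative (fieldPoly (fVar q) m) * fieldPoly (fVar q) n
        - Polynomial.derivative (fieldPoly (fVar q) n) * fieldPoly (fVar q) m
        - Polynomial.C ((n : FSpace q) - m) * fieldPoly (fVar q) (n + m)) := by
    have e1 : upow (FSpace q) (1 - m) * upow (FSpace q) (-n) = upow (FSpace q) (1 - (n + m)) := by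
      rw [upow_mul_upow]; congr 1; ring
    have e2 : upow (FSpace q) (1 - n) * upow (FSpace q) (-m) = upow (FSpace q) (1 - (n + m)) := by
      rw [upow_mul_upow]; congr 1; ring
    rw [extDer_lie, extDer_virField_virField, extDer_virField_virField, extDer_virField' (n + m)]
    simp only [evalF_add, evalF_sub, evalF_mul, evalF_C]
    simp only [map_sub, map_intCast]
    push_cast
    linear_combination ((1 - n) * fDer (fVar q)) * e1 - ((1 - m) * fDer (fVar q)) * e2
  have h0 := evalF_eq_zero_of_mem (fVar q) (heq ▸ hmem)
  refine ⟨sub_eq_zero.1 h0, sub_eq_zero.1 ?_⟩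
  rw [heq, h0]
  exact Polynomial.eval₂_zero ..

/-- The polynomial identity for the a_n, evaluated at the points, settles the coordinates; its
companion for f settles the variables f_l. -/
theorem virField_bracket (n m : ℤ) :
    ⁅virField q n, virField q m⁆ = ((n : FSpace q) - m) • virField q (n + m) := by
  refine ((isField_virField n).lie (isField_virField m)).ext ((isField_virField (n + m)).smul _)
    (fun i => ?_) (apply_X_eq_of_extDer ?_)
  · have h := congrArg (Polynomial.eval (var q i)) (fieldPoly_bracket (q := q) n m).1
    simp only [Polynomial.eval_add, Polynomial.eval_sub, Polynomial.eval_mul,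
      Polynomial.eval_C] at h
    rw [Derivation.commutator_apply, Derivation.smul_apply, smul_eq_mul, virField_var,
      virField_var, virField_var, apply_eval, apply_eval, virField_var, virField_var]
    linear_combination h
  · rw [extDer_smul, (fieldPoly_bracket n m).2]

/-- This is the derivative of the bracket identity for the a_n; the products a_n' a_m' cancel. -/
theorem pointCoeff_one_bracket (n m : ℤ) (i : ι) :
    virField q n (pointCoeff (fVar q) m 1 (var q i))
      - virField q m (pointCoeff (fVar q) n 1 (var q i)) =
    ((n : FSpace q) - m) * pointCoeff (fVar q) (n + m) 1 (var q i) := by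
  have h := congrArg (fun p => (Polynomial.derivative p).eval (var q i))
    (fieldPoly_bracket (q := q) n m).1
  simp only [Polynomial.derivative_add, Polynomial.derivative_sub, Polynomial.derivative_mul,
    Polynomial.derivative_C, zero_mul, zero_add, Polynomial.eval_add, Polynomial.eval_sub,
    Polynomial.eval_mul, Polynomial.eval_C] at h
  simp only [pointCoeff_one, apply_eval, virField_var, ← derivative_polyDer]
  linear_combination h

theorem virPotential_bracket (c : ℂ) (δ : ι → ℂ) (n m : ℤ) :
    virField q n (virPotential q c δ m) - virField q m (virPotential q c δ n) =
      ((n : FSpace q) - m) * virPotential q c δ (n + m)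
        + algebraMap ℂ (FSpace q) (if n + m = 0 then c / 12 * ((n : ℂ) ^ 3 - n) else 0) := by
  have hS := schwarzCoeff_bracket (fVar q) (extDer_virField (q := q) n)
    (extDer_virField (q := q) m)
  simp only [virPotential, map_add, map_sum, Algebra.smul_def, Derivation.leibniz,
    Derivation.map_algebraMap, mul_zero, add_zero]
  have hP : ∑ i, algebraMap ℂ (FSpace q) (δ i)
        * virField q n (pointCoeff (fVar q) m 1 (var q i))
      - ∑ i, algebraMap ℂ (FSpace q) (δ i)
        * virField q m (pointCoeff (fVar q) n 1 (var q i)) =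
      ((n : FSpace q) - m) * ∑ i, algebraMap ℂ (FSpace q) (δ i)
        * pointCoeff (fVar q) (n + m) 1 (var q i) := by
    rw [← Finset.sum_sub_distrib, Finset.mul_sum]
    refine Finset.sum_congr rfl fun i _ => ?_
    linear_combination algebraMap ℂ (FSpace q) (δ i) * pointCoeff_one_bracket n m i
  have hc : algebraMap ℂ (FSpace q) (if n + m = 0 then c / 12 * ((n : ℂ) ^ 3 - n) else 0) =
      algebraMap ℂ (FSpace q) (c / 12) * if n + m = 0 then (n : FSpace q) ^ 3 - n else 0 := by
    split_ifs
    · simp only [map_mul, map_sub, map_pow, map_intCast]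
    · simp
  rw [hc]
  linear_combination hP + algebraMap ℂ (FSpace q) (c / 12) * hS

/-- For operators V + P with V a derivation and P a multiplication, the commutator is [V_n, V_m]
plus multiplication by V_n P_m - V_m P_n. -/
theorem virOp_bracket (c : ℂ) (δ : ι → ℂ) (n m : ℤ) :
    virOp q c δ n * virOp q c δ m - virOp q c δ m * virOp q c δ n =
      ((n : ℂ) - m) • virOp q c δ (n + m)
        + (if n + m = 0 then c / 12 * ((n : ℂ) ^ 3 - n) else 0) • (1 : Module.End ℂ (FSpace q)) := by
  refine LinearMap.ext fun η => ?_
  rw [LinearMap.sub_apply, LinearMap.add_apply, LinearMap.smul_apply, LinearMap.smul_apply,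
    Module.End.mul_apply, Module.End.mul_apply, Module.End.one_apply]
  simp only [virOp_apply, map_add, Derivation.leibniz, smul_eq_mul]
  have h1 := congrArg (fun D => D η) (virField_bracket (q := q) n m)
  simp only [Derivation.commutator_apply, Derivation.smul_apply, smul_eq_mul] at h1
  have h2 := virPotential_bracket (q := q) c δ n m
  rw [Algebra.smul_def, Algebra.smul_def, map_sub, map_intCast, map_intCast]
  linear_combination h1 + η * h2

end Virasoro

/-! ## Commutation of the generators with the Virasoro operators -/

section Generators

variable {ι : Type} [Fintype ι] [DecidableEq ι] {q : ι → ℝ}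

theorem extDer_coordDer (I : ι) : extDer (coordDer q I) (fSer (fVar q)).1 = 0 :=
  extDer_fSer_eq (zero_mem _) fun j => by rw [coordDer_X, HahnSeries.coeff_zero]

omit [DecidableEq ι] in
theorem extDer_fDer {D : Derivation ℂ (FSpace q) (FSpace q)} :
    extDer D (fDer (fVar q)) = duDer _ (extDer D (fSer (fVar q)).1) := by
  rw [← duDer_fSer, extDer_duDer]

theorem extDer_coordDer_fDer (I : ι) : extDer (coordDer q I) (fDer (fVar q)) = 0 := by
  rw [extDer_fDer, extDer_coordDer, map_zero]

/-- The coefficients of a_n are built from f alone and do not depend on the points. -/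
theorem polyDer_coordDer (I : ι) (n : ℤ) :
    polyDer (coordDer q I) (fieldPoly (fVar q) n) = 0 := by
  ext m : 1
  rw [polyDer_coeff, fieldPoly_coeff, fieldCoeff, ← res_extDer, Derivation.leibniz,
    Derivation.leibniz, Derivation.leibniz_pow, extDer_upow, derivation_fPow, extDer_coordDer_fDer,
    extDer_coordDer]
  simp [res]

theorem polyDer_coordDer_derivative {I : ι} {p : Polynomial (FSpace q)}
    (hp : polyDer (coordDer q I) p = 0) :
    polyDer (coordDer q I) (Polynomial.derivative p) = 0 := by
  rw [← derivative_polyDer, hp, Polynomial.derivative_zero]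

theorem coordDer_eval {I : ι} {p : Polynomial (FSpace q)} (hp : polyDer (coordDer q I) p = 0)
    (i : ι) : coordDer q I (p.eval (var q i)) =
      if I = i then (Polynomial.derivative p).eval (var q i) else 0 := by
  rw [apply_eval, hp, coordDer_var, Polynomial.eval_zero, zero_add, mul_ite, mul_one, mul_zero]

theorem coordDer_schwarzCoeff (I : ι) (n : ℤ) :
    coordDer q I (schwarzCoeff (fVar q) n) = 0 := by
  rw [schwarzCoeff, ← res_extDer, Derivation.leibniz, extDer_upow, extDer_schwarzian,
    extDer_coordDer]
  simp [thirdOrder, res]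

theorem coordDer_virField (I : ι) (n : ℤ) : ⁅coordDer q I, virField q n⁆ =
    (Polynomial.derivative (fieldPoly (fVar q) n)).eval (var q I) • coordDer q I := by
  refine ((isField_coordDer I).lie (isField_virField n)).ext
    ((isField_coordDer I).smul _) (fun i => ?_) (apply_X_eq_of_extDer ?_)
  · rw [Derivation.commutator_apply, virField_var, coordDer_eval (polyDer_coordDer I n),
      coordDer_var, Derivation.smul_apply, coordDer_var]
    split_ifs with h <;> simp [h]
  · rw [extDer_lie, extDer_smul, extDer_coordDer, map_zero, mul_zero, sub_zero, extDer_virField',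
      map_sub, extDer_evalF, polyDer_coordDer, Derivation.leibniz, extDer_upow,
      extDer_coordDer_fDer, extDer_coordDer]
    simp [evalF]

/-- The function `1 / (p_i - p_I)` as an element of `𝓕`. -/
def invVar (hq : Function.Injective q) (i I : ι) : FSpace q := MvPolynomial.C (invDiff q hq i I)

omit [DecidableEq ι] in
theorem sub_mul_invVar (hq : Function.Injective q) {i I : ι} (h : i ≠ I) :
    (var q i - var q I) * invVar hq i I = 1 := by
  rw [var, var, invVar, ← map_sub, ← map_mul, ← map_one MvPolynomial.C]
  congr 1
  ext p
  have h1 : ((p.1 i - p.1 I : ℝ) : ℂ) ≠ 0 :=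
    Complex.ofReal_ne_zero.2 (sub_ne_zero.2 (chamber_ne hq h p.2))
  have h2 : (coord q i - coord q I) p = ((p.1 i - p.1 I : ℝ) : ℂ) := by
    rw [Complex.ofReal_sub]
    rfl
  rw [Smooth.mul_apply, h2]
  exact mul_inv_cancel₀ h1

omit [DecidableEq ι] in
theorem derivation_invVar (hq : Function.Injective q) {i I : ι} (h : i ≠ I)
    (D : Derivation ℂ (FSpace q) (FSpace q)) :
    D (invVar hq i I) = -(invVar hq i I ^ 2 * (D (var q i) - D (var q I))) := by
  have h1 := sub_mul_invVar hq h
  have h2 := congrArg D h1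
  rw [D.leibniz, map_sub, D.map_one_eq_zero] at h2
  simp only [smul_eq_mul] at h2
  linear_combination invVar hq i I * h2 - D (invVar hq i I) * h1

/-- The Loewner vector field with driving point `p_I`. -/
def loewnerField (hq : Function.Injective q) (I : ι) : Derivation ℂ (FSpace q) (FSpace q) :=
  mkField (fun j => 2 * loewnerCoeff (fVar q) (-2 - (j : ℤ)) (var q I))
    (fun i => if i = I then 0 else 2 * invVar hq i I)

theorem isField_loewnerField (hq : Function.Injective q) (I : ι) : IsField (loewnerField hq I) :=
  isField_mkField _ _

theorem loewnerField_var_self (hq : Function.Injective q) (I : ι) :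
    loewnerField hq I (var q I) = 0 := by
  rw [loewnerField, mkField_var, if_pos rfl]

theorem loewnerField_var_of_ne (hq : Function.Injective q) {i I : ι} (h : i ≠ I) :
    loewnerField hq I (var q i) = 2 * invVar hq i I := by
  rw [loewnerField, mkField_var, if_neg h]

theorem extDer_loewnerField (hq : Function.Injective q) (I : ι) :
    extDer (loewnerField hq I) (fSer (fVar q)).1 = 2 * invSer (fVar q) (var q I) := by
  have h2 : (2 : LaurentSeries (FSpace q)) = HahnSeries.C 2 := (map_ofNat HahnSeries.C 2).symm
  rw [h2]
  refine extDer_fSer_eq ?_ fun j => ?_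
  · simpa only [zero_add] using mul_mem_vanishingBelow (C_mem_vanishingBelow (2 : FSpace q))
      (invSer_mem (fVar q) (var q I))
  · rw [loewnerField, mkField_X, coeff_C_mul, loewnerCoeff_eq]

/-- The second order Taylor expansion of a polynomial. -/
theorem exists_taylor_two {B : Type} [CommRing B] (p : Polynomial B) (x : B) :
    ∃ p₁ p₂ : Polynomial B, p = Polynomial.C (p.eval x) + (Polynomial.X - Polynomial.C x) * p₁ ∧
      p₁ = Polynomial.C ((Polynomial.derivative p).eval x)
        + (Polynomial.X - Polynomial.C x) * p₂ := by
  obtain ⟨p₁, h₁⟩ := Polynomial.X_sub_C_dvd_sub_C_eval (p := p) (a := x)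
  obtain ⟨p₂, h₂⟩ := Polynomial.X_sub_C_dvd_sub_C_eval (p := p₁) (a := x)
  have h : (Polynomial.derivative p).eval x = p₁.eval x := by
    have := congrArg (fun r => (Polynomial.derivative r).eval x) h₁
    simpa using this
  refine ⟨p₁, p₂, ?_, ?_⟩
  · rw [← h₁]; ring
  · rw [h, ← h₂]; ring

/-- The terms with u^{1-n} cancel: the Loewner field acts on coefficients and so commutes with d/du.
Only a_n and the pole at the driving point remain. -/
theorem extDer_loewnerField_virField (hq : Function.Injective q) (I : ι) (n : ℤ) :
    extDer ⁅loewnerField hq I, virField q n⁆ (fSer (fVar q)).1 =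
      evalF (fVar q) (polyDer (loewnerField hq I) (fieldPoly (fVar q) n))
      + 2 * evalF (fVar q) (Polynomial.derivative (fieldPoly (fVar q) n))
          * invSer (fVar q) (var q I)
      + 2 * invSer (fVar q) (var q I) ^ 2 * (evalF (fVar q) (fieldPoly (fVar q) n)
          - HahnSeries.C ((fieldPoly (fVar q) n).eval (var q I))) := by
  have h2 : duDer (FSpace q) (2 : LaurentSeries (FSpace q)) = 0 := (duDer _).map_natCast 2
  have h2' : extDer (virField q n) (2 : LaurentSeries (FSpace q)) = 0 :=
    (extDer _).map_natCast 2
  rw [extDer_lie, extDer_virField', extDer_loewnerField, map_sub, extDer_evalF, Derivation.leibniz,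
    Derivation.leibniz, extDer_upow, extDer_fDer, extDer_loewnerField, Derivation.leibniz,
    duDer_invSer, h2, h2', extDer_invSer, extDer_virField', virField_var]
  simp only [smul_eq_mul]
  ring

variable (hq : Function.Injective q) (I : ι) (n : ℤ) {p₁ p₂ : Polynomial (FSpace q)}

/-- The variation of `fieldPoly` under the Loewner vector field, in terms of its Taylor expansion
at the driving point. -/
theorem polyDer_loewnerField
    (h₁ : fieldPoly (fVar q) n = Polynomial.C ((fieldPoly (fVar q) n).eval (var q I))
      + (Polynomial.X - Polynomial.C (var q I)) * p₁)
    (h₂ : p₁ = Polynomial.C ((Polynomial.derivative (fieldPoly (fVar q) n)).eval (var q I))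
      + (Polynomial.X - Polynomial.C (var q I)) * p₂) :
    polyDer (loewnerField hq I) (fieldPoly (fVar q) n) = -(4 * p₂ + 2 * Polynomial.derivative p₁)
    ∧ extDer ⁅loewnerField hq I, virField q n⁆ (fSer (fVar q)).1 =
      4 * HahnSeries.C ((Polynomial.derivative (fieldPoly (fVar q) n)).eval (var q I))
        * invSer (fVar q) (var q I) := by
  have hE := invSer_mul_sub (fVar q) (var q I)
  have k₁ := congrArg (evalF (fVar q)) h₁
  have k₂ := congrArg (evalF (fVar q)) h₂
  have k₃ := congrArg (fun r => evalF (fVar q) (Polynomial.derivative r)) h₁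
  simp only [Polynomial.derivative_add, Polynomial.derivative_C, Polynomial.derivative_mul,
    Polynomial.derivative_sub, Polynomial.derivative_X, sub_zero, zero_add, one_mul, evalF_add,
    evalF_mul, evalF_sub, evalF_C, evalF_X] at k₁ k₂ k₃
  have h2 : ∀ r : Polynomial (FSpace q), evalF (fVar q) (2 * r) = 2 * evalF (fVar q) r :=
    fun r => by rw [evalF_mul, ← Polynomial.C_ofNat, evalF_C, map_ofNat]
  have h4 : ∀ r : Polynomial (FSpace q), evalF (fVar q) (4 * r) = 4 * evalF (fVar q) r :=
    fun r => by rw [evalF_mul, ← Polynomial.C_ofNat, evalF_C, map_ofNat]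
  -- With a = a(x) + (X - x) p₁ and p₁ = a'(x) + (X - x) p₂, the two pole terms add up to 4 p₁/(f -
  -- x) + 2 p₁'(f), whose only pole is 4 a'(x)/(f - x). The rest is a polynomial in f with only
  -- negative powers of u, so it vanishes.
  have heq : extDer ⁅loewnerField hq I, virField q n⁆ (fSer (fVar q)).1
      - 4 * HahnSeries.C ((Polynomial.derivative (fieldPoly (fVar q) n)).eval (var q I))
        * invSer (fVar q) (var q I) =
      evalF (fVar q) (polyDer (loewnerField hq I) (fieldPoly (fVar q) n)
        + 4 * p₂ + 2 * Polynomial.derivative p₁) := by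
    rw [extDer_loewnerField_virField, evalF_add, evalF_add, h2, h4]
    set E := invSer (fVar q) (var q I)
    set X := (fSer (fVar q)).1 - HahnSeries.C (var q I)
    linear_combination 2 * E * k₃ + 2 * E ^ 2 * k₁ + 4 * E * k₂
      + 2 * evalF (fVar q) (Polynomial.derivative p₁) * hE + 2 * E * evalF (fVar q) p₁ * hE
      + 4 * evalF (fVar q) p₂ * hE
  have hmem : extDer ⁅loewnerField hq I, virField q n⁆ (fSer (fVar q)).1
      - 4 * HahnSeries.C ((Polynomial.derivative (fieldPoly (fVar q) n)).eval (var q I))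
        * invSer (fVar q) (var q I) ∈ vanishingBelow (FSpace q) 1 := by
    have hv := fieldNeg_mem (fVar q) n
    have hi := invSer_mem (fVar q) (var q I)
    have hm : ∀ a : FSpace q, ∀ r ∈ vanishingBelow (FSpace q) 1,
        HahnSeries.C a * r ∈ vanishingBelow (FSpace q) 1 := fun a r hr => by
      simpa only [zero_add] using mul_mem_vanishingBelow (C_mem_vanishingBelow a) hr
    rw [extDer_lie, extDer_virField, extDer_loewnerField, ← map_ofNat HahnSeries.C 2,
      ← map_ofNat HahnSeries.C 4, ← map_mul]
    exact sub_mem (sub_mem (extDer_mem_vanishingBelow _ (neg_mem hv))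
      (extDer_mem_vanishingBelow _ (hm _ _ hi))) (hm _ _ hi)
  have h0 := evalF_eq_zero_of_mem (fVar q) (heq ▸ hmem)
  refine ⟨by linear_combination h0, sub_eq_zero.1 ?_⟩
  rw [heq, h0]
  exact Polynomial.eval₂_zero ..

/-- `a''(x) = 2 p₂(x)` and `a'''(x) = 6 p₂'(x)` for `p₂` as in the second order Taylor expansion. -/
theorem eval_derivative_of_taylor {B : Type} [CommRing B] {p p₁ p₂ : Polynomial B} {x y b : B}
    (h₁ : p = Polynomial.C y + (Polynomial.X - Polynomial.C x) * p₁)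
    (h₂ : p₁ = Polynomial.C b + (Polynomial.X - Polynomial.C x) * p₂) :
    (Polynomial.derivative p₁).eval x = p₂.eval x ∧
    (Polynomial.derivative (Polynomial.derivative p₁)).eval x =
      2 * (Polynomial.derivative p₂).eval x ∧
    (Polynomial.derivative (Polynomial.derivative p)).eval x = 2 * p₂.eval x ∧
    (Polynomial.derivative (Polynomial.derivative (Polynomial.derivative p))).eval x =
      6 * (Polynomial.derivative p₂).eval x := by
  subst h₂
  subst h₁
  simp only [Polynomial.derivative_add, Polynomial.derivative_C, Polynomial.derivative_mul,
    Polynomial.derivative_sub, Polynomial.derivative_X, sub_zero, zero_add, one_mul,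
    Polynomial.eval_add, Polynomial.eval_mul, Polynomial.eval_sub, Polynomial.eval_X,
    Polynomial.eval_C, sub_self, zero_mul, add_zero]
  refine ⟨trivial, ?_, ?_, ?_⟩ <;> ring

/-- On f this is the Taylor computation above. On a point other than the driving point the same
algebra holds with 1/(p_i - p_I) for 1/(f - x_I). The driving point is fixed by the Loewner field,
so there only the variation of a_n counts: -(4 p₂ + 2 p₁')(x_I) = -3 a_n''(x_I), which is the source
of the ∂_I term. -/
theorem loewnerField_virField : ⁅loewnerField hq I, virField q n⁆ =
    (2 * (Polynomial.derivative (fieldPoly (fVar q) n)).eval (var q I)) • loewnerField hq I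
    + (-3 * (Polynomial.derivative (Polynomial.derivative (fieldPoly (fVar q) n))).eval (var q I))
      • coordDer q I := by
  obtain ⟨p₁, p₂, h₁, h₂⟩ := exists_taylor_two (fieldPoly (fVar q) n) (var q I)
  obtain ⟨hU, hf⟩ := polyDer_loewnerField hq I n h₁ h₂
  obtain ⟨d₁, -, d₃, -⟩ := eval_derivative_of_taylor h₁ h₂
  refine ((isField_loewnerField hq I).lie (isField_virField n)).ext
    (((isField_loewnerField hq I).smul _).add ((isField_coordDer I).smul _)) (fun i => ?_)
    (apply_X_eq_of_extDer ?_)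
  · rw [Derivation.commutator_apply, virField_var, apply_eval, hU, Derivation.add_apply,
      Derivation.smul_apply, Derivation.smul_apply, coordDer_var]
    by_cases h : i = I
    · subst h
      have h2 : (2 : Polynomial (FSpace q)).eval (var q i) = 2 := Polynomial.eval_ofNat ..
      have h4 : (4 : Polynomial (FSpace q)).eval (var q i) = 4 := Polynomial.eval_ofNat ..
      rw [loewnerField_var_self, if_pos rfl, map_zero]
      simp only [Polynomial.eval_neg, Polynomial.eval_add, Polynomial.eval_mul, h2, h4, smul_eq_mul]
      linear_combination -2 * d₁ + 3 * d₃
    · have k₁ := congrArg (Polynomial.eval (var q i)) h₁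
      have k₂ := congrArg (Polynomial.eval (var q i)) h₂
      have k₃ := congrArg (fun r => Polynomial.eval (var q i) (Polynomial.derivative r)) h₁
      have ht := sub_mul_invVar hq h
      have h2 : (2 : Polynomial (FSpace q)).eval (var q i) = 2 := Polynomial.eval_ofNat ..
      have h4 : (4 : Polynomial (FSpace q)).eval (var q i) = 4 := Polynomial.eval_ofNat ..
      have hV2 : virField q n (2 : FSpace q) = 0 := (virField q n).map_natCast 2
      rw [loewnerField_var_of_ne hq h, if_neg (Ne.symm h), Derivation.leibniz, hV2,
        derivation_invVar hq h, virField_var, virField_var]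
      simp only [Polynomial.derivative_add, Polynomial.derivative_C, Polynomial.derivative_mul,
        Polynomial.derivative_sub, Polynomial.derivative_X, sub_zero, zero_add, one_mul,
        Polynomial.eval_add, Polynomial.eval_mul, Polynomial.eval_sub, Polynomial.eval_X,
        Polynomial.eval_C, Polynomial.eval_neg, h2, h4, smul_eq_mul] at k₁ k₂ k₃ ⊢
      set t := invVar hq i I
      linear_combination 2 * t * k₃ + 2 * t ^ 2 * k₁ + 4 * t * k₂
        + 2 * (Polynomial.derivative p₁).eval (var q i) * ht + 2 * t * p₁.eval (var q i) * ht
        + 4 * p₂.eval (var q i) * ht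
  · rw [extDer_add, extDer_smul, extDer_smul, hf, extDer_coordDer, extDer_loewnerField, map_mul,
      map_ofNat]
    ring

end Generators

/-! ### Potentials and the commutator of a generator with the Virasoro operators. -/

section GeneratorCommutator

variable {ι : Type} [Fintype ι] [DecidableEq ι] {q : ι → ℝ}

/-- In the variable w = f(u) this is the third derivative of 1/(w - x). -/
theorem thirdOrder_invSer {A : Type} [CommRing A] [Algebra ℂ A] (φ : ℕ → A) (x : A) :
    thirdOrder φ (invSer φ x) = -6 * (fDer φ ^ 2 * invSer φ x ^ 4) := by
  have h := fDer_mul_fDerInv φ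
  simp only [thirdOrder, duDer_invSer, map_neg, Derivation.leibniz, Derivation.leibniz_pow,
    smul_eq_mul, nsmul_eq_mul, map_add]
  set r := fDerInv φ
  set f₁ := fDer φ with hf₁
  set f₂ := duDer A f₁
  set f₃ := duDer A f₂
  set E := invSer φ x
  have h2 : duDer A ((2 : ℕ) : LaurentSeries A) = 0 := (duDer A).map_natCast 2
  rw [h2]
  push_cast
  linear_combination (-6 * E ^ 4 * f₁ ^ 2 - 6 * E ^ 3 * f₂ * f₁ * r + r * E ^ 2 * f₃
    - 3 * r ^ 2 * f₂ ^ 2 * E ^ 2) * h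

theorem eval_fieldPoly {A : Type} [CommRing A] [Algebra ℂ A] (φ : ℕ → A) (n : ℤ) (x : A) :
    (fieldPoly φ n).eval x = res (upow A (1 - n) * (fDer φ ^ 2 * invSer φ x ^ 1)) := by
  rw [← pointCoeff_zero, pow_one]
  rfl

theorem coordDer_res_invSer_pow (I : ι) (n : ℤ) (k : ℕ) :
    coordDer q I (res (upow _ (1 - n) * (fDer (fVar q) ^ 2
      * invSer (fVar q) (var q I) ^ (k + 1)))) =
    ((k + 1 : ℕ) : FSpace q) * res (upow _ (1 - n) * (fDer (fVar q) ^ 2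
      * invSer (fVar q) (var q I) ^ (k + 2))) := by
  rw [← res_C_mul, ← res_extDer, Derivation.leibniz, Derivation.leibniz, Derivation.leibniz_pow,
    Derivation.leibniz_pow, extDer_upow, extDer_coordDer_fDer, extDer_invSer, extDer_coordDer,
    coordDer_var, if_pos rfl, map_one, map_natCast]
  congr 1
  simp only [smul_eq_mul, nsmul_eq_mul, Nat.add_sub_cancel]
  ring

/-- Since a_n is independent of the points, ∂_I differentiates a_n(x_I) as a polynomial. In the
residue formula for a_n(x_I), each ∂_I raises the order of the pole by one, and three of them
contribute 1·2·3. -/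
theorem eval_derivative_three (I : ι) (n : ℤ) :
    (Polynomial.derivative (Polynomial.derivative (Polynomial.derivative
      (fieldPoly (fVar q) n)))).eval (var q I) =
    6 * res (upow _ (1 - n) * (fDer (fVar q) ^ 2 * invSer (fVar q) (var q I) ^ 4)) := by
  have h0 := polyDer_coordDer (q := q) I n
  have h1 := polyDer_coordDer_derivative h0
  have h2 := polyDer_coordDer_derivative h1
  have e0 := coordDer_eval h0 I
  have e1 := coordDer_eval h1 I
  have e2 := coordDer_eval h2 I
  rw [if_pos rfl] at e0 e1 e2
  rw [← e2, ← e1, ← e0, eval_fieldPoly, coordDer_res_invSer_pow I n 0, Derivation.leibniz,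
    coordDer_res_invSer_pow I n 1, Derivation.map_natCast, Derivation.map_add, smul_zero,
    map_zero, add_zero, smul_eq_mul, Derivation.leibniz, Derivation.leibniz,
    coordDer_res_invSer_pow I n 2, Derivation.map_natCast, Derivation.map_natCast]
  simp only [smul_eq_mul]
  push_cast
  ring

variable (hq : Function.Injective q) (I : ι) (n : ℤ) (c k : ℂ) (δ : ι → ℂ)

/-- The variation 2/(f - x_I) of f changes Sf by -12 f'²/(f - x_I)^4, whose mode is -12/6 times
a_n'''(x_I). -/
theorem loewnerField_schwarzCoeff : loewnerField hq I (schwarzCoeff (fVar q) n) =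
    -2 * (Polynomial.derivative (Polynomial.derivative (Polynomial.derivative
      (fieldPoly (fVar q) n)))).eval (var q I) := by
  rw [eval_derivative_three, schwarzCoeff, ← res_extDer, Derivation.leibniz, extDer_upow,
    extDer_schwarzian, extDer_loewnerField, ← map_ofNat HahnSeries.C 2, thirdOrder_C_mul,
    thirdOrder_invSer, smul_zero, add_zero, smul_eq_mul,
    show upow (FSpace q) (1 - n) * (HahnSeries.C 2 * (-6 * (fDer (fVar q) ^ 2
      * invSer (fVar q) (var q I) ^ 4))) = HahnSeries.C (-12) * (upow (FSpace q) (1 - n) *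
        (fDer (fVar q) ^ 2 * invSer (fVar q) (var q I) ^ 4)) by
      simp only [map_neg, map_ofNat]; ring, res_C_mul]
  ring

theorem coordDer_algebraMap_mul (z : ℂ) (η : FSpace q) :
    coordDer q I (algebraMap ℂ (FSpace q) z * η) = algebraMap ℂ (FSpace q) z * coordDer q I η := by
  rw [Derivation.leibniz, Derivation.map_algebraMap, smul_zero, add_zero, smul_eq_mul]

theorem coordDer_virPotential : coordDer q I (virPotential q c δ n) =
    algebraMap ℂ (FSpace q) (δ I) * (Polynomial.derivative (Polynomial.derivative
      (fieldPoly (fVar q) n))).eval (var q I) := by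
  have h1 := polyDer_coordDer_derivative (polyDer_coordDer (q := q) I n)
  simp only [virPotential, map_add, map_sum, Algebra.smul_def, coordDer_algebraMap_mul,
    coordDer_schwarzCoeff, pointCoeff_one, coordDer_eval h1, mul_ite, mul_zero, zero_add,
    Finset.sum_ite_eq, Finset.mem_univ, if_true]

/-- The zeroth order part of the generator, up to sign. -/
def genPotential : FSpace q :=
  ∑ i, if i = I then 0 else algebraMap ℂ (FSpace q) (2 * δ i) * invVar hq i I ^ 2

/-- The Schwarzian contributes -(c/6) a_n'''(x_I), and the driving point contributes -8 δ_I p₂'(x_I)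
= -(8/6) δ_I a_n'''(x_I). For each other point, Taylor expansion at x_I leaves exactly its share of
the last term. -/
theorem loewnerField_virPotential :
    loewnerField hq I (virPotential q c δ n) + virField q n (genPotential hq I δ) =
    -(algebraMap ℂ (FSpace q) ((c + 8 * δ I) / 6) * (Polynomial.derivative (Polynomial.derivative
      (Polynomial.derivative (fieldPoly (fVar q) n)))).eval (var q I))
    - 2 * (Polynomial.derivative (fieldPoly (fVar q) n)).eval (var q I)
      * genPotential hq I δ := by
  obtain ⟨p₁, p₂, h₁, h₂⟩ := exists_taylor_two (fieldPoly (fVar q) n) (var q I)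
  obtain ⟨hU, -⟩ := polyDer_loewnerField hq I n h₁ h₂
  obtain ⟨-, d₂, -, d₄⟩ := eval_derivative_of_taylor h₁ h₂
  have hU' := congrArg Polynomial.derivative hU
  simp only [Polynomial.derivative_neg, Polynomial.derivative_add, Polynomial.derivative_mul,
    Polynomial.derivative_ofNat, zero_mul, zero_add] at hU'
  have h2 : ∀ i, (2 : Polynomial (FSpace q)).eval (var q i) = 2 := fun i =>
    Polynomial.eval_ofNat ..
  have h4 : ∀ i, (4 : Polynomial (FSpace q)).eval (var q i) = 4 := fun i =>
    Polynomial.eval_ofNat ..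
  have hterm : ∀ i, algebraMap ℂ (FSpace q) (δ i)
        * loewnerField hq I (pointCoeff (fVar q) n 1 (var q i))
      + virField q n (if i = I then 0 else
          algebraMap ℂ (FSpace q) (2 * δ i) * invVar hq i I ^ 2) =
      (if i = I then -(algebraMap ℂ (FSpace q) (δ i) * (8 * (Polynomial.derivative p₂).eval
        (var q I))) else 0)
      - 2 * (Polynomial.derivative (fieldPoly (fVar q) n)).eval (var q I) *
        (if i = I then 0 else algebraMap ℂ (FSpace q) (2 * δ i) * invVar hq i I ^ 2) := by
    intro i
    rw [pointCoeff_one, apply_eval, ← derivative_polyDer, hU']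
    by_cases h : i = I
    · subst h
      simp only [if_true, loewnerField_var_self, map_zero, Polynomial.eval_neg,
        Polynomial.eval_add, Polynomial.eval_mul, h2, h4]
      linear_combination -2 * algebraMap ℂ (FSpace q) (δ i) * d₂
    · have k₁ := congrArg (Polynomial.eval (var q i)) h₁
      have k₂ := congrArg (Polynomial.eval (var q i)) h₂
      have k₃ := congrArg (fun r => Polynomial.eval (var q i) (Polynomial.derivative r)) h₂
      have k₄ := congrArg (fun r => Polynomial.eval (var q i) (Polynomial.derivative
        (Polynomial.derivative r))) h₁
      have ht := sub_mul_invVar hq h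
      simp only [if_neg h]
      rw [loewnerField_var_of_ne hq h, Derivation.leibniz, Derivation.map_algebraMap,
        Derivation.leibniz_pow, derivation_invVar hq h, virField_var, virField_var]
      simp only [Polynomial.derivative_add, Polynomial.derivative_C, Polynomial.derivative_mul,
        Polynomial.derivative_sub, Polynomial.derivative_X, sub_zero, zero_add, one_mul,
        Polynomial.eval_add, Polynomial.eval_mul, Polynomial.eval_sub, Polynomial.eval_X,
        Polynomial.eval_C, Polynomial.eval_neg, h2, h4, smul_eq_mul, nsmul_eq_mul, map_mul,
        map_ofNat] at k₁ k₂ k₃ k₄ ⊢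
      push_cast
      set t := invVar hq i I
      set z := algebraMap ℂ (FSpace q) (δ i)
      set s := var q i - var q I
      linear_combination z * (2 * t * k₄ - 4 * t ^ 3 * k₁ + 4 * t * k₃ - 4 * t ^ 2 * k₂
        + (2 * (Polynomial.derivative (Polynomial.derivative p₁)).eval (var q i)
          - 4 * t ^ 2 * p₁.eval (var q i) + 4 * (Polynomial.derivative p₂).eval (var q i)
          - 4 * t * p₂.eval (var q i)) * ht)
  simp only [virPotential, map_add, map_sum, Algebra.smul_def]
  have hz : ∀ (z : ℂ) (η : FSpace q), loewnerField hq I (algebraMap ℂ (FSpace q) z * η) =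
      algebraMap ℂ (FSpace q) z * loewnerField hq I η := fun z η => by
    rw [Derivation.leibniz, Derivation.map_algebraMap, smul_zero, add_zero, smul_eq_mul]
  simp only [hz]
  have hsum := Finset.sum_congr rfl fun i (_ : i ∈ Finset.univ) => hterm i
  rw [Finset.sum_add_distrib, Finset.sum_sub_distrib, ← Finset.mul_sum, Finset.sum_ite_eq',
    if_pos (Finset.mem_univ I), ← map_sum] at hsum
  rw [add_assoc, genPotential, hsum, loewnerField_schwarzCoeff, d₄]
  have e1 : algebraMap ℂ (FSpace q) (c / 12) * 12 = algebraMap ℂ (FSpace q) c := by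
    rw [← map_ofNat (algebraMap ℂ (FSpace q)) 12, ← map_mul]
    congr 1
    ring
  have e2 : algebraMap ℂ (FSpace q) ((c + 8 * δ I) / 6) * 6 =
      algebraMap ℂ (FSpace q) c + 8 * algebraMap ℂ (FSpace q) (δ I) := by
    rw [← map_ofNat (algebraMap ℂ (FSpace q)) 6, ← map_ofNat (algebraMap ℂ (FSpace q)) 8,
      ← map_mul, ← map_mul, ← map_add]
    congr 1
    ring
  linear_combination (-(Polynomial.derivative p₂).eval (var q I)) * e1
    + (Polynomial.derivative p₂).eval (var q I) * e2

/-- The generator `k ∂_I² + U_I - ∑_{i ≠ I} 2 δ_i / (p_i - p_I)²`. -/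
def generator : Module.End ℂ (FSpace q) :=
  k • ((coordDer q I).toLinearMap * (coordDer q I).toLinearMap)
    + (loewnerField hq I).toLinearMap - mulOp (genPotential hq I δ)

theorem generator_apply (η : FSpace q) : generator hq I k δ η =
    algebraMap ℂ (FSpace q) k * coordDer q I (coordDer q I η) + loewnerField hq I η
      - genPotential hq I δ * η := by
  rw [← Algebra.smul_def]
  rfl

/-- Beyond the multiple of the generator, the first order terms are (k + 2kδ_I - 3) a_n''(x_I) ∂_I,
from ∂_I² on V_n, from ∂_I² on the potential, and from the Loewner bracket. The zeroth order terms
are (kδ_I - (c + 8δ_I)/6) a_n'''(x_I). The two hypotheses say that both coefficients vanish. -/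
theorem generator_virOp (h₁ : k + 2 * k * δ I = 3) (h₂ : 6 * k * δ I - 8 * δ I = c)
    (η : FSpace q) :
    generator hq I k δ (virOp q c δ n η) - virOp q c δ n (generator hq I k δ η) =
      2 * (Polynomial.derivative (fieldPoly (fVar q) n)).eval (var q I)
        * generator hq I k δ η := by
  have hV : ∀ θ, coordDer q I (virField q n θ) = virField q n (coordDer q I θ)
      + (Polynomial.derivative (fieldPoly (fVar q) n)).eval (var q I) * coordDer q I θ :=
    fun θ => by
      have := congrArg (fun D => D θ) (coordDer_virField (q := q) I n)
      simp only [Derivation.commutator_apply, Derivation.smul_apply, smul_eq_mul] at this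
      linear_combination this
  have hU := congrArg (fun D => D η) (loewnerField_virField hq I n)
  simp only [Derivation.commutator_apply, Derivation.add_apply, Derivation.smul_apply,
    smul_eq_mul] at hU
  have ha := coordDer_eval (polyDer_coordDer_derivative (polyDer_coordDer (q := q) I n)) I
  have hb := coordDer_eval (polyDer_coordDer_derivative (polyDer_coordDer_derivative
    (polyDer_coordDer (q := q) I n))) I
  rw [if_pos rfl] at ha hb
  have hg := loewnerField_virPotential hq I n c δ
  have hk1 : algebraMap ℂ (FSpace q) k
      + 2 * algebraMap ℂ (FSpace q) k * algebraMap ℂ (FSpace q) (δ I) = 3 := by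
    have := congrArg (algebraMap ℂ (FSpace q)) h₁
    simpa only [map_add, map_mul, map_ofNat] using this
  have hk2 : algebraMap ℂ (FSpace q) ((c + 8 * δ I) / 6) =
      algebraMap ℂ (FSpace q) k * algebraMap ℂ (FSpace q) (δ I) := by
    rw [← map_mul]
    congr 1
    linear_combination -h₂ / 6
  rw [hk2] at hg
  simp only [generator_apply, virOp_apply, map_add, map_sub, Derivation.leibniz, smul_eq_mul, hV,
    ha, hb, coordDer_virPotential, Derivation.map_algebraMap, mul_zero, add_zero]
  linear_combination hU + η * hg + (Polynomial.derivative (Polynomial.derivative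
    (fieldPoly (fVar q) n))).eval (var q I) * coordDer q I η * hk1

end GeneratorCommutator

/-! ## Representations of the Virasoro algebra -/

section Representations

variable {W : Type} [AddCommGroup W] [Module ℂ W]

/-- The operators satisfy the Virasoro relations with central charge `c`. -/
def VirRelations (T : ℤ → Module.End ℂ W) (c : ℂ) : Prop :=
  ∀ n m : ℤ, T n * T m - T m * T n = ((n : ℂ) - m) • T (n + m)
    + (if n + m = 0 then c / 12 * ((n : ℂ) ^ 3 - n) else 0) • (1 : Module.End ℂ W)

theorem VirRelations.linearCombination {T : ℤ → Module.End ℂ W} {c : ℂ} (hT : VirRelations T c)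
    (a b : ℤ →₀ ℂ) : Finsupp.linearCombination ℂ T a * Finsupp.linearCombination ℂ T b
      - Finsupp.linearCombination ℂ T b * Finsupp.linearCombination ℂ T a =
    Finsupp.linearCombination ℂ T (wittBracket a b)
      + virCocycle a b • c • (1 : Module.End ℂ W) := by
  induction a using Finsupp.induction_linear with
  | zero => simp
  | add a a' h h' =>
    simp only [map_add, LinearMap.add_apply, add_mul, mul_add, add_smul]
    rw [add_sub_add_comm, h, h']
    abel
  | single n s =>
    induction b using Finsupp.induction_linear with
    | zero => simp
    | add b b' h h' =>
      simp only [map_add, add_mul, mul_add, add_smul]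
      rw [add_sub_add_comm, h, h']
      abel
    | single m t =>
      rw [wittBracket_single, virCocycle_single]
      simp only [Finsupp.linearCombination_single, smul_mul_smul_comm]
      rw [mul_comm t s, ← smul_sub, hT n m, smul_add, smul_smul, smul_smul, smul_smul]
      congr 2
      split_ifs
      · ring
      · simp

/-- The representation of the Virasoro algebra given by operators that satisfy its relations. -/
def virRep (T : ℤ → Module.End ℂ W) (c : ℂ) (hT : VirRelations T c) :
    Vir →ₗ⁅ℂ⁆ Module.End ℂ W where
  toFun x := Finsupp.linearCombination ℂ T x.1 + x.2 • c • (1 : Module.End ℂ W)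
  map_add' x y := by
    change Finsupp.linearCombination ℂ T (x.1 + y.1) + (x.2 + y.2) • c • (1 : Module.End ℂ W) = _
    rw [map_add, add_smul]
    abel
  map_smul' s x := by
    change Finsupp.linearCombination ℂ T (s • x.1) + (s * x.2) • c • (1 : Module.End ℂ W) = _
    rw [map_smul, RingHom.id_apply, smul_add, smul_smul s]
  map_lie' {x y} := by
    change Finsupp.linearCombination ℂ T (wittBracket x.1 y.1)
      + virCocycle x.1 y.1 • c • (1 : Module.End ℂ W) = _
    rw [← hT.linearCombination, Ring.lie_def]
    simp only [mul_add, add_mul, smul_mul_assoc, mul_smul_comm, one_mul, mul_one, smul_smul,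
      smul_add]
    rw [mul_comm (y.2 * c)]
    abel

theorem virRep_apply (T : ℤ → Module.End ℂ W) (c : ℂ) (hT : VirRelations T c) (x : Vir) :
    virRep T c hT x = Finsupp.linearCombination ℂ T x.1 + x.2 • c • (1 : Module.End ℂ W) := rfl

theorem virRep_L (T : ℤ → Module.End ℂ W) (c : ℂ) (hT : VirRelations T c) (n : ℤ) :
    virRep T c hT (Vir.L n) = T n := by
  change Finsupp.linearCombination ℂ T (Finsupp.single n 1) + (0 : ℂ) • c • 1 = T n
  simp

theorem virRep_C (T : ℤ → Module.End ℂ W) (c : ℂ) (hT : VirRelations T c) :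
    virRep T c hT Vir.C = c • (1 : Module.End ℂ W) := by
  change Finsupp.linearCombination ℂ T 0 + (1 : ℂ) • c • (1 : Module.End ℂ W) = _
  simp

theorem isVirSubmodule_virRep {T : ℤ → Module.End ℂ W} {c : ℂ} (hT : VirRelations T c)
    {U : Submodule ℂ W} (hU : ∀ n, ∀ w ∈ U, T n w ∈ U) : IsVirSubmodule (virRep T c hT) U := by
  intro X w hw
  rw [virRep_apply, LinearMap.add_apply, Finsupp.linearCombination_apply, Finsupp.sum,
    LinearMap.sum_apply]
  exact add_mem (sum_mem fun n _ => U.smul_mem _ (hU n w hw))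
    (U.smul_mem _ (U.smul_mem _ hw))

theorem isVirSubmodule_cyclic (ρ : Vir →ₗ⁅ℂ⁆ Module.End ℂ W) (v : W) :
    IsVirSubmodule ρ (cyclic ρ v) := by
  intro X w hw
  obtain ⟨a, rfl⟩ := (mem_cyclic ρ v w).1 hw
  refine (mem_cyclic ρ v _).2 ⟨UniversalEnvelopingAlgebra.ι ℂ X * a, ?_⟩
  rw [map_mul, UniversalEnvelopingAlgebra.lift_ι_apply, Module.End.mul_apply]

theorem self_mem_cyclic (ρ : Vir →ₗ⁅ℂ⁆ Module.End ℂ W) (v : W) : v ∈ cyclic ρ v :=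
  (mem_cyclic ρ v v).2 ⟨1, by rw [map_one, Module.End.one_apply]⟩

/-- The enveloping algebra is a quotient of the tensor algebra, where stability of U can be checked
by induction from the generators. -/
theorem cyclic_le {ρ : Vir →ₗ⁅ℂ⁆ Module.End ℂ W} {U : Submodule ℂ W} (hU : IsVirSubmodule ρ U)
    {v : W} (hv : v ∈ U) : cyclic ρ v ≤ U := by
  intro w hw
  obtain ⟨a, rfl⟩ := (mem_cyclic ρ v w).1 hw
  have key : ∀ t : TensorAlgebra ℂ Vir, ∀ w ∈ U, UniversalEnvelopingAlgebra.lift ℂ ρ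
      (UniversalEnvelopingAlgebra.mkAlgHom ℂ Vir t) w ∈ U := by
    intro t
    induction t using TensorAlgebra.induction with
    | algebraMap r =>
      intro w hw
      rw [AlgHom.commutes, AlgHom.commutes, Module.algebraMap_end_apply]
      exact U.smul_mem _ hw
    | ι X =>
      intro w hw
      have : UniversalEnvelopingAlgebra.lift ℂ ρ
          (UniversalEnvelopingAlgebra.mkAlgHom ℂ Vir (TensorAlgebra.ι ℂ X)) = ρ X :=
        UniversalEnvelopingAlgebra.lift_ι_apply ℂ ρ X
      rw [this]
      exact hU X w hw
    | mul a b ha hb =>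
      intro w hw
      rw [map_mul, map_mul, Module.End.mul_apply]
      exact ha _ (hb _ hw)
    | add a b ha hb =>
      intro w hw
      rw [map_add, map_add, LinearMap.add_apply]
      exact add_mem (ha w hw) (hb w hw)
  obtain ⟨t, rfl⟩ := Quotient.exists_rep a
  exact key t v hv

/-! ### Ordered monomials -/

/-- The product of the operators with the given indices. -/
def word (T : ℤ → Module.End ℂ W) (l : List ℤ) : Module.End ℂ W := (l.map T).prod

theorem word_cons (T : ℤ → Module.End ℂ W) (n : ℤ) (l : List ℤ) :
    word T (n :: l) = T n * word T l := by simp [word]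

theorem word_append (T : ℤ → Module.End ℂ W) (l l' : List ℤ) :
    word T (l ++ l') = word T l * word T l' := by simp [word]

/-- The span of the vectors `T_{n_1} ⋯ T_{n_r} v` with `r < N`. -/
def shortSpan (T : ℤ → Module.End ℂ W) (v : W) (N : ℕ) : Submodule ℂ W :=
  Submodule.span ℂ {w | ∃ l : List ℤ, l.length < N ∧ word T l v = w}

theorem word_mem_shortSpan (T : ℤ → Module.End ℂ W) (v : W) {N : ℕ} {l : List ℤ}
    (hl : l.length < N) : word T l v ∈ shortSpan T v N := Submodule.subset_span ⟨l, hl, rfl⟩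

theorem shortSpan_mono (T : ℤ → Module.End ℂ W) (v : W) {N M : ℕ} (h : N ≤ M) :
    shortSpan T v N ≤ shortSpan T v M := by
  refine Submodule.span_mono ?_
  rintro w ⟨l, hl, rfl⟩
  exact ⟨l, hl.trans_le h, rfl⟩

theorem apply_mem_shortSpan (T : ℤ → Module.End ℂ W) (v : W) {N : ℕ} (n : ℤ) {w : W}
    (hw : w ∈ shortSpan T v N) : T n w ∈ shortSpan T v (N + 1) := by
  refine Submodule.span_induction ?_ ?_ ?_ ?_ hw
  · rintro _ ⟨l, hl, rfl⟩
    rw [← Module.End.mul_apply, ← word_cons]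
    exact word_mem_shortSpan T v (by simpa using hl)
  · rw [map_zero]
    exact zero_mem _
  · intro x y _ _ hx hy
    rw [map_add]
    exact add_mem hx hy
  · intro a x _ hx
    rw [map_smul]
    exact Submodule.smul_mem _ a hx

/-- An adjacent transposition produces a commutator, that is, words shorter by one or two letters.
This is the spanning half of the Poincaré-Birkhoff-Witt argument. -/
theorem word_sub_mem_of_perm {T : ℤ → Module.End ℂ W} {c : ℂ} (hT : VirRelations T c) (v : W)
    {l l' : List ℤ} (h : l.Perm l') : word T l v - word T l' v ∈ shortSpan T v l.length := by
  induction h with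
  | nil => simp
  | cons n _ ih =>
    rw [word_cons, word_cons, Module.End.mul_apply, Module.End.mul_apply, ← map_sub]
    exact apply_mem_shortSpan T v n ih
  | swap n m l =>
    have : word T (m :: n :: l) v - word T (n :: m :: l) v =
        ((m : ℂ) - n) • word T ((m + n) :: l) v
          + (if m + n = 0 then c / 12 * ((m : ℂ) ^ 3 - m) else 0) • word T l v := by
      have h := congrArg (fun S : Module.End ℂ W => S (word T l v)) (hT m n)
      simpa only [word_cons, Module.End.mul_apply, LinearMap.sub_apply, LinearMap.add_apply,
        LinearMap.smul_apply, Module.End.one_apply] using h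
    rw [this]
    exact add_mem (Submodule.smul_mem _ _ (word_mem_shortSpan T v (by simp)))
      (Submodule.smul_mem _ _ (word_mem_shortSpan T v (by simp)))
  | trans h₁ _ ih₁ ih₂ =>
    rw [← h₁.length_eq] at ih₂
    simpa using add_mem ih₁ ih₂

/-- The weakly increasing list with entries `s, s + 1, …, s + N - 1` and multiplicities `e`. -/
def sortedList (s : ℤ) (N : ℕ) (e : ℤ → ℕ) : List ℤ :=
  (List.range N).flatMap fun i : ℕ => List.replicate (e (s + i)) (s + i)

theorem sortedList_succ (s : ℤ) (N : ℕ) (e : ℤ → ℕ) : sortedList s (N + 1) e =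
    sortedList s N e ++ List.replicate (e (s + N)) (s + N) := by
  simp [sortedList, List.range_succ]

theorem count_sortedList (s : ℤ) (N : ℕ) (e : ℤ → ℕ) (a : ℤ) :
    (sortedList s N e).count a = if s ≤ a ∧ a < s + N then e a else 0 := by
  induction N with
  | zero => rw [if_neg (by push_cast; omega)]; simp [sortedList]
  | succ N ih =>
    rw [sortedList_succ, List.count_append, ih, List.count_replicate]
    by_cases h : s + (N : ℤ) = a
    · subst h
      rw [if_neg (by omega), if_pos (by simp), if_pos (by push_cast; omega), zero_add]
    · rw [if_neg (c := (s + (N : ℤ) == a) = true) (by simpa using h), add_zero]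
      congr 1
      apply propext
      push_cast
      omega

theorem word_sortedList (T : ℤ → Module.End ℂ W) (s : ℤ) (N : ℕ) (e : ℤ → ℕ) :
    word T (sortedList s N e) =
      ((List.range N).map fun i : ℕ => T (s + i) ^ e (s + i)).prod := by
  induction N with
  | zero => simp [sortedList, word]
  | succ N ih =>
    rw [sortedList_succ, word_append, ih, List.range_succ, List.map_append, List.prod_append]
    simp [word]

theorem exists_perm_sortedList (l : List ℤ) (hl : ∀ a ∈ l, a ≤ 1) :
    ∃ m : ℤ, -1 ≤ m ∧ (sortedList (-m) (m + 2).toNat fun a => l.count a).Perm l := by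
  obtain ⟨m, hm, hlm⟩ : ∃ m : ℤ, -1 ≤ m ∧ ∀ a ∈ l, -m ≤ a := by
    clear hl
    induction l with
    -- For the empty word the index range is {1}, with exponent 0.
    | nil => exact ⟨-1, le_rfl, by simp⟩
    | cons b l ih =>
      obtain ⟨m, hm, hlm⟩ := ih
      refine ⟨max m (-b), hm.trans (le_max_left _ _), fun a ha => ?_⟩
      rcases List.mem_cons.1 ha with rfl | ha
      · have := le_max_right m (-a)
        omega
      · have := hlm a ha
        have := le_max_left m (-b)
        omega
  refine ⟨m, hm, List.perm_iff_count.2 fun a => ?_⟩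
  rw [count_sortedList]
  split_ifs with h
  · rfl
  · refine (List.count_eq_zero.2 fun ha => h ⟨hlm a ha, ?_⟩).symm
    have := hl a ha
    omega

/-- Induction on length, working modulo shorter words. If all letters are at most 1 the word can be
sorted; otherwise a letter at least 2 is moved to the right end and kills v. -/
theorem shortSpan_le {T : ℤ → Module.End ℂ W} {c : ℂ} (hT : VirRelations T c) {v : W}
    (hv : ∀ n, 2 ≤ n → T n v = 0) (N : ℕ) : shortSpan T v N ≤ Submodule.span ℂ
      {w | ∃ (m : ℤ) (e : ℤ → ℕ), -1 ≤ m ∧ orderedMonomial T m e v = w} := by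
  induction N with
  | zero =>
    refine Submodule.span_le.2 ?_
    rintro _ ⟨l, hl, -⟩
    omega
  | succ N ih =>
    refine Submodule.span_le.2 ?_
    rintro _ ⟨l, hl, rfl⟩
    have hle := (shortSpan_mono T v (Nat.lt_succ_iff.1 hl)).trans ih
    by_cases h : ∀ a ∈ l, a ≤ 1
    · obtain ⟨m, hm, hp⟩ := exists_perm_sortedList l h
      have h1 := hle (word_sub_mem_of_perm hT v hp.symm)
      refine (Submodule.sub_mem_iff_left _ (Submodule.subset_span ?_)).1 h1
      exact ⟨m, fun a => l.count a, hm, by rw [word_sortedList]; rfl⟩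
    · push Not at h
      obtain ⟨a, ha, ha1⟩ := h
      have hp : l.Perm (l.erase a ++ [a]) :=
        (List.perm_cons_erase ha).trans (List.perm_append_singleton a _).symm
      have h1 := hle (word_sub_mem_of_perm hT v hp)
      have h0 : word T (l.erase a ++ [a]) v = 0 := by
        rw [word_append, Module.End.mul_apply]
        simp [word, hv a (by omega)]
      rwa [h0, sub_zero] at h1

theorem list_prod_apply_mem {U : Submodule ℂ W} {L : List (Module.End ℂ W)}
    (hL : ∀ S ∈ L, ∀ w ∈ U, S w ∈ U) {w : W} (hw : w ∈ U) : L.prod w ∈ U := by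
  induction L with
  | nil => simpa using hw
  | cons S L ih =>
    rw [List.prod_cons, Module.End.mul_apply]
    exact hL S (by simp) _ (ih fun S' hS' => hL S' (by simp [hS']))

theorem pow_apply_mem {U : Submodule ℂ W} {S : Module.End ℂ W} (hS : ∀ w ∈ U, S w ∈ U) (k : ℕ)
    {w : W} (hw : w ∈ U) : (S ^ k) w ∈ U := by
  rw [← List.prod_replicate]
  exact list_prod_apply_mem (fun S' hS' => by rwa [List.eq_of_mem_replicate hS']) hw

/-- A cyclic module whose generator is annihilated by `L_n` for `n ≥ 2` is spanned by the ordered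
monomials in `L_n`, `n ≤ 1`, applied to the generator. -/
theorem cyclic_eq_span {T : ℤ → Module.End ℂ W} {c : ℂ} (hT : VirRelations T c) {v : W}
    (hv : ∀ n, 2 ≤ n → T n v = 0) : cyclic (virRep T c hT) v = Submodule.span ℂ
      {w | ∃ (m : ℤ) (e : ℤ → ℕ), -1 ≤ m ∧ orderedMonomial T m e v = w} := by
  apply le_antisymm
  · have hmono : Monotone (shortSpan T v) := fun _ _ h => shortSpan_mono T v h
    refine (cyclic_le (U := ⨆ N, shortSpan T v N) (isVirSubmodule_virRep hT fun n w hw => ?_)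
      ?_).trans (iSup_le fun N => shortSpan_le hT hv N)
    · obtain ⟨N, hN⟩ := (Submodule.mem_iSup_of_directed _ hmono.directed_le).1 hw
      exact Submodule.mem_iSup_of_mem (N + 1) (apply_mem_shortSpan T v n hN)
    · exact Submodule.mem_iSup_of_mem 1 (word_mem_shortSpan T v (l := []) (by simp))
  · refine Submodule.span_le.2 ?_
    rintro _ ⟨m, e, -, rfl⟩
    refine list_prod_apply_mem (fun S hS w hw => ?_) (self_mem_cyclic _ v)
    obtain ⟨i, -, rfl⟩ := List.mem_map.1 hS
    refine pow_apply_mem (fun w hw => ?_) _ hw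
    have := isVirSubmodule_cyclic (virRep T c hT) v (Vir.L (-m + i)) w hw
    rwa [virRep_L] at this

end Representations

/-! ## The action on functions of the points -/

section Vacuum

variable {A : Type} [CommRing A] [Algebra ℂ A] (φ : ℕ → A)

omit [Algebra ℂ A] in
theorem fDer_sub_one_mem : fDer φ - 1 ∈ vanishingBelow A 2 := by
  intro k hk
  rw [HahnSeries.coeff_sub, HahnSeries.coeff_one]
  rcases lt_trichotomy k 0 with h | h | h
  · rw [fDer_mem φ k h, if_neg h.ne, sub_zero]
  · rw [h, fDer_coeff_zero, if_pos rfl, sub_self]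
  · obtain rfl : k = ((1 : ℕ) : ℤ) := by push_cast; omega
    rw [fDer_eq, LaurentSeries.coeff_coe_powerSeries]
    simp

omit [Algebra ℂ A] in
theorem fSer_sub_upow_mem : (fSer φ).1 - upow A 1 ∈ vanishingBelow A 1 := by
  intro k hk
  have h := fSer_coeff φ (k + 1)
  rw [add_sub_cancel_right] at h
  rw [HahnSeries.coeff_sub, h, upow, HahnSeries.coeff_single]
  rcases lt_trichotomy (k + 1) 0 with h0 | h0 | h0
  · rw [ofPowerSeries_mem_vanishingBelow _ _ h0, if_neg (by omega), sub_zero]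
  · rw [h0, ofPowerSeries_coeff_zero, if_pos (by omega)]
    simp [fCoeff]
  · rw [show k + 1 = ((1 : ℕ) : ℤ) by push_cast; omega, LaurentSeries.coeff_coe_powerSeries,
      if_neg (by omega)]
    simp [fCoeff]

/-- The polynomial part is unique, so it can be identified by a computation modulo negative powers
of u. -/
theorem fieldPoly_eq_of_mem {n : ℤ} {p : Polynomial A}
    (h : upow A (1 - n) * fDer φ - evalF φ p ∈ vanishingBelow A 1) : fieldPoly φ n = p := by
  rw [← sub_eq_zero]
  refine evalF_eq_zero_of_mem φ ?_
  have h2 := sub_mem h (fieldNeg_mem φ n)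
  rw [upow_mul_fDer] at h2
  rw [evalF_sub]
  convert h2 using 1
  ring

theorem fieldPoly_of_two_le {n : ℤ} (hn : 2 ≤ n) : fieldPoly φ n = 0 := by
  refine fieldPoly_eq_of_mem φ ?_
  rw [evalF, Polynomial.eval₂_zero, sub_zero]
  exact vanishingBelow_anti (by omega)
    (mul_mem_vanishingBelow (upow_mem_vanishingBelow (1 - n)) (fDer_mem φ))

omit [Algebra ℂ A] in
theorem upow_zero : upow A 0 = 1 := by simp [upow]

theorem fieldPoly_one : fieldPoly φ 1 = 1 := by
  refine fieldPoly_eq_of_mem φ ?_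
  rw [evalF, Polynomial.eval₂_one, sub_self, upow_zero, one_mul]
  exact vanishingBelow_anti (by norm_num) (fDer_sub_one_mem φ)

/-- Both u f'(u) and f(u) equal u + O(u^{-1}); the missing constant term of f is what excludes a
constant in a_0. -/
theorem fieldPoly_zero : fieldPoly φ 0 = Polynomial.X := by
  refine fieldPoly_eq_of_mem φ ?_
  rw [evalF_X, show upow A (1 - 0) * fDer φ - (fSer φ).1 =
    upow A 1 * (fDer φ - 1) - ((fSer φ).1 - upow A 1) by rw [sub_zero]; ring]
  exact sub_mem (vanishingBelow_anti (by norm_num) (mul_mem_vanishingBelow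
    (upow_mem_vanishingBelow 1) (fDer_sub_one_mem φ))) (fSer_sub_upow_mem φ)

/-- The normalisation of f gives f'' = O(u^{-3}), hence Sf = O(u^{-4}), which leaves no residue
after multiplication by u^{1-n}. -/
theorem schwarzCoeff_of_nonneg {n : ℤ} (hn : 0 ≤ n) : schwarzCoeff φ n = 0 := by
  have h1 : duDer A (fDer φ) ∈ vanishingBelow A 3 := by
    have := duDer_mem_vanishingBelow (fDer_sub_one_mem φ)
    rwa [map_sub, Derivation.map_one_eq_zero, sub_zero] at this
  have h2 := duDer_mem_vanishingBelow h1
  have hr := fDerInv_mem φ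
  have h3 := mul_mem_vanishingBelow h1 hr
  have hS : schwarzian φ ∈ vanishingBelow A 4 := by
    rw [schwarzian_eq, sq]
    exact sub_mem (mul_mem_vanishingBelow h2 hr) (vanishingBelow_anti (by norm_num)
      (mul_mem_vanishingBelow (C_mem_vanishingBelow _) (mul_mem_vanishingBelow h3 h3)))
  exact res_eq_zero (by omega) (mul_mem_vanishingBelow (upow_mem_vanishingBelow (1 - n)) hS)

variable {ι : Type} [Fintype ι] [DecidableEq ι] {q : ι → ℝ} (c : ℂ) (δ : ι → ℂ)

theorem virOp_C {n : ℤ} (hn : 0 ≤ n) (Z : Smooth q) : virOp q c δ n (MvPolynomial.C Z) =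
    ∑ i, (fieldPoly (fVar q) n).eval (var q i) * MvPolynomial.C (partialDeriv q i Z)
      + (∑ i, δ i • (Polynomial.derivative (fieldPoly (fVar q) n)).eval (var q i))
        * MvPolynomial.C Z := by
  rw [virOp_apply, isField_virField n Z, virPotential, schwarzCoeff_of_nonneg _ hn, smul_zero,
    zero_add]
  simp only [virField_var, pointCoeff_one]

theorem virOp_C_of_two_le {n : ℤ} (hn : 2 ≤ n) (Z : Smooth q) :
    virOp q c δ n (MvPolynomial.C Z) = 0 := by
  rw [virOp_C c δ (by omega), fieldPoly_of_two_le _ hn]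
  simp

theorem virOp_one_C (Z : Smooth q) :
    virOp q c δ 1 (MvPolynomial.C Z) = MvPolynomial.C (∑ i, partialDeriv q i Z) := by
  rw [virOp_C c δ zero_le_one, fieldPoly_one]
  simp

theorem virOp_zero_C (Z : Smooth q) : virOp q c δ 0 (MvPolynomial.C Z) =
    MvPolynomial.C (∑ i, coord q i * partialDeriv q i Z) + (∑ i, δ i) • MvPolynomial.C Z := by
  rw [virOp_C c δ le_rfl, fieldPoly_zero, Algebra.smul_def]
  simp [var, Algebra.smul_def]

omit [DecidableEq ι] in
theorem hasFDerivAt_extZero (Z : Smooth q) (p : chamber q) :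
    HasFDerivAt (extZero Z.val) (fderiv ℝ (extZero Z.val) p.1) p.1 :=
  (Z.differentiableAt p.2).hasFDerivAt

theorem sum_smul_partialDeriv (Z : Smooth q) (p : chamber q) (v : ι → ℝ) :
    ∑ i, (v i : ℂ) * partialDeriv q i Z p = fderiv ℝ (extZero Z.val) p.1 v := by
  conv_rhs => rw [pi_eq_sum_univ' v, map_sum]
  refine Finset.sum_congr rfl fun i _ => ?_
  rw [partialDeriv_apply, map_smul, Complex.real_smul]

omit [DecidableEq ι] in
theorem Smooth.sum_apply {σ : Type*} (s : Finset σ) (ψ : σ → Smooth q) (p : chamber q) :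
    (∑ i ∈ s, ψ i) p = ∑ i ∈ s, ψ i p := by
  classical
  induction s using Finset.induction_on with
  | empty => rfl
  | insert a s ha ih => rw [Finset.sum_insert ha, Finset.sum_insert ha, Smooth.add_apply, ih]

theorem sum_partialDeriv_eq_zero {Z : Smooth q}
    (hZ : ∀ (σ : ℝ) (p p' : chamber q), (∀ i, p'.1 i = p.1 i + σ) → Z p' = Z p) :
    ∑ i, partialDeriv q i Z = 0 := by
  ext p
  have h1 := sum_smul_partialDeriv Z p fun _ => 1
  simp only [Complex.ofReal_one, one_mul] at h1
  rw [Smooth.sum_apply, h1]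
  have hγ : HasDerivAt (fun s : ℝ => p.1 + s • (fun _ => 1 : ι → ℝ)) (fun _ => 1) 0 := by
    simpa using ((hasDerivAt_id (0 : ℝ)).smul_const (fun _ => 1 : ι → ℝ)).const_add p.1
  have hF := hasFDerivAt_extZero Z p
  have hF' : HasFDerivAt (extZero Z.val) (fderiv ℝ (extZero Z.val) p.1)
      (p.1 + (0 : ℝ) • (fun _ => 1 : ι → ℝ)) := by simpa using hF
  have h2 := hF'.comp_hasDerivAt (0 : ℝ) hγ
  have h3 : (extZero Z.val ∘ fun s : ℝ => p.1 + s • (fun _ => 1 : ι → ℝ)) = fun _ => Z p := by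
    funext s
    have hp : p.1 + s • (fun _ => 1 : ι → ℝ) ∈ chamber q := fun i j hij => by
      simpa using p.2 i j hij
    rw [Function.comp_apply, extZero_apply _ _ hp]
    exact hZ s p ⟨_, hp⟩ fun i => by simp
  rw [h3] at h2
  exact h2.unique (hasDerivAt_const _ _)

theorem sum_coord_mul_partialDeriv {Z : Smooth q} {Δ : ℝ}
    (hZ : ∀ (s : ℝ) (p p' : chamber q), 0 < s → (∀ i, p'.1 i = s * p.1 i) →
      Z p' = ((s ^ Δ : ℝ) : ℂ) * Z p) :
    ∑ i, coord q i * partialDeriv q i Z = (Δ : ℂ) • Z := by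
  ext p
  have h1 := sum_smul_partialDeriv Z p p.1
  rw [Smooth.sum_apply, Smooth.smul_apply]
  change ∑ i, (p.1 i : ℂ) * partialDeriv q i Z p = _
  rw [h1]
  have hγ : HasDerivAt (fun s : ℝ => s • p.1) p.1 1 := by
    simpa using (hasDerivAt_id (1 : ℝ)).smul_const p.1
  have hF : HasFDerivAt (extZero Z.val) (fderiv ℝ (extZero Z.val) p.1) ((1 : ℝ) • p.1) := by
    simpa using hasFDerivAt_extZero Z p
  have h2 := hF.comp_hasDerivAt (1 : ℝ) hγ
  -- Homogeneity is available only for s > 0, so the two functions of s are compared near s = 1.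
  have h3 : (fun s : ℝ => ((s ^ Δ : ℝ) : ℂ) * Z p) =ᶠ[nhds 1]
      (extZero Z.val ∘ fun s : ℝ => s • p.1) := by
    filter_upwards [lt_mem_nhds (zero_lt_one' ℝ)] with s hs
    have hp : s • p.1 ∈ chamber q := fun i j hij => by
      simpa [hs] using p.2 i j hij
    rw [Function.comp_apply, extZero_apply _ _ hp]
    exact (hZ s p ⟨_, hp⟩ hs fun i => by simp).symm
  have h4 : HasDerivAt (fun s : ℝ => ((s ^ Δ : ℝ) : ℂ) * Z p) ((Δ : ℂ) * Z p) 1 := by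
    have := (Real.hasDerivAt_rpow_const (x := 1) (p := Δ) (Or.inl one_ne_zero)).ofReal_comp
    simpa using this.mul_const (Z p)
  exact (h2.congr_of_eventuallyEq h3).unique h4

end Vacuum

/-! ## The generators of an SLE variant -/

section Coeffwise

variable {ι : Type} [Fintype ι] {q : ι → ℝ}

theorem coeffwise_add (d d' : Smooth q →ₗ[ℂ] Smooth q) :
    coeffwise (d + d') = coeffwise d + coeffwise d' := by
  refine LinearMap.ext fun η => ?_
  ext m : 1
  rw [LinearMap.add_apply, MvPolynomial.coeff_add]
  simp only [coeff_coeffwise, LinearMap.add_apply]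

theorem coeffwise_sub (d d' : Smooth q →ₗ[ℂ] Smooth q) :
    coeffwise (d - d') = coeffwise d - coeffwise d' := by
  refine LinearMap.ext fun η => ?_
  ext m : 1
  rw [LinearMap.sub_apply, MvPolynomial.coeff_sub]
  simp only [coeff_coeffwise, LinearMap.sub_apply]

theorem coeffwise_smul (a : ℂ) (d : Smooth q →ₗ[ℂ] Smooth q) :
    coeffwise (a • d) = a • coeffwise d := by
  refine LinearMap.ext fun η => ?_
  ext m : 1
  rw [LinearMap.smul_apply, MvPolynomial.coeff_smul]
  simp only [coeff_coeffwise, LinearMap.smul_apply]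

theorem coeffwise_sum {σ : Type*} (s : Finset σ) (d : σ → Smooth q →ₗ[ℂ] Smooth q) :
    coeffwise (∑ i ∈ s, d i) = ∑ i ∈ s, coeffwise (d i) := by
  refine LinearMap.ext fun η => ?_
  ext m : 1
  rw [LinearMap.sum_apply, MvPolynomial.coeff_sum]
  simp only [coeff_coeffwise, LinearMap.sum_apply]

theorem coeffwise_mul (d d' : Module.End ℂ (Smooth q)) :
    coeffwise (d * d') = coeffwise d * coeffwise d' := by
  refine LinearMap.ext fun η => ?_
  ext m : 1
  rw [Module.End.mul_apply]
  simp only [coeff_coeffwise, Module.End.mul_apply]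

theorem coeffwise_mulLeft (a : Smooth q) :
    coeffwise (LinearMap.mulLeft ℂ a) = mulOp (MvPolynomial.C a) := by
  refine LinearMap.ext fun η => ?_
  ext m : 1
  rw [coeff_coeffwise, mulOp, LinearMap.mulLeft_apply, LinearMap.mulLeft_apply,
    MvPolynomial.coeff_C_mul]

end Coeffwise

theorem C_smul {ι : Type} [Fintype ι] {q : ι → ℝ} (a : ℂ) (Z : Smooth q) :
    (MvPolynomial.C (a • Z) : FSpace q) = a • MvPolynomial.C Z := by
  ext m : 1
  rw [MvPolynomial.coeff_smul, MvPolynomial.coeff_C, MvPolynomial.coeff_C]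
  split_ifs <;> simp

theorem sum_ite_inl {σ τ B : Type*} [Fintype σ] [Fintype τ] [DecidableEq σ] [DecidableEq τ]
    [AddCommMonoid B] (a : σ) (F : σ ⊕ τ → B) :
    ∑ i, (if i = Sum.inl a then 0 else F i) =
      ∑ i ∈ Finset.univ.erase a, F (Sum.inl i) + ∑ i, F (Sum.inr i) := by
  rw [Fintype.sum_sum_type, ← Finset.sum_erase Finset.univ (a := a) (by simp)]
  congr 1
  exact Finset.sum_congr rfl fun i hi => if_neg fun h => Finset.ne_of_mem_erase hi (Sum.inl.inj h)

namespace Variant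

variable {N M : ℕ} (V : Variant N M)

/-- The conformal weights of all the points. -/
def weight : Fin N ⊕ Fin M → ℂ := Sum.elim (fun I => (V.hx I : ℂ)) (fun K => (V.hy K : ℂ))

theorem κx_pos (I : Fin N) : 0 < V.κx I := by
  rcases V.κx_mem I with h | h
  · exact h ▸ V.κ_pos
  · exact h ▸ div_pos (by norm_num) V.κ_pos

theorem genOp_eq_generator (I : Fin N) : V.genOp I =
    generator V.init_inj (Sum.inl I) ((V.κx I / 2 : ℝ) : ℂ) V.weight := by
  refine LinearMap.ext fun η => ?_
  have hvec : ∀ a : ℕ → V.F, vectorField (fun j => 2 * a j) η = (2 : ℂ) • vectorField a η :=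
    fun a => by
      rw [vectorField_apply, vectorField_apply, Finset.smul_sum]
      refine Finset.sum_congr rfl fun j _ => ?_
      rw [Algebra.smul_def, map_ofNat, mul_assoc]
  -- The potential of the null operator at another curve is that of a passive point of weight
  -- h_{x_J}, so both kinds of points fit one formula.
  have hx : ∀ J, (((V.κx J - 6) / V.κx J : ℝ) : ℂ) = -(2 * (V.hx J : ℂ)) := fun J => by
    have := (V.κx_pos J).ne'
    norm_cast
    rw [hx]
    field_simp
    ring
  have e1 : ∀ J θ, coeffwise (V.dx J) θ = coordDer V.init (Sum.inl J) θ := fun _ _ => rfl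
  have e2 : ∀ K θ, coeffwise (V.dy K) θ = coordDer V.init (Sum.inr K) θ := fun _ _ => rfl
  have e3 : ∀ J, (MvPolynomial.C (V.invXX J I) : V.F) = invVar V.init_inj (Sum.inl J) (Sum.inl I) :=
    fun _ => rfl
  have e4 : ∀ K, (MvPolynomial.C (V.invYX K I) : V.F) = invVar V.init_inj (Sum.inr K) (Sum.inl I) :=
    fun _ => rfl
  have e5 : ∀ J, V.weight (Sum.inl J) = V.hx J := fun _ => rfl
  have e6 : ∀ K, V.weight (Sum.inr K) = V.hy K := fun _ => rfl
  have e7 : ∀ K, ((2 * V.hy K : ℝ) : ℂ) = 2 * (V.hy K : ℂ) := fun K => by push_cast; rfl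
  rw [generator_apply, loewnerField, mkField_apply, hvec, genPotential, sum_ite_inl]
  simp only [ite_mul, zero_mul]
  rw [sum_ite_inl]
  simp only [genOp, nullOp, coeffwise_add, coeffwise_sub, coeffwise_smul, coeffwise_sum,
    coeffwise_mul, coeffwise_mulLeft, LinearMap.add_apply, LinearMap.sub_apply,
    LinearMap.smul_apply, LinearMap.sum_apply, Module.End.mul_apply, mulOp,
    LinearMap.mulLeft_apply, map_pow, hx, e1, e2, e3, e4, e5, e6, e7]
  simp only [Algebra.smul_def, Finset.sum_add_distrib, Finset.sum_sub_distrib, map_neg, map_mul,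
    map_ofNat, neg_mul, Finset.sum_neg_distrib, add_mul, Finset.sum_mul, mul_assoc]
  ring

theorem weight_first_relation (I : Fin N) :
    ((V.κx I / 2 : ℝ) : ℂ) + 2 * ((V.κx I / 2 : ℝ) : ℂ) * V.weight (Sum.inl I) = 3 := by
  have h := (V.κx_pos I).ne'
  change ((V.κx I / 2 : ℝ) : ℂ) + 2 * ((V.κx I / 2 : ℝ) : ℂ) * (V.hx I : ℂ) = 3
  norm_cast
  rw [hx]
  field_simp
  ring

/-- The expression (6 - κ)(3κ - 8)/(2κ) is invariant under κ ↦ 16/κ, so curves of both kinds give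
the same central charge. -/
theorem weight_second_relation (I : Fin N) :
    6 * ((V.κx I / 2 : ℝ) : ℂ) * V.weight (Sum.inl I) - 8 * V.weight (Sum.inl I) = V.c := by
  have h := V.κ_pos.ne'
  change 6 * ((V.κx I / 2 : ℝ) : ℂ) * (V.hx I : ℂ) - 8 * (V.hx I : ℂ) = V.c
  norm_cast
  rw [hx, c]
  rcases V.κx_mem I with h' | h' <;> rw [h'] <;> field_simp <;> ring

end Variant

end SLEVir

end

/-! ### The module structure and the consequences for a partition function Z. -/

theorem corollary4p6 {N M : ℕ} (V : SLEVir.Variant N M) :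
    ∃ ρ : SLEVir.Vir →ₗ⁅ℂ⁆ Module.End ℂ V.F,
      (∀ n : ℤ, ρ (SLEVir.Vir.L n) = V.L n) ∧
      ρ SLEVir.Vir.C = (V.c : ℂ) • (1 : Module.End ℂ V.F) ∧
      SLEVir.IsVirSubmodule ρ (⨅ I, LinearMap.ker (V.genOp I)) ∧
      ∀ Z : V.R, V.IsPositive Z → V.NullField Z →
        SLEVir.IsVirSubmodule ρ (SLEVir.cyclic ρ (V.toF Z)) ∧
        SLEVir.cyclic ρ (V.toF Z) ≤ ⨅ I, LinearMap.ker (V.genOp I) ∧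
        (∀ n : ℤ, 2 ≤ n → V.L n (V.toF Z) = 0) ∧
        SLEVir.cyclic ρ (V.toF Z) = Submodule.span ℂ
          {w | ∃ (m : ℤ) (e : ℤ → ℕ), -1 ≤ m ∧ SLEVir.orderedMonomial V.L m e (V.toF Z) = w} ∧
        (V.TranslationInvariant Z → V.L 1 (V.toF Z) = 0) ∧
        (∀ Δ : ℝ, V.Homogeneous Z Δ →
          V.L 0 (V.toF Z) = ((Δ + ∑ I, V.hx I + ∑ K, V.hy K : ℝ) : ℂ) • V.toF Z) ∧
        (∀ Δ : ℝ, V.TranslationInvariant Z → V.Homogeneous Z Δ →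
          SLEVir.IsHighestWeightModule ρ (SLEVir.cyclic ρ (V.toF Z)) (V.toF Z)
            (V.c : ℂ) ((Δ + ∑ I, V.hx I + ∑ K, V.hy K : ℝ) : ℂ)) := by
  have hT : SLEVir.VirRelations V.L (V.c : ℂ) := fun n m => SLEVir.virOp_bracket _ _ n m
  have hker : SLEVir.IsVirSubmodule (SLEVir.virRep V.L V.c hT)
      (⨅ I, LinearMap.ker (V.genOp I)) := by
    refine SLEVir.isVirSubmodule_virRep hT fun n w hw => ?_
    simp only [Submodule.mem_iInf, LinearMap.mem_ker] at hw ⊢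
    intro I
    have h := SLEVir.generator_virOp V.init_inj (Sum.inl I) n (V.c : ℂ) _ V.weight
      (V.weight_first_relation I) (V.weight_second_relation I) w
    -- For w in the kernel, both the term 𝓛_n 𝓐_I w and the right side 2 a_n'(x_I) 𝓐_I w vanish.
    rw [← V.genOp_eq_generator I, hw I, map_zero, mul_zero, sub_zero] at h
    exact h
  refine ⟨SLEVir.virRep V.L V.c hT, SLEVir.virRep_L _ _ _, SLEVir.virRep_C _ _ _, hker,
    fun Z hpos hnull => ?_⟩
  have hZ : V.toF Z ∈ ⨅ I, LinearMap.ker (V.genOp I) := by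
    simp only [Submodule.mem_iInf, LinearMap.mem_ker]
    intro I
    rw [SLEVir.Variant.genOp, LinearMap.add_apply, LinearMap.smul_apply, SLEVir.Variant.toF,
      SLEVir.coeffwise_C, hnull I, ← SLEVir.polyField_apply, SLEVir.polyField_C, smul_zero,
      add_zero, map_zero]
  have h2 : ∀ n : ℤ, 2 ≤ n → V.L n (V.toF Z) = 0 := fun n hn =>
    SLEVir.virOp_C_of_two_le _ _ hn Z
  have h1 : V.TranslationInvariant Z → V.L 1 (V.toF Z) = 0 := fun h => by
    refine (SLEVir.virOp_one_C _ _ Z).trans ?_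
    rw [SLEVir.sum_partialDeriv_eq_zero h, map_zero]
  have h0 : ∀ Δ : ℝ, V.Homogeneous Z Δ →
      V.L 0 (V.toF Z) = ((Δ + ∑ I, V.hx I + ∑ K, V.hy K : ℝ) : ℂ) • V.toF Z := fun Δ h => by
    refine (SLEVir.virOp_zero_C _ _ Z).trans ?_
    rw [SLEVir.sum_coord_mul_partialDeriv h, SLEVir.C_smul, Fintype.sum_sum_type, ← add_smul,
      add_assoc]
    push_cast
    rfl
  have hne : V.toF Z ≠ 0 := fun h => by
    have hz : Z = 0 := MvPolynomial.C_injective _ _ (h.trans (map_zero _).symm)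
    -- The initial configuration lies in the chamber, which is therefore nonempty, and positivity
    -- there excludes Z = 0.
    obtain ⟨r, hr, hr'⟩ := hpos ⟨V.init, fun _ _ h => h⟩
    rw [hz] at hr'
    exact hr.ne (Complex.ofReal_injective hr')
  refine ⟨SLEVir.isVirSubmodule_cyclic _ _, SLEVir.cyclic_le hker hZ, h2,
    SLEVir.cyclic_eq_span hT h2, h1, h0, fun Δ hc hd => ?_⟩
  refine ⟨SLEVir.isVirSubmodule_cyclic _ _, rfl, hne, fun n hn => ?_, ?_, fun w _ => ?_⟩
  · rw [SLEVir.virRep_L]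
    rcases eq_or_lt_of_le (Int.add_one_le_iff.2 hn) with h | h
    · obtain rfl : n = 1 := by omega
      exact h1 hc
    · exact h2 n (by omega)
  · rw [SLEVir.virRep_L]
    exact h0 Δ hd
  · rw [SLEVir.virRep_C]
    rfl
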